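/- Let $F$ be a field of characteristic not $2$ and let $H$ be a quaternion algebra over $F$, i.e. $H\cong\left(\frac{a,b}{F}\right)$ for some $a,b\in F^\times$, with standard involution $x\mapsto\overline{x}$ and reduced norm $\mathrm{nrm}(x)=x\overline{x}$. Let $\ddagger$ be an orthogonal involution of $H$, i.e. an $F$-linear map with $(xy)^\ddagger=y^\ddagger x^\ddagger$ and $(x^\ddagger)^\ddagger=x$ which is not the standard involution; extend $\ddagger$ and $\overline{\phantom{x}}$ $R$-linearly to $H_R=R\otimes_F H$ for every commutative $F$-algebra $R$. Put $H^+=\{z\in H: z^\ddagger=z\}$, $H_R^+=\{z\in H_R: z^\ddagger=z\}$, and define a quadratic form on $F^2\oplus H^+$ by $$q_H(s,t,z)=st-\mathrm{nrm}(z).$$ Consider the following group functors on commutative $F$-algebras $R$: * $SL^\ddagger(2,H)$, whose $R$-points are the matrices $\begin{pmatrix}a&b\\c&d\end{pmatrix}\in\mathrm{GL}_2(H_R)$ with $ab^\ddagger\in H_R^+$, $cd^\ddagger\in H_R^+$ and $ad^\ddagger-bc^\ddagger=1$; * $\{\pm I\}$, the constant subgroup of $SL^\ddagger(2,H)$, whose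 $R$-points are the matrices $eI-(1-e)I$ with $e\in R$ idempotent; * $SO(q_H)$, whose $R$-points are the $R$-linear automorphisms of $R\otimes_F(F^2\oplus H^+)$ of determinant $1$ preserving the base change of $q_H$; and its identity component $SO^0(q_H)$. **Theorem.** For every commutative $F$-algebra $R$ the map $(s,t,z)\mapsto\begin{pmatrix}s&z\\\overline{z}&t\end{pmatrix}$ (extended $R$-linearly) is a bijection from $R\otimes_F(F^2\oplus H^+)$ onto the set of matrices $M\in\mathrm{Mat}(2,H_R)$ with $\overline{M}^T=M$ and upper right entry in $H_R^+$. Under this identification the action $\gamma\cdot M=\gamma M\overline{\gamma}^T$ defines a homomorphism $SL^\ddagger(2,H)\to SO(q_H)$ with values in $SO^0(q_H)$, and the sequence $$1\to\{\pm I\}\to SL^\ddagger(2,H)\to SO^0(q_H)\to 1$$ is an exact sequence of algebraic groups over $F$. That is, all three functors are group functors represented by finitely generated $F$-algebras; for every $R$ the kernel of $SL^\ddagger(2,H)(R)\to SO^0(q_H)(R)$ is $\{\pm I\}(R)$; and for every $R$ and every $g\in SO^0(q_H)(R)$ there are a faithfully flat, finitely presented $R$-algebra $S$ (commutative) and an element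 of $SL^\ddagger(2,H)(S)$ mapping to the image of $g$ in $SO^0(q_H)(S)$. -/

import Mathlib

open CategoryTheory
open scoped TensorProduct Quaternion Matrix

universe u v w

noncomputable section

/-! ### Quaternion algebras, the standard involution and orthogonal involutions -/

section Quaternion

theorem trace_mul_quaternion {F : Type u} [Field F] (a b : F) (x : ℍ[F,a,b]) :
    LinearMap.trace F ℍ[F,a,b] (LinearMap.mul F ℍ[F,a,b] x) = 4 * x.re := by
  have h (i : Fin 4) : (QuaternionAlgebra.basisOneIJK a 0 b) i
      = ⟨(Pi.single i 1 : Fin 4 → F) 0, (Pi.single i 1 : Fin 4 → F) 1,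
        (Pi.single i 1 : Fin 4 → F) 2, (Pi.single i 1 : Fin 4 → F) 3⟩ := by
    rw [QuaternionAlgebra.basisOneIJK, Module.Basis.coe_ofEquivFun]
    rfl
  rw [LinearMap.trace_eq_matrix_trace F (QuaternionAlgebra.basisOneIJK a 0 b)]
  simp only [Matrix.trace, Fin.sum_univ_four, Matrix.diag_apply, LinearMap.toMatrix_apply,
    LinearMap.mul_apply', QuaternionAlgebra.coe_basisOneIJK_repr, h]
  simp
  ring

variable (F : Type u) [Field F] (H : Type v) [Ring H] [Algebra F H]

/-- `H` is a quaternion algebra over the field `F` (of characteristic not `2`): it is isomorphic to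
the algebra `(a, b / F)` generated by `i, j` with `i² = a`, `j² = b`, `ij = -ji`, for some nonzero
`a, b`. -/
class IsQuaternionAlgebra : Prop where
  exists_algEquiv : ∃ a b : F, a ≠ 0 ∧ b ≠ 0 ∧ Nonempty (H ≃ₐ[F] ℍ[F,a,b])

instance IsQuaternionAlgebra.finite [h : IsQuaternionAlgebra F H] : Module.Finite F H := by
  obtain ⟨a, b, -, -, ⟨e⟩⟩ := h.exists_algEquiv
  exact Module.Finite.equiv e.symm.toLinearEquiv

variable [Invertible (2 : F)]

/-- The reduced trace of a quaternion algebra. The trace of left multiplication on a central simple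
algebra of degree `2` is twice the reduced trace. -/
def redTrace : H →ₗ[F] F := ⅟(2 : F) • (LinearMap.trace F H ∘ₗ LinearMap.mul F H)

/-- The standard involution `x ↦ x̄ = trd(x) - x` of a quaternion algebra. -/
def conjQ : H →ₗ[F] H := (Algebra.linearMap F H).comp (redTrace F H) - LinearMap.id

/-- The reduced norm `nrm(x) = x x̄` of a quaternion algebra, as an `F`-valued quadratic form. As
`x x̄` is a scalar, it is half its own reduced trace. -/
def nrmQ : QuadraticForm F H :=
  LinearMap.BilinMap.toQuadraticMap
    (((LinearMap.mul F H).compl₂ (conjQ F H)).compr₂ (⅟(2 : F) • redTrace F H))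

variable {F H}

theorem redTrace_eq (a b : F) (e : H ≃ₐ[F] ℍ[F,a,b]) (x : H) :
    redTrace F H x = 2 * (e x).re := by
  have h : LinearMap.mul F ℍ[F,a,b] (e x) = e.toLinearEquiv.conj (LinearMap.mul F H x) := by
    ext1 y
    simp [LinearEquiv.conj_apply]
  have h2 : (2 : F) ≠ 0 := Invertible.ne_zero 2
  have h3 : redTrace F H x = ⅟(2 : F) * LinearMap.trace F H (LinearMap.mul F H x) := rfl
  rw [h3, ← LinearMap.trace_conj' _ e.toLinearEquiv, ← h, trace_mul_quaternion, invOf_eq_inv]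
  field_simp
  norm_num

/-- `conjQ` is the usual conjugation `w + xi + yj + zij ↦ w - xi - yj - zij`, in every
presentation of `H`. -/
theorem conjQ_eq_star (a b : F) (e : H ≃ₐ[F] ℍ[F,a,b]) (x : H) :
    conjQ F H x = e.symm (star (e x)) := by
  have h : conjQ F H x = algebraMap F H (redTrace F H x) - x := rfl
  apply e.injective
  rw [h, map_sub, AlgEquiv.commutes, AlgEquiv.apply_symm_apply]
  have ht := redTrace_eq a b e x
  generalize redTrace F H x = t at ht
  ext <;> simp
  linear_combination ht

/-- `nrmQ` is the reduced norm. -/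
theorem algebraMap_nrmQ [h : IsQuaternionAlgebra F H] (x : H) :
    algebraMap F H (nrmQ F H x) = x * conjQ F H x := by
  obtain ⟨a, b, -, -, ⟨e⟩⟩ := h.exists_algEquiv
  have h1 : nrmQ F H x = ⅟(2 : F) * redTrace F H (x * conjQ F H x) := rfl
  apply e.injective
  rw [h1, redTrace_eq a b e, invOf_mul_cancel_left, map_mul, conjQ_eq_star a b e,
    AlgEquiv.apply_symm_apply, AlgEquiv.commutes]
  ext <;> simp <;> ring

/-- An orthogonal involution of a quaternion algebra: an `F`-linear involution (of the first kind)
other than the standard involution. -/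
structure IsOrthogonalInvolution (φ : H →ₗ[F] H) : Prop where
  map_mul : ∀ x y, φ (x * y) = φ y * φ x
  involutive : ∀ x, φ (φ x) = x
  ne_conj : φ ≠ conjQ F H

/-- `H⁺`, the subspace on which the involution `φ` is the identity. -/
def symmPart (φ : H →ₗ[F] H) : Submodule F H := LinearMap.eqLocus φ LinearMap.id

/-- The quadratic form `q_H(s, t, z) = s t - nrm(z)` on `F² ⊕ H⁺`. -/
def qH (φ : H →ₗ[F] H) : QuadraticForm F (F × F × symmPart φ) :=
  QuadraticMap.linMulLin (LinearMap.fst F F (F × symmPart φ))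
      (LinearMap.fst F F (symmPart φ) ∘ₗ LinearMap.snd F F (F × symmPart φ)) -
    (nrmQ F H).comp ((symmPart φ).subtype ∘ₗ LinearMap.snd F F (symmPart φ) ∘ₗ
      LinearMap.snd F F (F × symmPart φ))

theorem qH_apply (φ : H →ₗ[F] H) (s t : F) (z : symmPart φ) :
    qH φ (s, t, z) = s * t - nrmQ F H z := rfl

end Quaternion

/-! ### Algebraic groups and exact sequences, through the functor of points -/

section GroupFunctor

variable {F : Type u} [Field F]

variable (F) in
/-- Group-valued functors on commutative `F`-algebras. -/
abbrev GroupFunctor := CommAlgCat.{u} F ⥤ GrpCat.{w}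

namespace GroupFunctor

/-- `G` is an (affine) algebraic group over `F`: a group functor represented by a finitely
generated `F`-algebra. -/
def IsAlgebraicGroup (G : GroupFunctor.{u, w} F) : Prop :=
  ∃ A : CommAlgCat.{u} F, Algebra.FiniteType F A ∧
    Nonempty ((G ⋙ forget GrpCat).CorepresentableBy A)

/-- The `R`-points `g` of `G = Spec A` such that the morphism `g : Spec R → Spec A` lands in the
connected component of the identity point `Spec F → Spec A`. (The condition does not depend on the
choice of the representing algebra `A`, which is unique up to unique isomorphism.) -/
def identityComponentPoints (G : GroupFunctor.{u, w} F) (R : CommAlgCat.{u} F) :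
    Set (G.obj R) :=
  {g | ∀ (A : CommAlgCat.{u} F) (r : (G ⋙ forget GrpCat).CorepresentableBy A)
      (x : PrimeSpectrum R),
    PrimeSpectrum.comap (r.homEquiv.symm g).hom.toRingHom x ∈
      connectedComponent (PrimeSpectrum.comap
        (r.homEquiv.symm (1 : G.obj (CommAlgCat.of F F))).hom.toRingHom (⊥ : PrimeSpectrum F))}

/-- `j : G₀ ⟶ G` is the inclusion of the identity component `G⁰` of `G`. -/
structure IsIdentityComponent {G₀ G : GroupFunctor.{u, w} F} (j : G₀ ⟶ G) : Prop where
  injective : ∀ R, Function.Injective (j.app R)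
  range_eq : ∀ R, Set.range (j.app R) = identityComponentPoints G R

/-- `1 → N → G → Q → 1` (with maps `i`, `p`) is an exact sequence of algebraic groups: `N`, `G`, `Q`
are algebraic groups, `i` is the kernel of `p` (on the points in every commutative `F`-algebra), and
`p` is an epimorphism of fppf sheaves, i.e. every point of `Q` lifts to `G` after a faithfully flat
and finitely presented extension of its ring of definition. -/
structure IsExactSequence {N G Q : GroupFunctor.{u, w} F} (i : N ⟶ G) (p : G ⟶ Q) : Prop where
  algebraic_left : N.IsAlgebraicGroup
  algebraic_middle : G.IsAlgebraicGroup
  algebraic_right : Q.IsAlgebraicGroup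
  injective : ∀ R, Function.Injective (i.app R)
  exact : ∀ R (g : G.obj R), p.app R g = 1 ↔ g ∈ Set.range (i.app R)
  surjective : ∀ R (x : Q.obj R), ∃ (S : CommAlgCat.{u} F) (f : R ⟶ S),
    f.hom.toRingHom.FaithfullyFlat ∧ f.hom.toRingHom.FinitePresentation ∧
      ∃ g : G.obj S, p.app S g = Q.map f x

end GroupFunctor

end GroupFunctor

/-! ### The special orthogonal group of a quadratic form -/

section SpecialOrthogonal

variable {F : Type u} [Field F]
  {V : Type v} [AddCommGroup V] [Module F V]

variable {R S T : Type u} [CommRing R] [Algebra F R] [CommRing S] [Algebra F S]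
  [CommRing T] [Algebra F T]

/-- The `S`-linear extension of an `R`-linear endomorphism of `R ⊗ V` along `f : R → S`, that is,
the endomorphism `g'` of `S ⊗ V` with `g' ∘ (f ⊗ 1) = (f ⊗ 1) ∘ g`. -/
def extendScalars (f : R →ₐ[F] S) (g : R ⊗[F] V →ₗ[R] R ⊗[F] V) : S ⊗[F] V →ₗ[S] S ⊗[F] V :=
  LinearMap.liftBaseChange S
    ((f.toLinearMap.rTensor V) ∘ₗ (g.restrictScalars F) ∘ₗ (TensorProduct.mk F R V 1))

theorem extendScalars_one_tmul (f : R →ₐ[F] S) (g : R ⊗[F] V →ₗ[R] R ⊗[F] V) (v : V) :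
    extendScalars f g (1 ⊗ₜ v) = f.toLinearMap.rTensor V (g (1 ⊗ₜ v)) := by
  simp [extendScalars]

theorem rTensor_smul (f : R →ₐ[F] S) (r : R) (x : R ⊗[F] V) :
    f.toLinearMap.rTensor V (r • x) = f r • f.toLinearMap.rTensor V x := by
  induction x with
  | zero => simp
  | tmul a v => simp [TensorProduct.smul_tmul']
  | add x y hx hy => simp [hx, hy]

theorem extendScalars_rTensor (f : R →ₐ[F] S) (g : R ⊗[F] V →ₗ[R] R ⊗[F] V) (x : R ⊗[F] V) :
    extendScalars f g (f.toLinearMap.rTensor V x) = f.toLinearMap.rTensor V (g x) := by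
  induction x with
  | zero => simp
  | tmul a v =>
    have : a ⊗ₜ[F] v = a • ((1 : R) ⊗ₜ[F] v) := by simp [TensorProduct.smul_tmul']
    rw [this, rTensor_smul, map_smul, map_smul, rTensor_smul, ← extendScalars_one_tmul]
    simp
  | add x y hx hy => simp [hx, hy]

theorem ext_one_tmul {g h : R ⊗[F] V →ₗ[R] R ⊗[F] V} (H : ∀ v, g (1 ⊗ₜ v) = h (1 ⊗ₜ v)) :
    g = h := by
  ext v
  simpa using H v

theorem extendScalars_id (f : R →ₐ[F] S) :
    extendScalars (V := V) f LinearMap.id = LinearMap.id :=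
  ext_one_tmul fun v => by simp [extendScalars_one_tmul]

theorem extendScalars_comp (f : R →ₐ[F] S) (g h : R ⊗[F] V →ₗ[R] R ⊗[F] V) :
    extendScalars f (g ∘ₗ h) = extendScalars f g ∘ₗ extendScalars f h :=
  ext_one_tmul fun v => by
    rw [LinearMap.comp_apply, extendScalars_one_tmul, extendScalars_one_tmul,
      extendScalars_rTensor, LinearMap.comp_apply]

theorem extendScalars_idHom (g : R ⊗[F] V →ₗ[R] R ⊗[F] V) :
    extendScalars (AlgHom.id F R) g = g :=
  ext_one_tmul fun v => by
    rw [extendScalars_one_tmul]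
    exact LinearMap.congr_fun (LinearMap.rTensor_id V R) _

theorem extendScalars_compHom (f : R →ₐ[F] S) (f' : S →ₐ[F] T) (g : R ⊗[F] V →ₗ[R] R ⊗[F] V) :
    extendScalars (f'.comp f) g = extendScalars f' (extendScalars f g) :=
  ext_one_tmul fun v => by
    rw [extendScalars_one_tmul, extendScalars_one_tmul, extendScalars_one_tmul]
    exact LinearMap.congr_fun
      (LinearMap.rTensor_comp V f'.toLinearMap f.toLinearMap) (g (1 ⊗ₜ v))

theorem det_extendScalars [Module.Finite F V] (f : R →ₐ[F] S) (g : R ⊗[F] V →ₗ[R] R ⊗[F] V) :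
    LinearMap.det (extendScalars f g) = f (LinearMap.det g) := by
  classical
  let b := Module.finBasis F V
  rw [← LinearMap.det_toMatrix (b.baseChange S), ← LinearMap.det_toMatrix (b.baseChange R),
    AlgHom.map_det]
  congr 1
  ext i j
  rw [LinearMap.toMatrix_apply, AlgHom.mapMatrix_apply, Matrix.map_apply, LinearMap.toMatrix_apply,
    Module.Basis.baseChange_apply, Module.Basis.baseChange_apply, extendScalars_one_tmul]
  generalize g (1 ⊗ₜ b j) = x
  induction x with
  | zero => simp
  | tmul a v => simp [Module.Basis.baseChange_repr_tmul]
  | add x y hx hy => simp [hx, hy]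

/-- Base change of linear automorphisms. -/
def extendAut (f : R →ₐ[F] S) :
    ((R ⊗[F] V) ≃ₗ[R] (R ⊗[F] V)) →* ((S ⊗[F] V) ≃ₗ[S] (S ⊗[F] V)) where
  toFun g := LinearEquiv.ofLinearMap (extendScalars f g.toLinearMap)
    (extendScalars f g.symm.toLinearMap)
    (by rw [← extendScalars_comp, LinearEquiv.comp_symm, extendScalars_id])
    (by rw [← extendScalars_comp, LinearEquiv.symm_comp, extendScalars_id])
  map_one' := LinearEquiv.toLinearMap_injective (extendScalars_id f)
  map_mul' g h := LinearEquiv.toLinearMap_injective (extendScalars_comp f g.toLinearMap h.toLinearMap)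

variable [Invertible (2 : F)]

/-- The `R`-points of `SO(q)`: the `R`-linear automorphisms of `R ⊗ V` of determinant `1` which
preserve the base change of `q` to `R`. -/
def soPoints (q : QuadraticForm F V) (R : Type u) [CommRing R] [Algebra F R] :
    Subgroup ((R ⊗[F] V) ≃ₗ[R] (R ⊗[F] V)) where
  carrier := {g | (∀ x, q.baseChange R (g x) = q.baseChange R x) ∧
    LinearMap.det (g : R ⊗[F] V →ₗ[R] R ⊗[F] V) = 1}
  mul_mem' := by
    rintro g h ⟨hg, hg'⟩ ⟨hh, hh'⟩
    refine ⟨fun x => by rw [LinearEquiv.mul_apply, hg, hh], ?_⟩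
    have : ((g * h : (R ⊗[F] V) ≃ₗ[R] (R ⊗[F] V)) : R ⊗[F] V →ₗ[R] R ⊗[F] V) =
      (g : R ⊗[F] V →ₗ[R] R ⊗[F] V) * (h : R ⊗[F] V →ₗ[R] R ⊗[F] V) := rfl
    rw [this, map_mul, hg', hh', one_mul]
  one_mem' := ⟨fun x => rfl, LinearMap.det_id⟩
  inv_mem' := by
    rintro g ⟨hg, hg'⟩
    refine ⟨fun x => by
      rw [← hg (g⁻¹ x), ← LinearEquiv.mul_apply, mul_inv_cancel]; rfl, ?_⟩
    have h := LinearEquiv.det_symm_mul_det g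
    rwa [hg', mul_one] at h

theorem baseChange_rTensor (q : QuadraticForm F V) (f : R →ₐ[F] S) (x : R ⊗[F] V) :
    q.baseChange S (f.toLinearMap.rTensor V x) = f (q.baseChange R x) := by
  let : Invertible (2 : R) := (Invertible.map (algebraMap F R) 2).copy 2 (map_ofNat _ _).symm
  let : Invertible (2 : S) := (Invertible.map (algebraMap F S) 2).copy 2 (map_ofNat _ _).symm
  induction x with
  | zero => simp
  | tmul a v => simp [QuadraticForm.baseChange_tmul]
  | add x y hx hy =>
    have key : ∀ x y : R ⊗[F] V,
        QuadraticMap.polarBilin (q.baseChange S) (f.toLinearMap.rTensor V x)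
          (f.toLinearMap.rTensor V y) = f (QuadraticMap.polarBilin (q.baseChange R) x y) := by
      intro x y
      rw [QuadraticForm.polarBilin_baseChange, QuadraticForm.polarBilin_baseChange]
      induction x with
      | zero => simp
      | add x x' hx hx' => simp only [map_add, LinearMap.add_apply, hx, hx']
      | tmul a v =>
        induction y with
        | zero => simp
        | add y y' hy hy' => simp only [map_add, hy, hy']
        | tmul b w => simp [LinearMap.BilinForm.baseChange_tmul]
    have h := key x y
    simp only [QuadraticMap.polarBilin_apply_apply, QuadraticMap.polar, map_sub, hx, hy] at h
    rw [map_add]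
    have h' := congrArg (fun t => t + f (q.baseChange R y) + f (q.baseChange R x)) h
    simpa using h'

theorem extendAut_mem [Module.Finite F V] (q : QuadraticForm F V) (f : R →ₐ[F] S)
    {g : (R ⊗[F] V) ≃ₗ[R] (R ⊗[F] V)} (hg : g ∈ soPoints q R) : extendAut f g ∈ soPoints q S := by
  refine ⟨fun x => ?_, ?_⟩
  · have : (q.baseChange S).comp (extendScalars f g.toLinearMap) = q.baseChange S := by
      apply baseChange_ext
      intro v
      rw [QuadraticMap.comp_apply, extendScalars_one_tmul, baseChange_rTensor]
      erw [hg.1]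
      rw [← baseChange_rTensor]
      simp
    exact DFunLike.congr_fun this x
  · have : ((extendAut f g : (S ⊗[F] V) ≃ₗ[S] (S ⊗[F] V)) : S ⊗[F] V →ₗ[S] S ⊗[F] V) =
      extendScalars f g.toLinearMap := rfl
    rw [this, det_extendScalars, hg.2, map_one]

/-- The special orthogonal group `SO(q)` as a group functor. -/
def SO [Module.Finite F V] (q : QuadraticForm F V) : GroupFunctor.{u, max u v} F where
  obj R := GrpCat.of (soPoints q R)
  map {R S} f := GrpCat.ofHom (((extendAut f.hom).comp (soPoints q R).subtype).codRestrict
    (soPoints q S) fun g => extendAut_mem q f.hom g.2)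
  map_id R := by
    refine GrpCat.ext fun g => ?_
    exact Subtype.ext (LinearEquiv.toLinearMap_injective (extendScalars_idHom _))
  map_comp f g := by
    refine GrpCat.ext fun g => ?_
    exact Subtype.ext (LinearEquiv.toLinearMap_injective (extendScalars_compHom _ _ _))

end SpecialOrthogonal

/-! ### The group `SL^‡(2, H)` -/

section SLddag

variable {F : Type u} [Field F] {H : Type v} [Ring H] [Algebra F H]
  {R S : Type u} [CommRing R] [Algebra F R] [CommRing S] [Algebra F S]

theorem baseChange_mul_rev {φ : H →ₗ[F] H} (hφ : ∀ x y, φ (x * y) = φ y * φ x)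
    (x y : R ⊗[F] H) : φ.baseChange R (x * y) = φ.baseChange R y * φ.baseChange R x := by
  induction x with
  | zero => simp
  | add x x' hx hx' => simp only [add_mul, mul_add, map_add, hx, hx']
  | tmul a v =>
    induction y with
    | zero => simp
    | add y y' hy hy' => simp only [add_mul, mul_add, map_add, hy, hy']
    | tmul b w => simp [hφ, mul_comm]

theorem baseChange_invol {φ : H →ₗ[F] H} (hφ : ∀ x, φ (φ x) = x)
    (x : R ⊗[F] H) : φ.baseChange R (φ.baseChange R x) = x := by
  induction x with
  | zero => simp
  | add x x' hx hx' => simp only [map_add, hx, hx']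
  | tmul a v => simp [hφ]

theorem map_one_of_invol {φ : H →ₗ[F] H} (h1 : ∀ x y, φ (x * y) = φ y * φ x)
    (h2 : ∀ x, φ (φ x) = x) : φ 1 = 1 := by
  have h := h1 (φ 1) 1
  rw [mul_one, h2, mul_one] at h
  exact h.symm

theorem baseChange_map (φ : H →ₗ[F] H) (f : R →ₐ[F] S) (x : R ⊗[F] H) :
    φ.baseChange S (Algebra.TensorProduct.map f (AlgHom.id F H) x) =
      Algebra.TensorProduct.map f (AlgHom.id F H) (φ.baseChange R x) := by
  induction x with
  | zero => simp
  | add x x' hx hx' => simp only [map_add, hx, hx']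
  | tmul a v => simp

/-- The defining conditions of `SL^‡(2, H)` for a matrix with rows `(a, b)`, `(c, d)` and entries in
`H_R = R ⊗ H`: `a b^‡ ∈ H_R⁺`, `c d^‡ ∈ H_R⁺` and `a d^‡ - b c^‡ = 1`, where `H_R⁺` consists of
the fixed points of `‡`. -/
def IsSLddag (φ : H →ₗ[F] H) (M : Matrix (Fin 2) (Fin 2) (R ⊗[F] H)) : Prop :=
  φ.baseChange R (M 0 0 * φ.baseChange R (M 0 1)) = M 0 0 * φ.baseChange R (M 0 1) ∧
  φ.baseChange R (M 1 0 * φ.baseChange R (M 1 1)) = M 1 0 * φ.baseChange R (M 1 1) ∧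
  M 0 0 * φ.baseChange R (M 1 1) - M 0 1 * φ.baseChange R (M 1 0) = 1

/-- The transpose of a `2 × 2` matrix, with `‡` applied to the entries. -/
def ddagTranspose (φ : H →ₗ[F] H) (M : Matrix (Fin 2) (Fin 2) (R ⊗[F] H)) :
    Matrix (Fin 2) (Fin 2) (R ⊗[F] H) :=
  (M.map (φ.baseChange R))ᵀ

theorem isSLddag_iff {φ : H →ₗ[F] H} (h1 : ∀ x y, φ (x * y) = φ y * φ x)
    (h2 : ∀ x, φ (φ x) = x) (M : Matrix (Fin 2) (Fin 2) (R ⊗[F] H)) :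
    IsSLddag φ M ↔ M * !![0, 1; -1, 0] * ddagTranspose φ M = !![0, 1; -1, 0] := by
  have hone : φ.baseChange R (1 : R ⊗[F] H) = 1 := by
    simp [Algebra.TensorProduct.one_def, map_one_of_invol h1 h2]
  simp only [IsSLddag, ← Matrix.ext_iff, Fin.forall_fin_two, Matrix.mul_apply, Fin.sum_univ_two,
    ddagTranspose, Matrix.transpose_apply, Matrix.map_apply, baseChange_mul_rev h1,
    baseChange_invol h2]
  simp only [Matrix.of_apply, Matrix.cons_val', Matrix.cons_val_zero, Matrix.cons_val_one,
    Matrix.cons_val_fin_one, mul_zero, mul_one, mul_neg, zero_add, add_zero, neg_mul]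
  constructor
  · rintro ⟨ha, hc, hd⟩
    refine ⟨⟨?_, ?_⟩, ?_, ?_⟩
    · rw [ha]; abel
    · rw [← hd]; abel
    · have := congrArg (φ.baseChange R) hd
      rw [map_sub, baseChange_mul_rev h1, baseChange_mul_rev h1, baseChange_invol h2,
        baseChange_invol h2, hone] at this
      rw [← this]; abel
    · rw [hc]; abel
  · rintro ⟨⟨ha, hd⟩, -, hc⟩
    refine ⟨?_, ?_, ?_⟩
    · exact (neg_add_eq_zero.mp ha)
    · exact (neg_add_eq_zero.mp hc)
    · rw [← hd]; abel

theorem ddagTranspose_mul {φ : H →ₗ[F] H} (h1 : ∀ x y, φ (x * y) = φ y * φ x)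
    (M N : Matrix (Fin 2) (Fin 2) (R ⊗[F] H)) :
    ddagTranspose φ (M * N) = ddagTranspose φ N * ddagTranspose φ M := by
  ext i j
  simp [ddagTranspose, Matrix.mul_apply, baseChange_mul_rev h1]

theorem ddagTranspose_one {φ : H →ₗ[F] H} (h1 : ∀ x y, φ (x * y) = φ y * φ x)
    (h2 : ∀ x, φ (φ x) = x) :
    ddagTranspose φ (1 : Matrix (Fin 2) (Fin 2) (R ⊗[F] H)) = 1 := by
  have hone : φ.baseChange R (1 : R ⊗[F] H) = 1 := by
    simp [Algebra.TensorProduct.one_def, map_one_of_invol h1 h2]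
  rw [ddagTranspose, Matrix.map_one _ (map_zero _) hone, Matrix.transpose_one]

theorem IsSLddag.map {φ : H →ₗ[F] H} {M : Matrix (Fin 2) (Fin 2) (R ⊗[F] H)} (hM : IsSLddag φ M)
    (f : R →ₐ[F] S) :
    IsSLddag φ ((Algebra.TensorProduct.map f (AlgHom.id F H)).mapMatrix M) := by
  obtain ⟨ha, hc, hd⟩ := hM
  refine ⟨?_, ?_, ?_⟩
  · simp only [AlgHom.mapMatrix_apply, Matrix.map_apply, baseChange_map, ← map_mul, ha]
  · simp only [AlgHom.mapMatrix_apply, Matrix.map_apply, baseChange_map, ← map_mul, hc]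
  · simp only [AlgHom.mapMatrix_apply, Matrix.map_apply, baseChange_map, ← map_mul, ← map_sub, hd,
      map_one]

/-- Extension of scalars on invertible matrices. -/
def mapGL (f : R →ₐ[F] S) :
    (Matrix (Fin 2) (Fin 2) (R ⊗[F] H))ˣ →* (Matrix (Fin 2) (Fin 2) (S ⊗[F] H))ˣ :=
  Units.map ((Algebra.TensorProduct.map f (AlgHom.id F H)).mapMatrix (m := Fin 2)).toMonoidHom

theorem mapGL_id (γ : (Matrix (Fin 2) (Fin 2) (R ⊗[F] H))ˣ) : mapGL (AlgHom.id F R) γ = γ := by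
  apply Units.ext
  ext i j
  simp [mapGL]

theorem mapGL_comp {T : Type u} [CommRing T] [Algebra F T] (f : R →ₐ[F] S) (f' : S →ₐ[F] T)
    (γ : (Matrix (Fin 2) (Fin 2) (R ⊗[F] H))ˣ) : mapGL (f'.comp f) γ = mapGL f' (mapGL f γ) := by
  apply Units.ext
  ext i j
  have : Algebra.TensorProduct.map (f'.comp f) (AlgHom.id F H) =
      (Algebra.TensorProduct.map f' (AlgHom.id F H)).comp
        (Algebra.TensorProduct.map f (AlgHom.id F H)) := by
    ext <;> simp
  simp [mapGL, this]

variable [Invertible (2 : F)] {φ : H →ₗ[F] H}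

variable (R) in
/-- The group `SL^‡(2, H_R)` of the matrices satisfying `IsSLddag`, under matrix multiplication.
(Such matrices are automatically invertible when `H` is finite-dimensional.) -/
def slPoints (hφ : IsOrthogonalInvolution φ) :
    Subgroup (Matrix (Fin 2) (Fin 2) (R ⊗[F] H))ˣ where
  carrier := {γ | IsSLddag φ (γ : Matrix (Fin 2) (Fin 2) (R ⊗[F] H))}
  mul_mem' {γ δ} hγ hδ := by
    rw [Set.mem_ofPred_eq, isSLddag_iff hφ.map_mul hφ.involutive] at *
    rw [Units.val_mul, ddagTranspose_mul hφ.map_mul]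
    calc _ = γ.val * (δ.val * !![0, 1; -1, 0] * ddagTranspose φ δ.val) * ddagTranspose φ γ.val := by
          simp only [mul_assoc]
      _ = _ := by rw [hδ, hγ]
  one_mem' := by
    rw [Set.mem_ofPred_eq, isSLddag_iff hφ.map_mul hφ.involutive, Units.val_one,
      ddagTranspose_one hφ.map_mul hφ.involutive, one_mul, mul_one]
  inv_mem' {γ} hγ := by
    rw [Set.mem_ofPred_eq, isSLddag_iff hφ.map_mul hφ.involutive] at *
    calc _ = γ⁻¹.val * (γ.val * !![0, 1; -1, 0] * ddagTranspose φ γ.val) *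
            ddagTranspose φ γ⁻¹.val := by rw [hγ]
      _ = (γ⁻¹.val * γ.val) * !![0, 1; -1, 0] * ddagTranspose φ (γ⁻¹.val * γ.val) := by
          rw [ddagTranspose_mul hφ.map_mul]; simp only [mul_assoc]
      _ = _ := by
          rw [Units.inv_mul, ddagTranspose_one hφ.map_mul hφ.involutive, one_mul, mul_one]

/-- The group functor `SL^‡(2, H)`. -/
def SLddag (hφ : IsOrthogonalInvolution φ) : GroupFunctor.{u, max u v} F where
  obj R := GrpCat.of (slPoints R hφ)
  map {R S} f := GrpCat.ofHom (((mapGL f.hom).comp (slPoints R hφ).subtype).codRestrict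
    (slPoints S hφ) fun γ => IsSLddag.map γ.2 f.hom)
  map_id R := by
    refine GrpCat.ext fun γ => ?_
    exact Subtype.ext (mapGL_id _)
  map_comp f g := by
    refine GrpCat.ext fun γ => ?_
    exact Subtype.ext (mapGL_comp _ _ _)

variable (R) in
/-- The `R`-points of the constant subgroup `{±I}` of `SL^‡(2, H)`: the matrices that are locally
on `Spec R` equal to `I` or to `-I`, i.e. `I` where an idempotent `e` of `R` is `1`, and `-I` where
`e` is `0`. -/
def pmPoints (hφ : IsOrthogonalInvolution φ) : Subgroup (slPoints R hφ) where
  carrier := {γ | ∃ e : R, e * e = e ∧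
    (γ : (Matrix (Fin 2) (Fin 2) (R ⊗[F] H))ˣ).val = e • 1 + (1 - e) • (-1)}
  mul_mem' := by
    rintro γ δ ⟨e, he, hγ⟩ ⟨f, hf, hδ⟩
    refine ⟨e * f + (1 - e) * (1 - f), by grind, ?_⟩
    rw [Subgroup.coe_mul, Units.val_mul, hγ, hδ]
    simp only [add_mul, mul_add, smul_mul_smul_comm, mul_one, mul_neg, neg_neg]
    module
  one_mem' := ⟨1, by simp, by simp⟩
  inv_mem' := by
    rintro γ ⟨e, he, hγ⟩
    refine ⟨e, he, ?_⟩
    have hsq : (γ : (Matrix (Fin 2) (Fin 2) (R ⊗[F] H))ˣ) *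
        (γ : (Matrix (Fin 2) (Fin 2) (R ⊗[F] H))ˣ) = 1 := by
      apply Units.ext
      rw [Units.val_mul, hγ, Units.val_one]
      have h1 : (e - (1 - e)) * (e - (1 - e)) = 1 := by grind
      have h2 : e • (1 : Matrix (Fin 2) (Fin 2) (R ⊗[F] H)) + (1 - e) • (-1) =
        (e - (1 - e)) • 1 := by module
      rw [h2, smul_mul_smul_comm, h1, one_smul, mul_one]
    rw [Subgroup.coe_inv, inv_eq_of_mul_eq_one_left hsq, hγ]

theorem pmPoints_map (hφ : IsOrthogonalInvolution φ) {R S : CommAlgCat.{u} F} (f : R ⟶ S)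
    {γ : slPoints R hφ} (hγ : γ ∈ pmPoints R hφ) :
    ((SLddag hφ).map f).hom γ ∈ pmPoints S hφ := by
  obtain ⟨e, he, h⟩ := hγ
  refine ⟨f.hom e, by rw [← map_mul, he], ?_⟩
  change (Algebra.TensorProduct.map f.hom (AlgHom.id F H)).mapMatrix
    (γ : (Matrix (Fin 2) (Fin 2) (R ⊗[F] H))ˣ).val = _
  rw [h]
  have hs : ∀ (r : R) (M : Matrix (Fin 2) (Fin 2) (R ⊗[F] H)),
      (Algebra.TensorProduct.map f.hom (AlgHom.id F H)).mapMatrix (r • M) =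
        f.hom r • (Algebra.TensorProduct.map f.hom (AlgHom.id F H)).mapMatrix M := by
    intro r M
    ext i j
    simp only [AlgHom.mapMatrix_apply, Matrix.map_apply, Matrix.smul_apply]
    rw [Algebra.smul_def, map_mul, Algebra.smul_def]
    simp
  rw [map_add, hs, hs, map_neg, map_one, map_sub, map_one]

/-- The group functor `{±I}`. -/
def PlusMinusOne (hφ : IsOrthogonalInvolution φ) : GroupFunctor.{u, max u v} F where
  obj R := GrpCat.of (pmPoints R hφ)
  map {R S} f := GrpCat.ofHom ((((SLddag hφ).map f).hom.comp (pmPoints R hφ).subtype).codRestrict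
    (pmPoints S hφ) fun γ => pmPoints_map hφ f γ.2)
  map_id R := by
    refine GrpCat.ext fun γ => ?_
    exact Subtype.ext (DFunLike.congr_fun (congrArg GrpCat.Hom.hom ((SLddag hφ).map_id R)) γ.1)
  map_comp f g := by
    refine GrpCat.ext fun γ => ?_
    exact Subtype.ext
      (DFunLike.congr_fun (congrArg GrpCat.Hom.hom ((SLddag hφ).map_comp f g)) γ.1)

/-- The inclusion of `{±I}` into `SL^‡(2, H)`. -/
def plusMinusOneInclusion (hφ : IsOrthogonalInvolution φ) : PlusMinusOne hφ ⟶ SLddag hφ where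
  app R := GrpCat.ofHom (pmPoints R hφ).subtype

/-! ### The action on Hermitian matrices -/

/-- The conjugate transpose of a `2 × 2` matrix over `R ⊗ H`, with respect to the standard
involution. -/
def conjTransposeQ (M : Matrix (Fin 2) (Fin 2) (R ⊗[F] H)) : Matrix (Fin 2) (Fin 2) (R ⊗[F] H) :=
  (M.map ((conjQ F H).baseChange R))ᵀ

variable (R φ) in
/-- The base change to `R` of the map `(s, t, z) ↦ !![s, z; z̄, t]` from `F² ⊕ H⁺` to the `2 × 2`
matrices over `H`. -/
def toHermitian (v : R ⊗[F] (F × F × symmPart φ)) : Matrix (Fin 2) (Fin 2) (R ⊗[F] H) :=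
  let s : (F × F × symmPart φ) →ₗ[F] H :=
    Algebra.linearMap F H ∘ₗ LinearMap.fst F F (F × symmPart φ)
  let t : (F × F × symmPart φ) →ₗ[F] H :=
    Algebra.linearMap F H ∘ₗ LinearMap.fst F F (symmPart φ) ∘ₗ LinearMap.snd F F (F × symmPart φ)
  let z : (F × F × symmPart φ) →ₗ[F] H :=
    (symmPart φ).subtype ∘ₗ LinearMap.snd F F (symmPart φ) ∘ₗ LinearMap.snd F F (F × symmPart φ)
  !![s.baseChange R v, z.baseChange R v;
    (conjQ F H ∘ₗ z).baseChange R v, t.baseChange R v]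

variable (R φ) in
/-- The Hermitian matrices over `H_R = R ⊗ H` with off-diagonal entries in `H_R⁺`. -/
def hermitianMatrices : Set (Matrix (Fin 2) (Fin 2) (R ⊗[F] H)) :=
  {M | conjTransposeQ M = M ∧ φ.baseChange R (M 0 1) = M 0 1}

end SLddag

end

/-! In a suitable presentation of `H` every orthogonal involution is `x ↦ k x̄ k⁻¹` for a pure
quaternion `k` with `k² = -κ`, `κ ≠ 0` (`IsOrthogonalInvolution.exists_isTwist`). With `K = (0, k;
-k, 0)` the group `SL^‡(2, H)` becomes the unitary group `γ K γ̄ᵀ = K`. The map `M ↦ M K` sends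
Hermitian matrices to matrices `c(v)` with `c(v)² = κ q_H(v)`, a Clifford relation up to the factor
`κ`. As `γ̄ᵀ K = K γ⁻¹`, the action `γ M γ̄ᵀ` turns into the conjugation `γ c(v) γ⁻¹`, so it
preserves `q_H`, and the group plays the part of the spin group of the five-dimensional space.

Kernel: the centralizer of all `c(v)` consists of the scalars `r`, and a scalar is unitary exactly
if `r² = 1`, that is, `r = 2e - 1` with `e` idempotent.

Surjectivity: a Cartan–Dieudonné argument over rings (`IsRegularOrthogonal.exists_cover`) writes an
isometry, after a cover, as a product of rotations `r_a r_b` and a map that only scales the last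
vector of an orthogonal basis, by the determinant. If `q(a) q(b) = m²`, then `r_a r_b` is the action
of `c(a) c(b) / (κ m)`, so adjoining square roots lifts each rotation.

Determinant: dividing `γ` by such a lift leaves a matrix whose conjugation scales only `c(e₄)`, by
`det`. The product of all five `c(eᵢ)` is central and invertible, so the factor is `1`
(`IsTwist.eq_one_of_conj`).

Identity component: products of four rotations are parametrized by a nonempty open part of an affine
space, and by the decomposition this irreducible scheme maps onto `SO(q_H)`. So `SO(q_H)` is
connected and equals its identity component. Representability is read off from explicit equations
(`exists_corepresentableBy`). -/

noncomputable section

/-! ### Faithfully flat, finitely presented extensions -/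

section Cover

/-- `f` is faithfully flat and finitely presented. -/
def RingHom.IsFppfCover {R S : Type*} [CommRing R] [CommRing S] (f : R →+* S) : Prop :=
  f.FaithfullyFlat ∧ f.FinitePresentation

namespace RingHom.IsFppfCover

theorem id (R : Type*) [CommRing R] : (RingHom.id R).IsFppfCover :=
  ⟨.of_bijective Function.bijective_id, .id R⟩

theorem comp {R S T : Type u} [CommRing R] [CommRing S] [CommRing T] {g : S →+* T} {f : R →+* S}
    (hg : g.IsFppfCover) (hf : f.IsFppfCover) : (g.comp f).IsFppfCover :=
  ⟨RingHom.FaithfullyFlat.stableUnderComposition f g hf.1 hg.1, hg.2.comp hf.2⟩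

theorem injective {R S : Type*} [CommRing R] [CommRing S] {f : R →+* S} (hf : f.IsFppfCover) :
    Function.Injective f := hf.1.injective

end RingHom.IsFppfCover

variable {F : Type u} [Field F] {R : Type u} [CommRing R] [Algebra F R]

/-- After a faithfully flat, finitely presented extension, `a` acquires a square root. -/
theorem exists_isFppfCover_sqrt (a : R) : ∃ (S : CommAlgCat.{u} F) (f : R →ₐ[F] S),
    f.toRingHom.IsFppfCover ∧ ∃ x : S, x * x = f a := by
  let P : Polynomial R := Polynomial.X ^ 2 - Polynomial.C a
  have hP : P.Monic := Polynomial.monic_X_pow_sub_C a two_ne_zero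
  let S := AdjoinRoot P
  have : Module.Free R S := hP.free_adjoinRoot
  have : Module.Finite R S := hP.finite_adjoinRoot
  refine ⟨CommAlgCat.of F S, IsScalarTower.toAlgHom F R S, ⟨?_, ?_⟩, AdjoinRoot.root P, ?_⟩
  · change (algebraMap R S).FaithfullyFlat
    rw [RingHom.faithfullyFlat_algebraMap_iff]
    -- Freeness gives faithful flatness only when `S` is nonzero. Over the zero ring the spectrum is
    -- empty and surjectivity on spectra is vacuous.
    cases subsingleton_or_nontrivial R
    · exact Module.FaithfullyFlat.of_comap_surjective fun p =>
        (p.2.ne_top (Subsingleton.elim _ _)).elim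
    · have : Nontrivial S := by
        refine Ideal.Quotient.nontrivial_iff.mpr fun h => ?_
        have h := hP.eq_one_of_isUnit (Ideal.span_singleton_eq_top.mp h)
        have h' : P.natDegree = 2 := Polynomial.natDegree_X_pow_sub_C
        simp [h] at h'
      infer_instance
  · change (algebraMap R S).FinitePresentation
    rw [RingHom.finitePresentation_algebraMap]
    infer_instance
  · have := AdjoinRoot.eval₂_root P
    simp only [P, Polynomial.eval₂_sub, Polynomial.eval₂_X_pow, Polynomial.eval₂_C] at this
    rw [← sq]
    exact sub_eq_zero.mp this

/-- The extension `R[1/a] × R[1/(1-a)]` of `R`, with its idempotent `(1, 0)`. -/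
theorem exists_isFppfCover_idempotent (a : R) : ∃ (S : CommAlgCat.{u} F) (f : R →ₐ[F] S),
    f.toRingHom.IsFppfCover ∧ ∃ e : S, e * e = e ∧ IsUnit (e * f a + (1 - e) * (1 - f a)) := by
  -- Taken as one localization of `R × R`, so that flatness and finite presentation each need a
  -- single appeal to localization.
  let S := Localization.Away ((a, 1 - a) : R × R)
  have : Module.Flat (R × R) S := IsLocalization.flat S (Submonoid.powers ((a, 1 - a) : R × R))
  have : Module.Flat R S := Module.Flat.trans R (R × R) S
  have : Algebra.FinitePresentation (R × R) S := IsLocalization.Away.finitePresentation ((a, 1 - a) : R × R)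
  have : Algebra.FinitePresentation R S := Algebra.FinitePresentation.trans R (R × R) S
  refine ⟨CommAlgCat.of F S, IsScalarTower.toAlgHom F R S, ⟨?_, ?_⟩,
    algebraMap (R × R) S (1, 0), ?_, ?_⟩
  · change (algebraMap R S).FaithfullyFlat
    rw [RingHom.faithfullyFlat_algebraMap_iff]
    apply Module.FaithfullyFlat.of_comap_surjective
    have hr := PrimeSpectrum.localization_away_comap_range S ((a, 1 - a) : R × R)
    intro p
    -- As `a` and `1 - a` sum to `1`, a prime misses one of them and lifts to the corresponding
    -- factor.
    by_cases hp : a ∈ p.asIdeal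
    · have : PrimeSpectrum.comap (RingHom.snd R R) p ∈ Set.range (PrimeSpectrum.comap (algebraMap (R × R) S)) := by
        rw [hr]
        intro h
        exact p.2.ne_top ((Ideal.eq_top_iff_one _).mpr (by simpa using add_mem hp h))
      obtain ⟨x, hx⟩ := this
      refine ⟨x, ?_⟩
      rw [IsScalarTower.algebraMap_eq R (R × R) S, PrimeSpectrum.comap_comp_apply, hx]
      rfl
    · have : PrimeSpectrum.comap (RingHom.fst R R) p ∈ Set.range (PrimeSpectrum.comap (algebraMap (R × R) S)) := by
        rw [hr]
        exact hp
      obtain ⟨x, hx⟩ := this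
      refine ⟨x, ?_⟩
      rw [IsScalarTower.algebraMap_eq R (R × R) S, PrimeSpectrum.comap_comp_apply, hx]
      rfl
  · change (algebraMap R S).FinitePresentation
    rw [RingHom.finitePresentation_algebraMap]
    infer_instance
  · rw [← map_mul]; simp
  -- The element in question is the image of `(a, 1 - a)`, which was inverted.
  · have h := IsLocalization.Away.algebraMap_isUnit (S := S) ((a, 1 - a) : R × R)
    convert h using 1
    change algebraMap (R × R) S (1, 0) * algebraMap R S a +
      (1 - algebraMap (R × R) S (1, 0)) * (1 - algebraMap R S a) = _
    rw [IsScalarTower.algebraMap_apply R (R × R) S, ← map_mul, ← map_one (algebraMap (R × R) S),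
      ← map_sub, ← map_sub, ← map_mul, ← map_add]
    congr 1
    ext <;> simp

end Cover

/-! ### Corepresentability -/

section Corepresentable

variable {F : Type u} [Field F]

/-- A functor which is identified, by natural coordinates, with the zero locus in an affine space
of a natural map to another affine space is corepresented by a finitely generated algebra. -/
theorem exists_corepresentableBy (X : CommAlgCat.{u} F ⥤ Type w) {ι : Type} [Finite ι]
    {κ : Type*} (x : ∀ R : CommAlgCat.{u} F, X.obj R → ι → R)
    (hx : ∀ R, Function.Injective (x R))
    (x_map : ∀ {R S : CommAlgCat.{u} F} (f : R ⟶ S) (a : X.obj R),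
      x S (X.map f a) = f.hom ∘ x R a)
    (Φ : ∀ R : CommAlgCat.{u} F, (ι → R) → κ → R)
    (Φ_map : ∀ {R S : CommAlgCat.{u} F} (f : R ⟶ S) (y : ι → R), Φ S (f.hom ∘ y) = f.hom ∘ Φ R y)
    (mem_range : ∀ (R : CommAlgCat.{u} F) (y : ι → R), y ∈ Set.range (x R) ↔ Φ R y = 0) :
    ∃ A : CommAlgCat.{u} F, Algebra.FiniteType F A ∧ Nonempty (X.CorepresentableBy A) := by
  let P : CommAlgCat.{u} F := CommAlgCat.of F (MvPolynomial ι F)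
  let X₀ : ι → P := fun i => MvPolynomial.X i
  -- The equations are evaluated at the generic point `X₀`. By naturality their values at any other
  -- point are specializations of these.
  let I : Ideal (MvPolynomial ι F) := Ideal.span (Set.range (Φ P X₀))
  let A : CommAlgCat.{u} F := CommAlgCat.of F (MvPolynomial ι F ⧸ I)
  let π : P ⟶ A := CommAlgCat.ofHom (Ideal.Quotient.mkₐ F I)
  have key (R : CommAlgCat.{u} F) (y : ι → R) :
      Φ R y = 0 ↔ ∀ a ∈ I, MvPolynomial.aeval y a = 0 := by
    have h1 : y = (CommAlgCat.ofHom (MvPolynomial.aeval y) : P ⟶ R).hom ∘ X₀ := by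
      funext i; exact (MvPolynomial.aeval_X y i).symm
    have h2 := Φ_map (CommAlgCat.ofHom (MvPolynomial.aeval y) : P ⟶ R) X₀
    rw [← h1] at h2
    rw [h2]
    constructor
    · intro h a ha
      have : I ≤ RingHom.ker (MvPolynomial.aeval y : MvPolynomial ι F →ₐ[F] R) := by
        rw [Ideal.span_le]
        rintro _ ⟨k, rfl⟩
        exact congrFun h k
      exact this ha
    · intro h
      funext k
      exact h _ (Ideal.subset_span ⟨k, rfl⟩)
  have hA : Φ A (π.hom ∘ X₀) = 0 := by
    rw [Φ_map]
    funext k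
    exact Ideal.Quotient.eq_zero_iff_mem.mpr (Ideal.subset_span ⟨k, rfl⟩)
  -- `a₀` is the universal element: its coordinates are the classes of the variables.
  obtain ⟨a₀, ha₀⟩ := (mem_range A _).mpr hA
  have hb (R : CommAlgCat.{u} F) : Function.Bijective fun f : A ⟶ R => X.map f a₀ := by
    constructor
    · intro f g h
      have h := congrArg (x R) h
      simp only [x_map, ha₀] at h
      apply CommAlgCat.hom_ext
      apply Ideal.Quotient.algHom_ext
      apply MvPolynomial.algHom_ext
      intro i
      exact congrFun h i
    · intro a
      have h := (key R (x R a)).mp ((mem_range R _).mp ⟨a, rfl⟩)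
      refine ⟨CommAlgCat.ofHom (Ideal.Quotient.liftₐ I (MvPolynomial.aeval (x R a)) h), hx R ?_⟩
      rw [x_map, ha₀]
      funext i
      exact MvPolynomial.aeval_X (x R a) i
  refine ⟨A, ?_, ⟨{ homEquiv := fun {R} => Equiv.ofBijective _ (hb R), homEquiv_comp := ?_ }⟩⟩
  · change Algebra.FiniteType F (MvPolynomial ι F ⧸ I)
    infer_instance
  · intro R S g f
    simp

end Corepresentable

/-! ### Reflections -/

section Reflection

variable {R W : Type*} [CommRing R] [AddCommGroup W] [Module R W] (Q : QuadraticForm R W)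

/-- The reflection in the vector `a`, which is meaningful if `Q a` is a unit. -/
def reflectionIn (a : W) : Module.End R W :=
  LinearMap.transvection (-(Ring.inverse (Q a) • Q.polarBilin a)) a

variable {Q}

theorem reflectionIn_apply (a x : W) :
    reflectionIn Q a x = x - (Ring.inverse (Q a) * QuadraticMap.polar Q a x) • a := by
  simp [reflectionIn, LinearMap.transvection.apply, sub_eq_add_neg]

theorem polar_smul_self (a : W) (r : R) : QuadraticMap.polar Q a (r • a) = r * (2 * Q a) := by
  rw [QuadraticMap.polar_smul_right, QuadraticMap.polar_self, smul_eq_mul, nsmul_eq_mul,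
    Nat.cast_ofNat]

theorem map_sub_smul (x a : W) (r : R) :
    Q (x - r • a) = Q x + r * r * Q a - r * QuadraticMap.polar Q a x := by
  have h : Q (x + (-r) • a) = Q x + Q ((-r) • a) + QuadraticMap.polar Q x ((-r) • a) := by
    rw [QuadraticMap.polar]; ring
  rw [sub_eq_add_neg, ← neg_smul, h, QuadraticMap.map_smul, QuadraticMap.polar_smul_right,
    QuadraticMap.polar_comm, smul_eq_mul, smul_eq_mul]
  ring

theorem map_reflectionIn {a : W} (ha : IsUnit (Q a)) (x : W) : Q (reflectionIn Q a x) = Q x := by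
  rw [reflectionIn_apply, map_sub_smul]
  have h := Ring.inverse_mul_cancel _ ha
  linear_combination Ring.inverse (Q a) * (QuadraticMap.polar Q a x) ^ 2 * h

theorem reflectionIn_mul_self {a : W} (ha : IsUnit (Q a)) :
    reflectionIn Q a * reflectionIn Q a = 1 := by
  ext x
  have h := Ring.inverse_mul_cancel _ ha
  rw [Module.End.mul_apply, reflectionIn_apply, reflectionIn_apply, QuadraticMap.polar_sub_right,
    polar_smul_self, sub_sub, ← add_smul, Module.End.one_apply, sub_eq_self]
  convert zero_smul R a
  linear_combination -2 * Ring.inverse (Q a) * (QuadraticMap.polar Q a x) * h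

/-- A transvection by `f` and `a` has determinant `1 + f a`, and here `f a = -polar(a, a) / Q(a) =
-2`. -/
theorem det_reflectionIn [Module.Free R W] [Module.Finite R W] {a : W} (ha : IsUnit (Q a)) :
    LinearMap.det (reflectionIn Q a) = -1 := by
  rw [reflectionIn, LinearMap.transvection.det]
  have h := Ring.inverse_mul_cancel _ ha
  simp only [LinearMap.neg_apply, LinearMap.smul_apply, QuadraticMap.polarBilin_apply_apply,
    QuadraticMap.polar_self, smul_eq_mul, nsmul_eq_mul, Nat.cast_ofNat]
  linear_combination -2 * h

theorem reflectionIn_of_polar_eq_zero {a x : W} (h : QuadraticMap.polar Q a x = 0) :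
    reflectionIn Q a x = x := by
  rw [reflectionIn_apply, h, mul_zero, zero_smul, sub_zero]

/-- For vectors of equal norm, `polar(y - x, x) = -Q(y - x)`, so reflecting `x` just adds `y - x`.
This is the basic move of the Cartan–Dieudonné argument. -/
theorem reflectionIn_sub {x y : W} (h : Q x = Q y) (hu : IsUnit (Q (y - x))) :
    reflectionIn Q (y - x) x = y := by
  have h1 : QuadraticMap.polar Q (y - x) x = -Q (y - x) := by
    rw [QuadraticMap.polar, sub_add_cancel, h]; ring
  rw [reflectionIn_apply, h1, mul_neg, Ring.inverse_mul_cancel _ hu, neg_smul, one_smul]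
  abel

variable (Q) in
/-- The product of the rotations `r_a r_b`, for the pairs `(a, b)` in a list. -/
def rotationProd (l : List (W × W)) : Module.End R W :=
  (l.map fun p => reflectionIn Q p.1 * reflectionIn Q p.2).prod

variable (Q) in
/-- The vectors in the list are all anisotropic. -/
def IsUnitList (l : List (W × W)) : Prop := ∀ p ∈ l, IsUnit (Q p.1) ∧ IsUnit (Q p.2)

theorem rotationProd_cons (p : W × W) (l : List (W × W)) :
    rotationProd Q (p :: l) = reflectionIn Q p.1 * reflectionIn Q p.2 * rotationProd Q l := by
  simp [rotationProd]

theorem rotationProd_append (l l' : List (W × W)) :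
    rotationProd Q (l ++ l') = rotationProd Q l * rotationProd Q l' := by
  simp [rotationProd]

theorem map_rotationProd {l : List (W × W)} (hl : IsUnitList Q l) (x : W) :
    Q (rotationProd Q l x) = Q x := by
  induction l with
  | nil => rfl
  | cons p l ih =>
    rw [IsUnitList, List.forall_mem_cons] at hl
    rw [rotationProd_cons, Module.End.mul_apply, Module.End.mul_apply, map_reflectionIn hl.1.1,
      map_reflectionIn hl.1.2, ih hl.2]

theorem det_rotationProd [Module.Free R W] [Module.Finite R W] {l : List (W × W)}
    (hl : IsUnitList Q l) : LinearMap.det (rotationProd Q l) = 1 := by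
  induction l with
  | nil => exact map_one _
  | cons p l ih =>
    rw [IsUnitList, List.forall_mem_cons] at hl
    rw [rotationProd_cons, map_mul, map_mul, det_reflectionIn hl.1.1, det_reflectionIn hl.1.2,
      ih hl.2]
    simp

theorem polar_map_map {g : Module.End R W} (hg : ∀ x, Q (g x) = Q x) (x y : W) :
    QuadraticMap.polar Q (g x) (g y) = QuadraticMap.polar Q x y := by
  simp only [QuadraticMap.polar, ← map_add, hg]

/-- An isometry `g` becomes, after multiplication with two reflections, an isometry fixing a vector
`x`. The reflections exist if `1 + polar(x, g x) / 2 Q(x)` and `1 - polar(x, g x) / 2 Q(x)` are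
units where the idempotent `ε` is `1` and `0`, respectively. -/
theorem exists_reflectionIn_reflectionIn {g : Module.End R W} (hg : ∀ x, Q (g x) = Q x)
    {x x' : W} (hx : IsUnit (Q x)) (hx' : IsUnit (Q x')) (hxx' : QuadraticMap.polar Q x x' = 0)
    {ε t : R} (h4 : IsUnit (4 : R)) (hε : ε * ε = ε)
    (ht : 4 * Q x * t = 2 * Q x + QuadraticMap.polar Q x (g x))
    (hu : IsUnit (ε * t + (1 - ε) * (1 - t))) :
    ∃ a b : W, IsUnit (Q a) ∧ IsUnit (Q b) ∧ (reflectionIn Q a * reflectionIn Q b) x = g x ∧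
      ∀ y, g y = y → QuadraticMap.polar Q x y = 0 → QuadraticMap.polar Q x' y = 0 →
        (reflectionIn Q a * reflectionIn Q b) y = y := by
  obtain ⟨c, hc⟩ := isUnit_iff_exists_inv.mp hx
  obtain ⟨c', hc'⟩ := isUnit_iff_exists_inv.mp hx'
  -- Where `ε = 1` this is `x`, whose reflection negates `x`; where `ε = 0` it is `x' ⟂ x`, whose
  -- reflection fixes `x`. So `r_b x = (1 - 2ε) x`, and on both parts exactly one more reflection is
  -- needed, which keeps the number of reflections even.
  set b : W := ε • x + (1 - ε) • x' with hb
  have hQb : Q b = ε * Q x + (1 - ε) * Q x' := by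
    have h := QuadraticMap.map_add Q (ε • x) ((1 - ε) • x')
    rw [QuadraticMap.polar_smul_left, QuadraticMap.polar_smul_right, hxx', QuadraticMap.map_smul,
      QuadraticMap.map_smul] at h
    rw [hb, h]
    simp only [smul_eq_mul]
    linear_combination (Q x + Q x') * hε
  have hQbi : Q b * (ε * c + (1 - ε) * c') = 1 := by
    rw [hQb]
    linear_combination (Q x * c - Q x' * c - Q x * c' + Q x' * c') * hε + ε * hc + (1 - ε) * hc'
  have hbu : IsUnit (Q b) := IsUnit.of_mul_eq_one _ hQbi
  have hpb (y : W) : QuadraticMap.polar Q b y =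
      ε * QuadraticMap.polar Q x y + (1 - ε) * QuadraticMap.polar Q x' y := by
    simp [hb, QuadraticMap.polar_add_left, QuadraticMap.polar_smul_left]
  have hbx : reflectionIn Q b x = (1 - 2 * ε) • x := by
    have hi : Ring.inverse (Q b) = ε * c + (1 - ε) * c' := by
      have := Ring.inverse_mul_cancel _ hbu
      linear_combination (-Ring.inverse (Q b)) * hQbi + (ε * c + (1 - ε) * c') * this
    have hxx : QuadraticMap.polar Q x x = 2 * Q x := by
      simp
    have h1 : Ring.inverse (Q b) * QuadraticMap.polar Q b x = 2 * ε := by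
      rw [hpb, hi, QuadraticMap.polar_comm Q x' x, hxx', hxx]
      linear_combination 2 * Q x * (c - c') * hε + 2 * ε * hc
    rw [reflectionIn_apply, h1, hb, smul_add, smul_smul, smul_smul]
    have h2 : 2 * ε * (1 - ε) = 0 := by linear_combination -2 * hε
    have h3 : 2 * ε * ε = 2 * ε := by linear_combination 2 * hε
    rw [h2, h3]
    module
  have hQy : Q ((1 - 2 * ε) • x) = Q (g x) := by
    rw [QuadraticMap.map_smul, hg, smul_eq_mul]
    linear_combination 4 * Q x * hε
  -- `Q(g x + x) = 4 Q(x) t` and `Q(g x - x) = 4 Q(x) (1 - t)`; the idempotent selects the one that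
  -- is a unit.
  have hau : IsUnit (Q (g x - (1 - 2 * ε) • x)) := by
    rw [map_sub_smul, hg]
    convert (h4.mul hx).mul hu using 1
    linear_combination (4 * Q x) * hε + (1 - 2 * ε) * ht
  refine ⟨g x - (1 - 2 * ε) • x, b, hau, hbu, ?_, fun y hgy hy hy' => ?_⟩
  · rw [Module.End.mul_apply, hbx, reflectionIn_sub hQy hau]
  -- A `g`-fixed vector orthogonal to `x` is also orthogonal to `g x`, hence to both reflection
  -- vectors.
  · have h1 : QuadraticMap.polar Q (g x) y = 0 := by
      rw [← hy, ← polar_map_map hg x y, hgy]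
    rw [Module.End.mul_apply, reflectionIn_of_polar_eq_zero (a := b) (by rw [hpb, hy, hy']; ring)]
    apply reflectionIn_of_polar_eq_zero
    rw [QuadraticMap.polar_sub_left, QuadraticMap.polar_smul_left, h1, hy, smul_zero, sub_zero]

end Reflection

/-! ### Rotations are locally products of reflections -/

section Rotation

variable {F : Type u} [Field F] {V : Type v} [AddCommGroup V] [Module F V]
  {R S T : Type u} [CommRing R] [Algebra F R] [CommRing S] [Algebra F S] [CommRing T] [Algebra F T]

theorem extendScalars_mul (f : R →ₐ[F] S) (g h : Module.End R (R ⊗[F] V)) :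
    (extendScalars f (g * h) : Module.End S (S ⊗[F] V)) = extendScalars f g * extendScalars f h :=
  extendScalars_comp f g h

variable [Invertible (2 : F)] (q : QuadraticForm F V)

theorem polar_baseChange_rTensor (f : R →ₐ[F] S) (x y : R ⊗[F] V) :
    QuadraticMap.polar (q.baseChange S) (f.toLinearMap.rTensor V x) (f.toLinearMap.rTensor V y) =
      f (QuadraticMap.polar (q.baseChange R) x y) := by
  simp only [QuadraticMap.polar, ← map_add, baseChange_rTensor, map_sub]

theorem polar_baseChange_tmul (x y : V) (a b : R) :
    QuadraticMap.polar (q.baseChange R) (a ⊗ₜ x) (b ⊗ₜ y) =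
      a * b * algebraMap F R (QuadraticMap.polar q x y) := by
  have h1 : a ⊗ₜ[F] x = a • ((1 : R) ⊗ₜ[F] x) := by simp [TensorProduct.smul_tmul']
  have h2 : b ⊗ₜ[F] y = b • ((1 : R) ⊗ₜ[F] y) := by simp [TensorProduct.smul_tmul']
  rw [h1, h2, QuadraticMap.polar_smul_left, QuadraticMap.polar_smul_right]
  simp only [QuadraticMap.polar, ← TensorProduct.tmul_add, QuadraticForm.baseChange_tmul, mul_one,
    Algebra.algebraMap_eq_smul_one, sub_smul, smul_eq_mul]
  ring

theorem map_extendScalars (f : R →ₐ[F] S) {g : Module.End R (R ⊗[F] V)}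
    (hg : ∀ x, q.baseChange R (g x) = q.baseChange R x) (x : S ⊗[F] V) :
    q.baseChange S (extendScalars f g x) = q.baseChange S x := by
  have : (q.baseChange S).comp (extendScalars f g) = q.baseChange S := by
    apply baseChange_ext
    intro v
    rw [QuadraticMap.comp_apply, extendScalars_one_tmul, baseChange_rTensor, hg,
      ← baseChange_rTensor]
    simp
  exact DFunLike.congr_fun this x

theorem extendScalars_reflectionIn (f : R →ₐ[F] S) {a : R ⊗[F] V}
    (ha : IsUnit (q.baseChange R a)) :
    extendScalars f (reflectionIn (q.baseChange R) a) =
      reflectionIn (q.baseChange S) (f.toLinearMap.rTensor V a) := by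
  refine ext_one_tmul fun v => ?_
  have h1 : ((1 : S) ⊗ₜ[F] v) = f.toLinearMap.rTensor V (1 ⊗ₜ v) := by simp
  have h2 : f (Ring.inverse (q.baseChange R a)) = Ring.inverse (f (q.baseChange R a)) := by
    obtain ⟨r, hr⟩ := ha
    have := Ring.inverse_unit (Units.map (f : R →* S) r)
    rw [← hr, Ring.inverse_unit]
    exact this.symm
  rw [extendScalars_one_tmul, reflectionIn_apply, reflectionIn_apply, h1,
    polar_baseChange_rTensor, baseChange_rTensor, map_sub, rTensor_smul, map_mul, h2]

/-- Base change of a list of pairs of vectors. -/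
def mapPairs (f : R →ₐ[F] S) (l : List ((R ⊗[F] V) × (R ⊗[F] V))) :
    List ((S ⊗[F] V) × (S ⊗[F] V)) :=
  l.map (Prod.map (f.toLinearMap.rTensor V) (f.toLinearMap.rTensor V))

variable {q}

theorem IsUnitList.map {l : List ((R ⊗[F] V) × (R ⊗[F] V))}
    (hl : IsUnitList (q.baseChange R) l) (f : R →ₐ[F] S) :
    IsUnitList (q.baseChange S) (mapPairs f l) := by
  intro p' hp'
  obtain ⟨p, hp, rfl⟩ := List.mem_map.mp hp'
  simp only [Prod.map_fst, Prod.map_snd, baseChange_rTensor]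
  exact ⟨(hl p hp).1.map f, (hl p hp).2.map f⟩

theorem extendScalars_rotationProd (f : R →ₐ[F] S) {l : List ((R ⊗[F] V) × (R ⊗[F] V))}
    (hl : IsUnitList (q.baseChange R) l) :
    extendScalars f (rotationProd (q.baseChange R) l) =
      rotationProd (q.baseChange S) (mapPairs f l) := by
  induction l with
  | nil => exact extendScalars_id f
  | cons p l ih =>
    rw [IsUnitList, List.forall_mem_cons] at hl
    rw [rotationProd_cons, extendScalars_mul, extendScalars_mul, ih hl.2,
      extendScalars_reflectionIn q f hl.1.1, extendScalars_reflectionIn q f hl.1.2]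
    simp [mapPairs, rotationProd_cons]

/-- An orthogonal basis of anisotropic vectors. -/
structure IsRegularOrthogonal {n : ℕ} (q : QuadraticForm F V) (e : Module.Basis (Fin n) F V) :
    Prop where
  polar_eq_zero : ∀ i j, i ≠ j → QuadraticMap.polar q (e i) (e j) = 0
  ne_zero : ∀ i, q (e i) ≠ 0

namespace IsRegularOrthogonal

variable {n : ℕ} {e : Module.Basis (Fin n) F V} (he : IsRegularOrthogonal q e)
include he

theorem polar_one_tmul {i j : Fin n} (hij : i ≠ j) :
    QuadraticMap.polar (q.baseChange R) (1 ⊗ₜ e i) (1 ⊗ₜ e j) = 0 := by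
  rw [polar_baseChange_tmul, he.polar_eq_zero i j hij, map_zero, mul_zero]

theorem isUnit_one_tmul (i : Fin n) : IsUnit (q.baseChange R (1 ⊗ₜ e i)) := by
  rw [QuadraticForm.baseChange_tmul, mul_one, ← Algebra.algebraMap_eq_smul_one]
  exact (he.ne_zero i).isUnit.map (algebraMap F R)

/-- An isometry which fixes all but one vector of an orthogonal basis multiplies the remaining one
with its determinant. -/
theorem apply_eq_det_smul {h : Module.End R (R ⊗[F] V)}
    (hh : ∀ x, q.baseChange R (h x) = q.baseChange R x) {l : Fin n}
    (hl : ∀ i, i ≠ l → h (1 ⊗ₜ e i) = 1 ⊗ₜ e i) :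
    h (1 ⊗ₜ e l) = LinearMap.det h • (1 ⊗ₜ e l) := by
  classical
  let E := e.baseChange R
  have hE (i) : E i = 1 ⊗ₜ e i := Module.Basis.baseChange_apply R e i
  have h2 : IsUnit (2 : R) := by
    have := (isUnit_of_invertible (2 : F)).map (algebraMap F R)
    rwa [map_ofNat] at this
  -- Pairing with `E j` reads off the `j`-th coordinate up to `2 q(E j)`, which is a unit.
  have hp (x) (j) : QuadraticMap.polar (q.baseChange R) x (E j) =
      E.repr x j * (2 * q.baseChange R (E j)) := by
    conv_lhs => rw [← E.sum_repr x]
    have := map_sum ((q.baseChange R).polarBilin.flip (E j)) (fun i => E.repr x i • E i) Finset.univ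
    simp only [LinearMap.flip_apply, QuadraticMap.polarBilin_apply_apply] at this
    rw [this, Finset.sum_eq_single j]
    · rw [QuadraticMap.polar_comm, polar_smul_self]
    · intro i _ hij
      rw [QuadraticMap.polar_smul_left, hE, hE, he.polar_one_tmul hij, smul_zero]
    · simp
  -- The image of `E l` stays orthogonal to the fixed vectors `E j`, so only its `l`-th coordinate
  -- survives and the matrix of `h` is diagonal.
  have h0 (j) (hj : j ≠ l) : E.repr (h (E l)) j = 0 := by
    have h1 := hp (h (E l)) j
    have h3 : QuadraticMap.polar (q.baseChange R) (h (E l)) (E j) = 0 := by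
      have h4 : h (E j) = E j := by rw [hE, hl j hj]
      rw [← h4, polar_map_map hh, hE, hE, he.polar_one_tmul hj.symm]
    rw [h3, hE j] at h1
    exact ((h2.mul (he.isUnit_one_tmul j)).mul_left_eq_zero).mp h1.symm
  have hlast : h (E l) = E.repr (h (E l)) l • E l := by
    conv_lhs => rw [← E.sum_repr (h (E l))]
    rw [Finset.sum_eq_single l]
    · intro i _ hi; rw [h0 i hi, zero_smul]
    · simp
  have hdet : LinearMap.det h = E.repr (h (E l)) l := by
    have : LinearMap.toMatrix E E h =
        Matrix.diagonal (Function.update (fun _ => 1) l (E.repr (h (E l)) l)) := by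
      ext i j
      rw [LinearMap.toMatrix_apply]
      by_cases hj : j = l
      · subst hj
        by_cases hi : i = j
        · subst hi; simp
        · rw [h0 i hi, Matrix.diagonal_apply_ne _ hi]
      · rw [hE j, hl j hj, ← hE j, Module.Basis.repr_self, Matrix.diagonal_apply,
          Finsupp.single_apply]
        by_cases hi : i = j
        · subst hi; simp [hj]
        · simp [hi, Ne.symm hi]
    rw [← LinearMap.det_toMatrix E, this, Matrix.det_diagonal, Finset.prod_update_of_mem (by simp)]
    simp
  rw [hdet, ← hE, ← hlast]

/-- Locally, an isometry fixing `e i` for `i < k` can be multiplied by a product of two reflections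
such that it fixes also `e k`. -/
theorem exists_cover_step {k : ℕ} (hk : k + 1 < n) {g : Module.End R (R ⊗[F] V)}
    (hg : ∀ x, q.baseChange R (g x) = q.baseChange R x)
    (hgk : ∀ i : Fin n, i.val < k → g (1 ⊗ₜ e i) = 1 ⊗ₜ e i) :
    ∃ (S : CommAlgCat.{u} F) (f : R →ₐ[F] S), f.toRingHom.IsFppfCover ∧
      ∃ p : (S ⊗[F] V) × (S ⊗[F] V), IsUnitList (q.baseChange S) [p] ∧
        ∃ h : Module.End S (S ⊗[F] V), (∀ x, q.baseChange S (h x) = q.baseChange S x) ∧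
          (∀ i : Fin n, i.val < k + 1 → h (1 ⊗ₜ e i) = 1 ⊗ₜ e i) ∧
          extendScalars f g = rotationProd (q.baseChange S) [p] * h := by
  have h4' {S : Type u} [CommRing S] [Algebra F S] : IsUnit (4 : S) := by
    have h2 := (isUnit_of_invertible (2 : F)).map (algebraMap F S)
    have := h2.mul h2
    rwa [map_ofNat, show (2 : S) * 2 = 4 by norm_num] at this
  let i₀ : Fin n := ⟨k, by omega⟩
  -- The next basis vector serves as the auxiliary `x'`; this is why the step requires `k + 1 < n`.
  let i₁ : Fin n := ⟨k + 1, hk⟩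
  have h01 : i₀ ≠ i₁ := by simp [i₀, i₁]
  obtain ⟨c, hc⟩ := isUnit_iff_exists_inv.mp
    ((h4' (S := R)).mul (he.isUnit_one_tmul (R := R) i₀))
  set P := QuadraticMap.polar (q.baseChange R) (1 ⊗ₜ e i₀) (g (1 ⊗ₜ e i₀)) with hP
  -- Chosen so that `q(g x + x) = 4 q(x) t` for `x = e k`; the cover makes `t` invertible on one
  -- part and `1 - t` on the other.
  set t : R := c * (2 * q.baseChange R (1 ⊗ₜ e i₀) + P) with ht
  have ht' : 4 * q.baseChange R (1 ⊗ₜ e i₀) * t = 2 * q.baseChange R (1 ⊗ₜ e i₀) + P := by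
    rw [ht]; linear_combination (2 * q.baseChange R (1 ⊗ₜ e i₀) + P) * hc
  clear_value t
  obtain ⟨S, f, hf, ε, hε, hu⟩ := exists_isFppfCover_idempotent (F := F) t
  have h1 (i) : f.toLinearMap.rTensor V (1 ⊗ₜ e i) = 1 ⊗ₜ e i := by simp
  have hgS := map_extendScalars q f hg
  have hgi (i : Fin n) (hi : i.val < k) : extendScalars f g (1 ⊗ₜ e i) = 1 ⊗ₜ e i := by
    rw [extendScalars_one_tmul, hgk i hi, h1]
  obtain ⟨a, b, ha, hb, hab, hfix⟩ := exists_reflectionIn_reflectionIn hgS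
    (he.isUnit_one_tmul i₀) (he.isUnit_one_tmul i₁) (he.polar_one_tmul h01) (ε := ε) (t := f t)
    h4' hε (by
      have := congrArg f ht'
      rw [hP, map_add, map_mul, map_mul, map_mul, ← baseChange_rTensor,
        ← polar_baseChange_rTensor, map_ofNat, map_ofNat, h1] at this
      rwa [extendScalars_one_tmul]) hu
  have hinv : reflectionIn (q.baseChange S) a * reflectionIn (q.baseChange S) b *
      (reflectionIn (q.baseChange S) b * reflectionIn (q.baseChange S) a) = 1 := by
    rw [mul_assoc, ← mul_assoc (reflectionIn (q.baseChange S) b), reflectionIn_mul_self hb,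
      one_mul, reflectionIn_mul_self ha]
  have hinv' : reflectionIn (q.baseChange S) b * reflectionIn (q.baseChange S) a *
      (reflectionIn (q.baseChange S) a * reflectionIn (q.baseChange S) b) = 1 := by
    rw [mul_assoc, ← mul_assoc (reflectionIn (q.baseChange S) a), reflectionIn_mul_self ha,
      one_mul, reflectionIn_mul_self hb]
  -- The new isometry is `(r_a r_b)⁻¹ g`, reflections being their own inverses.
  refine ⟨S, f, hf, (a, b), by simp [IsUnitList, ha, hb],
    reflectionIn (q.baseChange S) b * reflectionIn (q.baseChange S) a * extendScalars f g, ?_, ?_,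
    ?_⟩
  · intro x
    rw [Module.End.mul_apply, Module.End.mul_apply, map_reflectionIn hb, map_reflectionIn ha, hgS]
  · intro i hi
    have key : extendScalars f g (1 ⊗ₜ e i) =
        (reflectionIn (q.baseChange S) a * reflectionIn (q.baseChange S) b) (1 ⊗ₜ e i) := by
      rcases Nat.lt_succ_iff_lt_or_eq.mp hi with hi | hi
      · rw [hfix _ (hgi i hi) (he.polar_one_tmul ?_) (he.polar_one_tmul ?_), hgi i hi]
        · rintro rfl; simp [i₀] at hi
        · rintro rfl; simp [i₁] at hi
      · obtain rfl : i = i₀ := Fin.ext hi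
        exact hab.symm
    rw [Module.End.mul_apply, key, ← Module.End.mul_apply, hinv']
    rfl
  · rw [rotationProd_cons, rotationProd, List.map_nil, List.prod_nil, mul_one, ← mul_assoc, hinv,
      one_mul]

/-- One rotation is spent per basis vector, and each step needs a further vector in reserve, so the
induction stops with one vector left over. The exact length of the list is recorded because the
connectedness argument needs one parameter space for all products. -/
theorem exists_cover_rotationProd {k : ℕ} (hk : k < n) {g : Module.End R (R ⊗[F] V)}
    (hg : ∀ x, q.baseChange R (g x) = q.baseChange R x) :
    ∃ (S : CommAlgCat.{u} F) (f : R →ₐ[F] S), f.toRingHom.IsFppfCover ∧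
      ∃ l : List ((S ⊗[F] V) × (S ⊗[F] V)), l.length = k ∧ IsUnitList (q.baseChange S) l ∧
        ∃ h : Module.End S (S ⊗[F] V), (∀ x, q.baseChange S (h x) = q.baseChange S x) ∧
          (∀ i : Fin n, i.val < k → h (1 ⊗ₜ e i) = 1 ⊗ₜ e i) ∧
          extendScalars f g = rotationProd (q.baseChange S) l * h := by
  induction k with
  | zero =>
    refine ⟨CommAlgCat.of F R, AlgHom.id F R, .id R, [], rfl, by simp [IsUnitList], g, hg, by simp,
      ?_⟩
    rw [extendScalars_idHom]
    exact (one_mul g).symm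
  | succ k ih =>
    obtain ⟨S, f, hf, l, hl, hlu, h, hh, hfix, hgl⟩ := ih (by omega)
    obtain ⟨T, f', hf', p, hp, h', hh', hfix', hgl'⟩ := he.exists_cover_step hk hh hfix
    refine ⟨T, f'.comp f, hf'.comp hf, mapPairs f' l ++ [p], by simp [mapPairs, hl], ?_, h', hh',
      hfix', ?_⟩
    · intro p' hp'
      rcases List.mem_append.mp hp' with hp' | hp'
      · exact hlu.map f' p' hp'
      · exact hp p' hp'
    · rw [extendScalars_compHom, hgl, extendScalars_mul, hgl', extendScalars_rotationProd f' hlu,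
        rotationProd_append, mul_assoc]

end IsRegularOrthogonal

/-- Every isometry of a regular quadratic form of dimension `n + 1` is, locally, the product of `n`
rotations `r_a r_b` and of an isometry which is the identity except on the last basis vector, which
it multiplies with the determinant. -/
theorem IsRegularOrthogonal.exists_cover {n : ℕ} {e : Module.Basis (Fin (n + 1)) F V}
    (he : IsRegularOrthogonal q e) {g : Module.End R (R ⊗[F] V)}
    (hg : ∀ x, q.baseChange R (g x) = q.baseChange R x) :
    ∃ (S : CommAlgCat.{u} F) (f : R →ₐ[F] S), f.toRingHom.IsFppfCover ∧
      ∃ l : List ((S ⊗[F] V) × (S ⊗[F] V)), l.length = n ∧ IsUnitList (q.baseChange S) l ∧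
        ∃ h : Module.End S (S ⊗[F] V), (∀ i, i ≠ Fin.last n → h (1 ⊗ₜ e i) = 1 ⊗ₜ e i) ∧
          h (1 ⊗ₜ e (Fin.last n)) = f (LinearMap.det g) • (1 ⊗ₜ e (Fin.last n)) ∧
          extendScalars f g = rotationProd (q.baseChange S) l * h := by
  obtain ⟨S, f, hf, l, hl, hlu, h, hh, hfix, hgl⟩ :=
    he.exists_cover_rotationProd (Nat.lt_succ_self n) hg
  have hfix' (i : Fin (n + 1)) (hi : i ≠ Fin.last n) : h (1 ⊗ₜ e i) = 1 ⊗ₜ e i :=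
    hfix i (Fin.lt_last_iff_ne_last.mpr hi)
  refine ⟨S, f, hf, l, hl, hlu, h, hfix', ?_, hgl⟩
  have : Module.Finite F V := Module.Finite.of_basis e
  have hdet : LinearMap.det h = f (LinearMap.det g) := by
    rw [← det_extendScalars, hgl, map_mul, det_rotationProd hlu, one_mul]
  rw [he.apply_eq_det_smul hh hfix', hdet]

/-- The leftover factor scales the last basis vector by the determinant, so for determinant `1` it
is the identity. -/
theorem IsRegularOrthogonal.exists_cover_of_det_eq_one {n : ℕ}
    {e : Module.Basis (Fin (n + 1)) F V} (he : IsRegularOrthogonal q e)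
    {g : Module.End R (R ⊗[F] V)} (hg : ∀ x, q.baseChange R (g x) = q.baseChange R x)
    (hdet : LinearMap.det g = 1) :
    ∃ (S : CommAlgCat.{u} F) (f : R →ₐ[F] S), f.toRingHom.IsFppfCover ∧
      ∃ l : List ((S ⊗[F] V) × (S ⊗[F] V)), l.length = n ∧ IsUnitList (q.baseChange S) l ∧
        extendScalars f g = rotationProd (q.baseChange S) l := by
  obtain ⟨S, f, hf, l, hl, hlu, h, hfix, hlast, hgl⟩ := he.exists_cover hg
  refine ⟨S, f, hf, l, hl, hlu, ?_⟩
  have h1 : h = 1 := by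
    refine (e.baseChange S).ext fun i => ?_
    rw [Module.Basis.baseChange_apply]
    by_cases hi : i = Fin.last n
    · rw [hi, hlast, hdet, map_one, one_smul]; rfl
    · exact hfix i hi
  rw [hgl, h1, mul_one]

end Rotation

/-! ### The special orthogonal group is a connected algebraic group -/

section SpecialOrthogonalConnected

variable {F : Type u} [Field F] {V : Type v} [AddCommGroup V] [Module F V]
  {R S : Type u} [CommRing R] [Algebra F R] [CommRing S] [Algebra F S]

theorem toMatrix_extendScalars {ι : Type*} [Fintype ι] [DecidableEq ι] (b : Module.Basis ι F V)
    (f : R →ₐ[F] S) (g : Module.End R (R ⊗[F] V)) :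
    LinearMap.toMatrix (b.baseChange S) (b.baseChange S) (extendScalars f g) =
      (LinearMap.toMatrix (b.baseChange R) (b.baseChange R) g).map f := by
  ext i j
  rw [LinearMap.toMatrix_apply, Matrix.map_apply, LinearMap.toMatrix_apply,
    Module.Basis.baseChange_apply, Module.Basis.baseChange_apply, extendScalars_one_tmul]
  generalize g (1 ⊗ₜ b j) = x
  induction x with
  | zero => simp
  | tmul a v => simp [Module.Basis.baseChange_repr_tmul]
  | add x y hx hy => simp [hx, hy]

variable [Invertible (2 : F)] (q : QuadraticForm F V)

theorem isUnit_two_of_algebra (F : Type*) [Field F] [Invertible (2 : F)] (R : Type*) [CommRing R]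
    [Algebra F R] : IsUnit (2 : R) := by
  have := (isUnit_of_invertible (2 : F)).map (algebraMap F R)
  rwa [map_ofNat] at this

-- Reduces preservation of `q` to finitely many polynomial equations on matrix entries; `2` being a
-- unit, `q` is recovered from its polar form.
variable {q} in
theorem isometry_of_polar_basis {ι : Type*} (b : Module.Basis ι F V) {g : Module.End R (R ⊗[F] V)}
    (hg : ∀ i j, QuadraticMap.polar (q.baseChange R) (g (1 ⊗ₜ b i)) (g (1 ⊗ₜ b j)) =
      QuadraticMap.polar (q.baseChange R) (1 ⊗ₜ b i) (1 ⊗ₜ b j)) (x : R ⊗[F] V) :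
    q.baseChange R (g x) = q.baseChange R x := by
  have h : (q.baseChange R).polarBilin.compl₁₂ g g = (q.baseChange R).polarBilin := by
    refine LinearMap.ext_basis (b.baseChange R) (b.baseChange R) fun i j => ?_
    simpa using hg i j
  have h := LinearMap.congr_fun₂ h x x
  simp only [LinearMap.compl₁₂_apply, QuadraticMap.polarBilin_apply_apply,
    QuadraticMap.polar_self, nsmul_eq_mul, Nat.cast_ofNat] at h
  exact (isUnit_two_of_algebra F R).mul_left_cancel h

variable [Module.Finite F V]

variable {q} in
/-- The element of `SO(q)(R)` given by an isometry of determinant `1`. -/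
def soOfEnd (g : Module.End R (R ⊗[F] V)) (hg : ∀ x, q.baseChange R (g x) = q.baseChange R x)
    (hdet : LinearMap.det g = 1) : soPoints q R :=
  ⟨LinearEquiv.ofIsUnitDet (f := g)
    (v := (Module.finBasis F V).baseChange R) (v' := (Module.finBasis F V).baseChange R)
    (by rw [LinearMap.det_toMatrix, hdet]; exact isUnit_one), hg, hdet⟩

omit [Module.Finite F V] in
theorem soPoints_ext {g h : soPoints q R}
    (H : (g.1 : R ⊗[F] V →ₗ[R] R ⊗[F] V) = (h.1 : R ⊗[F] V →ₗ[R] R ⊗[F] V)) : g = h :=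
  Subtype.ext (LinearEquiv.toLinearMap_injective H)

theorem SO_map_coe {R S : CommAlgCat.{u} F} (f : R ⟶ S) (g : soPoints q R) :
    (((SO q).map f g : soPoints q S).1 : S ⊗[F] V →ₗ[S] S ⊗[F] V) =
      extendScalars f.hom (g.1 : R ⊗[F] V →ₗ[R] R ⊗[F] V) := rfl

/-- The coordinates are the matrix entries, the equations are those of the Gram matrix and `det =
1`. No coordinates for the inverse are needed, since determinant `1` already gives invertibility. -/
theorem isAlgebraicGroup_SO : (SO q).IsAlgebraicGroup := by
  classical
  let n := Module.finrank F V
  let b := Module.finBasis F V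
  let X (R : CommAlgCat.{u} F) (g : soPoints q R) (p : Fin n × Fin n) : R :=
    LinearMap.toMatrix (b.baseChange R) (b.baseChange R) (g.1 : R ⊗[F] V →ₗ[R] R ⊗[F] V) p.1 p.2
  let G (R : CommAlgCat.{u} F) (y : Fin n × Fin n → R) : Module.End R (R ⊗[F] V) :=
    Matrix.toLin (b.baseChange R) (b.baseChange R) (Matrix.of fun i j => y (i, j))
  let Φ (R : CommAlgCat.{u} F) (y : Fin n × Fin n → R) : (Fin n × Fin n) ⊕ Unit → R :=
    Sum.elim (fun p => QuadraticMap.polar (q.baseChange R) (G R y (1 ⊗ₜ b p.1))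
      (G R y (1 ⊗ₜ b p.2)) - QuadraticMap.polar (q.baseChange R) (1 ⊗ₜ b p.1) (1 ⊗ₜ b p.2))
      (fun _ => LinearMap.det (G R y) - 1)
  have hXG (R : CommAlgCat.{u} F) (g : soPoints q R) : G R (X R g) = g.1 :=
    Matrix.toLin_toMatrix (b.baseChange R) (b.baseChange R) _
  have hGmap {R S : CommAlgCat.{u} F} (f : R ⟶ S) (y : Fin n × Fin n → R) :
      G S (f.hom ∘ y) = extendScalars f.hom (G R y) := by
    apply (LinearMap.toMatrix (b.baseChange S) (b.baseChange S)).injective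
    rw [toMatrix_extendScalars, LinearMap.toMatrix_toLin, LinearMap.toMatrix_toLin]
    rfl
  refine exists_corepresentableBy (SO q ⋙ forget GrpCat) X ?_ ?_ Φ ?_ ?_
  · intro R (g : soPoints q R) (h : soPoints q R) H
    apply soPoints_ext
    rw [← hXG, ← hXG, H]
  · intro R S f g
    funext p
    exact congrFun₂ (toMatrix_extendScalars b f.hom _) p.1 p.2
  · intro R S f y
    have h1 (i) : (1 : S) ⊗ₜ[F] b i = f.hom.toLinearMap.rTensor V (1 ⊗ₜ b i) := by simp
    funext k
    rcases k with p | _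
    · simp only [Φ, Sum.elim_inl, Function.comp_apply, map_sub, hGmap]
      rw [h1, h1, extendScalars_rTensor, extendScalars_rTensor, polar_baseChange_rTensor,
        polar_baseChange_rTensor]
    · simp only [Φ, Sum.elim_inr, Function.comp_apply, map_sub, hGmap, map_one,
        det_extendScalars]
  · intro R y
    constructor
    · intro hy
      obtain ⟨g, rfl⟩ : ∃ g : soPoints q R, X R g = y := hy
      have hg : ∀ x, q.baseChange R (G R (X R g) x) = q.baseChange R x := by
        rw [hXG]; exact g.2.1
      funext k
      rcases k with p | _
      · exact sub_eq_zero.mpr (polar_map_map hg _ _)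
      · refine sub_eq_zero.mpr ?_
        rw [hXG]
        exact g.2.2
    · intro h
      refine ⟨soOfEnd (G R y) (isometry_of_polar_basis b fun i j => ?_) ?_, ?_⟩
      · exact sub_eq_zero.mp (congrFun h (Sum.inl (i, j)))
      · exact sub_eq_zero.mp (congrFun h (Sum.inr ()))
      · funext p
        exact congrFun₂ (LinearMap.toMatrix_toLin (b.baseChange R) (b.baseChange R)
          (Matrix.of fun i j => y (i, j))) p.1 p.2

/-- The list of `n` pairs of vectors with given coordinates. -/
def pairsOfCoords {n m : ℕ} (e : Module.Basis (Fin m) F V) (y : Fin n × Bool × Fin m → R) :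
    List ((R ⊗[F] V) × (R ⊗[F] V)) :=
  List.ofFn fun i => (∑ j, y (i, true, j) • (1 ⊗ₜ e j), ∑ j, y (i, false, j) • (1 ⊗ₜ e j))

omit [Module.Finite F V] [Invertible (2 : F)] in
theorem mapPairs_pairsOfCoords {n m : ℕ} (e : Module.Basis (Fin m) F V) (f : R →ₐ[F] S)
    (y : Fin n × Bool × Fin m → R) :
    mapPairs f (pairsOfCoords e y) = pairsOfCoords e (f ∘ y) := by
  simp only [mapPairs, pairsOfCoords, List.map_ofFn]
  congr 1
  funext i
  simp only [Function.comp_apply, Prod.map_apply, map_sum, rTensor_smul, LinearMap.rTensor_tmul,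
    AlgHom.toLinearMap_apply, map_one]

omit [Module.Finite F V] [Invertible (2 : F)] in
theorem exists_pairsOfCoords {n m : ℕ} (e : Module.Basis (Fin m) F V)
    (l : List ((R ⊗[F] V) × (R ⊗[F] V))) (hl : l.length = n) :
    ∃ y : Fin n × Bool × Fin m → R, pairsOfCoords e y = l := by
  subst hl
  refine ⟨fun p => (e.baseChange R).repr (if p.2.1 then (l.get p.1).1 else (l.get p.1).2) p.2.2, ?_⟩
  have h (x : R ⊗[F] V) : ∑ j, (e.baseChange R).repr x j • ((1 : R) ⊗ₜ[F] e j) = x := by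
    simpa using (e.baseChange R).sum_repr x
  simp only [pairsOfCoords, if_true, Bool.false_eq_true, if_false, h]
  exact List.ofFn_get l

/-- The product of the values of the quadratic form at the vectors in a list of pairs. -/
def prodNorms (l : List ((R ⊗[F] V) × (R ⊗[F] V))) : R :=
  (l.map fun p => q.baseChange R p.1 * q.baseChange R p.2).prod

omit [Module.Finite F V] in
theorem prodNorms_mapPairs (f : R →ₐ[F] S) (l : List ((R ⊗[F] V) × (R ⊗[F] V))) :
    prodNorms q (mapPairs f l) = f (prodNorms q l) := by
  simp [prodNorms, mapPairs, map_list_prod, Function.comp_def, baseChange_rTensor]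

omit [Module.Finite F V] in
theorem isUnit_prodNorms_iff (l : List ((R ⊗[F] V) × (R ⊗[F] V))) :
    IsUnit (prodNorms q l) ↔ IsUnitList (q.baseChange R) l := by
  induction l with
  | nil => simp [prodNorms, IsUnitList]
  | cons p l ih =>
    rw [IsUnitList, List.forall_mem_cons, ← IsUnitList, ← ih, prodNorms, List.map_cons,
      List.prod_cons, IsUnit.mul_iff, IsUnit.mul_iff, prodNorms]

variable {q}

/-- Let `C` be the coordinate ring of lists of `n` pairs of anisotropic vectors, a localization of a
polynomial ring and hence a domain. The universal product of rotations gives `A → C`. The universal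
isometry over `A` is such a product after a cover, so `Spec C → Spec A` is onto, and the image of a
connected space is connected. -/
theorem IsRegularOrthogonal.preconnectedSpace {n : ℕ} {e : Module.Basis (Fin (n + 1)) F V}
    (he : IsRegularOrthogonal q e) (A : CommAlgCat.{u} F)
    (r : (SO q ⋙ forget GrpCat).CorepresentableBy A) : PreconnectedSpace (PrimeSpectrum A) := by
  let B := MvPolynomial (Fin n × Bool × Fin (n + 1)) F
  let l₀ : List ((B ⊗[F] V) × (B ⊗[F] V)) := pairsOfCoords e MvPolynomial.X
  let P : B := prodNorms q l₀
  have hP : P ≠ 0 := by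
    intro h0
    -- Specializing all vectors to `e 0` gives a point where every norm is nonzero, so the
    -- polynomial `P` is not zero.
    let y : Fin n × Bool × Fin (n + 1) → F := fun p => if p.2.2 = 0 then 1 else 0
    have h1 := prodNorms_mapPairs q (MvPolynomial.aeval y) l₀
    have h2 : IsUnitList (q.baseChange F) (mapPairs (MvPolynomial.aeval y) l₀) := by
      have h3 : (MvPolynomial.aeval y : B →ₐ[F] F) ∘ MvPolynomial.X = y := by
        funext i; exact MvPolynomial.aeval_X y i
      have h4 (i : Fin n) (c : Bool) :
          ∑ j, y (i, c, j) • ((1 : F) ⊗ₜ[F] e j) = 1 ⊗ₜ e 0 := by simp [y]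
      rw [mapPairs_pairsOfCoords, h3]
      intro p hp
      obtain ⟨i, rfl⟩ := (List.mem_ofFn' _ _).mp hp
      simp only [h4]
      exact ⟨he.isUnit_one_tmul 0, he.isUnit_one_tmul 0⟩
    rw [← isUnit_prodNorms_iff, h1] at h2
    change IsUnit ((MvPolynomial.aeval y) P) at h2
    rw [h0, map_zero] at h2
    exact not_isUnit_zero h2
  let C := Localization.Away P
  have : IsDomain C := IsLocalization.isDomain_localization
    (powers_le_nonZeroDivisors_of_noZeroDivisors hP)
  let ι : B →ₐ[F] C := IsScalarTower.toAlgHom F B C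
  have hl : IsUnitList (q.baseChange C) (mapPairs ι l₀) := by
    rw [← isUnit_prodNorms_iff, prodNorms_mapPairs]
    exact IsLocalization.Away.algebraMap_isUnit P
  let G : soPoints q (CommAlgCat.of F C) :=
    soOfEnd (rotationProd _ (mapPairs ι l₀)) (map_rotationProd hl) (det_rotationProd hl)
  let ψ : A ⟶ CommAlgCat.of F C := r.homEquiv.symm G
  -- The universal isometry, to which the local decomposition is applied.
  let g : soPoints q A := r.homEquiv (𝟙 A)
  obtain ⟨S, f, hf, l, hln, hlu, hgl⟩ := he.exists_cover_of_det_eq_one g.2.1 g.2.2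
  obtain ⟨y, hy⟩ := exists_pairsOfCoords e l hln
  have hyl : mapPairs (MvPolynomial.aeval y) l₀ = l := by
    rw [mapPairs_pairsOfCoords, ← hy]
    congr 1
    funext i
    exact MvPolynomial.aeval_X y i
  have hPu : ∀ z : Submonoid.powers P, IsUnit ((MvPolynomial.aeval y : B →ₐ[F] S) z) := by
    rintro ⟨_, m, rfl⟩
    rw [map_pow]
    refine IsUnit.pow m ?_
    rw [← prodNorms_mapPairs, isUnit_prodNorms_iff, hyl]
    exact hlu
  -- The specialization of the generic list of vectors to the list found over `S`.
  let χ : C →ₐ[F] S := IsLocalization.liftAlgHom (M := Submonoid.powers P) hPu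
  have hχ : χ.comp ι = MvPolynomial.aeval y := by
    apply AlgHom.ext
    intro z
    exact IsLocalization.lift_eq _ z
  have hG : (SO q).map (CommAlgCat.ofHom χ) G = (SO q).map (CommAlgCat.ofHom f : A ⟶ S) g := by
    apply soPoints_ext
    rw [SO_map_coe, SO_map_coe]
    change extendScalars χ (rotationProd _ (mapPairs ι l₀)) = extendScalars f _
    rw [extendScalars_rotationProd χ hl, hgl, ← hyl, ← hχ]
    simp only [l₀, mapPairs_pairsOfCoords]
    rfl
  -- Both maps `A → S` classify the same isometry over `S`, so they agree.
  have hψ : ψ ≫ CommAlgCat.ofHom χ = CommAlgCat.ofHom f := by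
    apply r.homEquiv.injective
    rw [r.homEquiv_comp, r.homEquiv_eq (CommAlgCat.ofHom f : A ⟶ S)]
    exact (congrArg _ (Equiv.apply_symm_apply r.homEquiv G)).trans hG
  have hsurj : Function.Surjective (PrimeSpectrum.comap ψ.hom.toRingHom) := by
    intro x
    -- A point of `Spec A` lifts to `Spec S` by faithful flatness, and the lift maps to `Spec C`.
    obtain ⟨z, hz⟩ := (RingHom.FaithfullyFlat.iff_flat_and_comap_surjective.mp hf.1).2 x
    refine ⟨PrimeSpectrum.comap χ.toRingHom z, ?_⟩
    rw [← PrimeSpectrum.comap_comp_apply, ← hz]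
    exact congrArg (fun t => PrimeSpectrum.comap t.hom.toRingHom z) hψ
  exact hsurj.denseRange.preconnectedSpace (PrimeSpectrum.continuous_comap _)

theorem IsRegularOrthogonal.identityComponentPoints_eq {n : ℕ}
    {e : Module.Basis (Fin (n + 1)) F V} (he : IsRegularOrthogonal q e) (R : CommAlgCat.{u} F) :
    GroupFunctor.identityComponentPoints (SO q) R = Set.univ := by
  refine Set.eq_univ_of_forall fun g A r x => ?_
  have := he.preconnectedSpace A r
  rw [PreconnectedSpace.connectedComponent_eq_univ]
  exact Set.mem_univ _

theorem IsRegularOrthogonal.isIdentityComponent_id {n : ℕ}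
    {e : Module.Basis (Fin (n + 1)) F V} (he : IsRegularOrthogonal q e) :
    GroupFunctor.IsIdentityComponent (𝟙 (SO q)) where
  injective R := Function.injective_id
  range_eq R := by
    rw [he.identityComponentPoints_eq]
    exact Set.range_id

end SpecialOrthogonalConnected

/-! ### Normal form of an orthogonal involution -/

section NormalForm

variable {F : Type u} [Field F] [Invertible (2 : F)] {H : Type v} [Ring H] [Algebra F H]

theorem conjQ_apply (x : H) : conjQ F H x = algebraMap F H (redTrace F H x) - x := rfl

theorem add_conjQ (x : H) : x + conjQ F H x = algebraMap F H (redTrace F H x) := by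
  rw [conjQ_apply]; abel

variable [h : IsQuaternionAlgebra F H]

theorem redTrace_one : redTrace F H (1 : H) = 2 := by
  obtain ⟨a, b, -, -, ⟨e⟩⟩ := h.exists_algEquiv
  rw [redTrace_eq a b e, map_one, QuaternionAlgebra.re_one, mul_one]

theorem redTrace_mul_comm (x y : H) : redTrace F H (x * y) = redTrace F H (y * x) := by
  obtain ⟨a, b, -, -, ⟨e⟩⟩ := h.exists_algEquiv
  rw [redTrace_eq a b e, redTrace_eq a b e, map_mul, map_mul]
  congr 1
  simp
  ring

theorem redTrace_algEquiv (σ : H ≃ₐ[F] H) (x : H) : redTrace F H (σ x) = redTrace F H x := by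
  obtain ⟨a, b, -, -, ⟨e⟩⟩ := h.exists_algEquiv
  rw [redTrace_eq a b e, redTrace_eq a b (σ.trans e)]
  rfl

theorem conjQ_mul (x y : H) : conjQ F H (x * y) = conjQ F H y * conjQ F H x := by
  obtain ⟨a, b, -, -, ⟨e⟩⟩ := h.exists_algEquiv
  simp [conjQ_eq_star a b e]

theorem conjQ_conjQ (x : H) : conjQ F H (conjQ F H x) = x := by
  obtain ⟨a, b, -, -, ⟨e⟩⟩ := h.exists_algEquiv
  simp [conjQ_eq_star a b e]

theorem mul_add_mul_of_redTrace_eq_zero {x y : H} (hx : redTrace F H x = 0)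
    (hy : redTrace F H y = 0) : x * y + y * x = algebraMap F H (redTrace F H (x * y)) := by
  rw [← add_conjQ, conjQ_mul, conjQ_apply, conjQ_apply, hx, hy, map_zero, zero_sub, zero_sub,
    neg_mul_neg]

theorem redTrace_sub_half (x : H) :
    redTrace F H (x - algebraMap F H (⅟2 * redTrace F H x)) = 0 := by
  rw [map_sub, Algebra.algebraMap_eq_smul_one, map_smul, redTrace_one, smul_eq_mul, mul_right_comm,
    invOf_mul_self, one_mul, sub_self]

/-- The trace form is nondegenerate on pure quaternions. Scalars pair to zero with `x` anyway, so
`x` is orthogonal to all of `H`, and pairing with `1, i, j, k` isolates each coordinate. -/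
theorem eq_zero_of_redTrace_mul {x : H} (hx : redTrace F H x = 0)
    (H0 : ∀ y, redTrace F H y = 0 → redTrace F H (x * y) = 0) : x = 0 := by
  have H1 (y : H) : redTrace F H (x * y) = 0 := by
    have := H0 _ (redTrace_sub_half y)
    rwa [mul_sub, map_sub, ← Algebra.commutes, ← Algebra.smul_def, map_smul, hx, smul_zero,
      sub_zero] at this
  obtain ⟨a, b, ha, hb, ⟨e⟩⟩ := h.exists_algEquiv
  have h2 : (2 : F) ≠ 0 := Invertible.ne_zero 2
  have H2 (y : ℍ[F,a,b]) : (e x * y).re = 0 := by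
    have := H1 (e.symm y)
    rw [redTrace_eq a b e, map_mul, e.apply_symm_apply] at this
    exact (mul_eq_zero.mp this).resolve_left h2
  apply e.injective
  rw [map_zero]
  have h1 := H2 1
  have hi := H2 ⟨0, 1, 0, 0⟩
  have hj := H2 ⟨0, 0, 1, 0⟩
  have hk := H2 ⟨0, 0, 0, 1⟩
  simp [ha, hb] at h1 hi hj hk
  ext <;> simpa

variable {φ : H →ₗ[F] H}

/-- The composition of an orthogonal involution with the standard involution. -/
def IsOrthogonalInvolution.algEquiv (hφ : IsOrthogonalInvolution φ) : H ≃ₐ[F] H :=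
  AlgEquiv.ofLinearEquiv
    (LinearEquiv.ofLinearMap (φ ∘ₗ conjQ F H) (conjQ F H ∘ₗ φ)
      (LinearMap.ext fun x => by simp [conjQ_conjQ, hφ.involutive])
      (LinearMap.ext fun x => by simp [conjQ_conjQ, hφ.involutive]))
    (by
      have : conjQ F H (1 : H) = 1 := map_one_of_invol conjQ_mul conjQ_conjQ
      simp [this, map_one_of_invol hφ.map_mul hφ.involutive])
    (fun x y => by simp [conjQ_mul, hφ.map_mul])

theorem IsOrthogonalInvolution.algEquiv_apply (hφ : IsOrthogonalInvolution φ) (x : H) :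
    hφ.algEquiv x = φ (conjQ F H x) := rfl

theorem IsOrthogonalInvolution.algEquiv_algEquiv (hφ : IsOrthogonalInvolution φ) (x : H) :
    hφ.algEquiv (hφ.algEquiv x) = x := by
  have hc (x : H) : conjQ F H (hφ.algEquiv x) = hφ.algEquiv (conjQ F H x) := by
    rw [conjQ_apply, redTrace_algEquiv, conjQ_apply, map_sub, AlgEquiv.commutes]
  rw [hφ.algEquiv_apply (hφ.algEquiv x), hc, hφ.algEquiv_apply, conjQ_conjQ, hφ.involutive]

/-- There are anticommuting pure quaternions fixed by the orthogonal involution. -/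
theorem IsOrthogonalInvolution.exists_anticommuting (hφ : IsOrthogonalInvolution φ) :
    ∃ (α β : F) (i j : H), α ≠ 0 ∧ β ≠ 0 ∧ i * i = algebraMap F H α ∧ j * j = algebraMap F H β ∧
      i * j = -(j * i) ∧ redTrace F H i = 0 ∧ redTrace F H j = 0 ∧
      hφ.algEquiv i = -i ∧ hφ.algEquiv j = -j := by
  set σ := hφ.algEquiv with hσ
  have h2 : (2 : F) ≠ 0 := Invertible.ne_zero 2
  have hσσ (x) : σ (σ x) = x := hφ.algEquiv_algEquiv x
  have hT (x y : H) : redTrace F H (σ x * σ y) = redTrace F H (x * y) := by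
    rw [← _root_.map_mul, redTrace_algEquiv]
  have hT' (x y : H) : redTrace F H (x * σ y) = redTrace F H (σ x * y) := by
    rw [← hT, hσσ]
  have hsq {x : H} (hx : redTrace F H x = 0) :
      x * x = algebraMap F H (⅟2 * redTrace F H (x * x)) := by
    have h1 := mul_add_mul_of_redTrace_eq_zero hx hx
    rw [_root_.map_mul, ← h1, ← two_mul, ← mul_assoc, ← map_ofNat (algebraMap F H) 2, ← _root_.map_mul,
      invOf_mul_self, map_one, one_mul]
  -- If the `-1` eigenspace of `σ` in the pure quaternions were totally isotropic, polarizing on the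
  -- elements `z - σ z` would make each `x - σ x` orthogonal to all pure quaternions. Then `σ` is
  -- the identity and the involution is the standard one.
  obtain ⟨i, hi0, hi, hiT⟩ : ∃ i : H, redTrace F H i = 0 ∧ σ i = -i ∧ redTrace F H (i * i) ≠ 0 := by
    by_contra! hcon
    have hfix (x : H) (hx : redTrace F H x = 0) : x - σ x = 0 := by
      apply eq_zero_of_redTrace_mul (F := F)
      · rw [map_sub, redTrace_algEquiv, sub_self]
      intro y hy
      have hw (z : H) (hz : redTrace F H z = 0) :
          redTrace F H ((z - σ z) * (z - σ z)) = 0 :=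
        hcon _ (by rw [map_sub, redTrace_algEquiv, sub_self]) (by rw [map_sub, hσσ]; abel)
      have h1 := hw x hx
      have h2 := hw y hy
      have h3 := hw (x + y) (by rw [map_add, hx, hy, add_zero])
      simp only [map_add, sub_mul, mul_sub, add_mul, mul_add, map_sub, hT, hT'] at h1 h2 h3 ⊢
      have e1 := redTrace_mul_comm (F := F) y x
      have e2 : redTrace F H (σ y * x) = redTrace F H (σ x * y) := by
        rw [redTrace_mul_comm, hT']
      rw [e1, e2] at h3
      have h4 : 4 * (redTrace F H (x * y) - redTrace F H (σ x * y)) = 0 := by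
        linear_combination h3 - h1 - h2
      refine (mul_eq_zero.mp h4).resolve_left ?_
      rw [show (4 : F) = 2 * 2 by norm_num]
      exact mul_ne_zero ‹_› ‹_›
    apply hφ.ne_conj
    ext x
    have h1 := sub_eq_zero.mp (hfix _ (redTrace_sub_half x))
    rw [map_sub, AlgEquiv.commutes, sub_left_inj] at h1
    have h3 := hσσ (conjQ F H x)
    have h4 : σ (conjQ F H x) = conjQ F H x := by
      rw [conjQ_apply, map_sub, AlgEquiv.commutes, ← h1]
    have h5 : φ x = σ (conjQ F H x) := by rw [hσ, hφ.algEquiv_apply, conjQ_conjQ]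
    rw [h5, h4]
  have hiα : ⅟2 * redTrace F H (i * i) ≠ 0 := mul_ne_zero (Invertible.ne_zero (⅟2)) hiT
  -- Otherwise the orthogonal complement of `i` is isotropic, hence zero by nondegeneracy, so `H` is
  -- spanned by `1` and `i` and is commutative, which it is not.
  obtain ⟨w, hw0, hiw, hwT⟩ : ∃ w : H, redTrace F H w = 0 ∧ redTrace F H (i * w) = 0 ∧
      redTrace F H (w * w) ≠ 0 := by
    by_contra! hcon
    let r (y : H) : F := redTrace F H (i * y) / redTrace F H (i * i)
    have hr0 (y : H) (hy : redTrace F H y = 0) : redTrace F H (y - r y • i) = 0 := by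
      rw [map_sub, map_smul, hy, hi0, smul_zero, sub_zero]
    have hr1 (y : H) : redTrace F H (i * (y - r y • i)) = 0 := by
      rw [mul_sub, mul_smul_comm, map_sub, map_smul, smul_eq_mul, div_mul_cancel₀ _ hiT, sub_self]
    have hr (y : H) (hy : redTrace F H y = 0) : y = r y • i := by
      rw [← sub_eq_zero]
      apply eq_zero_of_redTrace_mul (hr0 y hy)
      intro z hz
      have h1 := hcon _ (hr0 y hy) (hr1 y)
      have h2 := hcon _ (hr0 z hz) (hr1 z)
      have h3 := hcon (y - r y • i + (z - r z • i)) (by rw [map_add, hr0 y hy, hr0 z hz, add_zero])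
        (by rw [mul_add, map_add, hr1, hr1, add_zero])
      have h4 := hr1 y
      generalize y - r y • i = y' at *
      rw [redTrace_mul_comm] at h4
      simp only [add_mul, mul_add, mul_sub, sub_mul, map_add, map_sub, mul_smul_comm,
        smul_mul_assoc, map_smul, h4, h1, smul_zero, sub_zero,
        redTrace_mul_comm (F := F) z y', redTrace_mul_comm (F := F) i y'] at h2 h3
      have h5 : 2 * redTrace F H (y' * z) = 0 := by linear_combination h3 - h2
      exact (mul_eq_zero.mp h5).resolve_left ‹_›
    have hform (x : H) : ∃ s t : F, x = algebraMap F H s + t • i :=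
      ⟨_, _, (eq_add_of_sub_eq' (hr _ (redTrace_sub_half x)))⟩
    have hcomm (x y : H) : x * y = y * x := by
      obtain ⟨s, t, rfl⟩ := hform x
      obtain ⟨s', t', rfl⟩ := hform y
      simp only [Algebra.algebraMap_eq_smul_one, add_mul, mul_add, smul_mul_assoc, mul_smul_comm,
        one_mul, mul_one]
      module
    obtain ⟨a, b, ha, hb, ⟨e⟩⟩ := h.exists_algEquiv
    have := congrArg e (hcomm (e.symm ⟨0, 1, 0, 0⟩) (e.symm ⟨0, 0, 1, 0⟩))
    simp only [_root_.map_mul, e.apply_symm_apply] at this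
    have := congrArg QuaternionAlgebra.imK this
    simp at this
    exact h2 (by linear_combination this)
  -- The norms of the eigenvectors `w + σ w` and `w - σ w` add up to `4` times that of `w`, so one
  -- of them is anisotropic; both stay orthogonal to `i`.
  obtain ⟨s, v, hv0, hiv, hvT, hs, hv⟩ : ∃ (s : F) (v : H), redTrace F H v = 0 ∧
      redTrace F H (i * v) = 0 ∧ redTrace F H (v * v) ≠ 0 ∧ (s = 1 ∨ s = -1) ∧ σ v = s • v := by
    have h1 : redTrace F H ((w + σ w) * (w + σ w)) + redTrace F H ((w - σ w) * (w - σ w)) =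
        4 * redTrace F H (w * w) := by
      simp only [add_mul, mul_add, sub_mul, mul_sub, map_add, map_sub, hT]
      ring
    have h3 : redTrace F H (i * σ w) = 0 := by
      rw [hT', hi, neg_mul, map_neg, hiw, neg_zero]
    have hw0' : redTrace F H (σ w) = 0 := by rw [redTrace_algEquiv, hw0]
    by_cases hp : redTrace F H ((w + σ w) * (w + σ w)) = 0
    · refine ⟨-1, w - σ w, by rw [map_sub, hw0, hw0', sub_zero],
        by rw [mul_sub, map_sub, hiw, h3, sub_zero], ?_, Or.inr rfl, ?_⟩
      · rw [hp, zero_add] at h1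
        rw [h1, show (4 : F) = 2 * 2 by norm_num]
        exact mul_ne_zero (mul_ne_zero h2 h2) hwT
      · rw [map_sub, hσσ, neg_smul, one_smul]; abel
    · exact ⟨1, w + σ w, by rw [map_add, hw0, hw0', add_zero],
        by rw [mul_add, map_add, hiw, h3, add_zero], hp, Or.inl rfl,
        by rw [map_add, hσσ, one_smul]; abel⟩
  have hanti : i * v = -(v * i) := by
    have := mul_add_mul_of_redTrace_eq_zero hi0 hv0
    rw [hiv, map_zero] at this
    exact eq_neg_of_add_eq_zero_left this
  have hvβ : ⅟2 * redTrace F H (v * v) ≠ 0 := mul_ne_zero (Invertible.ne_zero (⅟2)) hvT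
  rcases hs with rfl | rfl
  -- If `σ v = v`, then `i v` is negated by `σ`, still anticommutes with `i`, and has square `-i²
  -- v²`.
  · refine ⟨_, -(⅟2 * redTrace F H (i * i) * (⅟2 * redTrace F H (v * v))), i, i * v, hiα,
      neg_ne_zero.mpr (mul_ne_zero hiα hvβ), hsq hi0, ?_, ?_, hi0, hiv, hi, ?_⟩
    · rw [map_neg, _root_.map_mul, ← hsq hi0, ← hsq hv0]
      calc i * v * (i * v) = i * (v * i) * v := by noncomm_ring
        _ = _ := by rw [← neg_eq_iff_eq_neg.mpr hanti]; noncomm_ring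
    · rw [mul_assoc i v i, ← neg_eq_iff_eq_neg.mpr hanti, mul_neg, neg_neg]
    · rw [_root_.map_mul, hi, hv, one_smul, neg_mul]
  · exact ⟨_, _, i, v, hiα, hvβ, hsq hi0, hsq hv0, hanti, hi0, hv0, hi, by
      rw [hv, neg_smul, one_smul]⟩

/-- Every orthogonal involution is `w + xi + yj + zk ↦ w + xi + yj - zk` in a suitable presentation
of the quaternion algebra. -/
theorem IsOrthogonalInvolution.exists_algEquiv (hφ : IsOrthogonalInvolution φ) :
    ∃ α β : F, α ≠ 0 ∧ β ≠ 0 ∧ ∃ e : H ≃ₐ[F] ℍ[F,α,β], ∀ x,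
      e (φ x) = ⟨(e x).re, (e x).imI, (e x).imJ, -(e x).imK⟩ := by
  obtain ⟨α, β, i, j, hα, hβ, hi, hj, hij, hi0, hj0, hσi, hσj⟩ := hφ.exists_anticommuting
  have h2 : (2 : F) ≠ 0 := Invertible.ne_zero 2
  let B : QuaternionAlgebra.Basis H α 0 β :=
    { i := i, j := j, k := i * j
      i_mul_i := by rw [hi, zero_smul, add_zero, Algebra.algebraMap_eq_smul_one]
      j_mul_j := by rw [hj, Algebra.algebraMap_eq_smul_one]
      i_mul_j := rfl
      j_mul_i := by rw [hij, zero_smul, zero_sub, neg_neg] }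
  let f : ℍ[F,α,β] →ₐ[F] H := B.liftHom
  have hf (x : ℍ[F,α,β]) : f x = algebraMap F H x.re + x.imI • i + x.imJ • j + x.imK • (i * j) :=
    rfl
  have hij0 : redTrace F H (i * j) = 0 := by
    have h1 := redTrace_mul_comm (F := F) i j
    rw [← neg_eq_iff_eq_neg.mpr hij, map_neg] at h1
    have h3 : 2 * redTrace F H (i * j) = 0 := by linear_combination h1
    exact (mul_eq_zero.mp h3).resolve_left h2
  have htr (x : ℍ[F,α,β]) : redTrace F H (f x) = 2 * x.re := by
    rw [hf, map_add, map_add, map_add, map_smul, map_smul, map_smul, hi0, hj0, hij0,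
      Algebra.algebraMap_eq_smul_one, map_smul, redTrace_one]
    simp [mul_comm]
  have hinj : Function.Injective f := by
    rw [injective_iff_map_eq_zero]
    intro x hx
    -- The kernel is orthogonal to everything under the trace form, so it vanishes; surjectivity
    -- then follows from equal dimension `4`.
    have H2 (y : ℍ[F,α,β]) : (x * y).re = 0 := by
      have := htr (x * y)
      rw [_root_.map_mul, hx, zero_mul, map_zero] at this
      exact (mul_eq_zero.mp this.symm).resolve_left h2
    have h1 := H2 1
    have hi := H2 ⟨0, 1, 0, 0⟩
    have hj := H2 ⟨0, 0, 1, 0⟩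
    have hk := H2 ⟨0, 0, 0, 1⟩
    simp [hα, hβ] at h1 hi hj hk
    ext <;> simpa
  have hbij : Function.Bijective f := by
    refine ⟨hinj, ?_⟩
    obtain ⟨a, b, -, -, ⟨e⟩⟩ := h.exists_algEquiv
    have hd : Module.finrank F ℍ[F,α,β] = Module.finrank F H := by
      rw [e.toLinearEquiv.finrank_eq, QuaternionAlgebra.finrank_eq_four,
        QuaternionAlgebra.finrank_eq_four]
    exact (LinearMap.injective_iff_surjective_of_finrank_eq_finrank (f := f.toLinearMap) hd).mp hinj
  let e := (AlgEquiv.ofBijective f hbij).symm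
  refine ⟨α, β, hα, hβ, e, fun x => ?_⟩
  have hex : f (e x) = x := (AlgEquiv.ofBijective f hbij).apply_symm_apply x
  apply e.symm.injective
  rw [e.symm_apply_apply]
  change φ x = f _
  have hφx : φ x = hφ.algEquiv (conjQ F H x) := by rw [hφ.algEquiv_apply, conjQ_conjQ]
  have hc : conjQ F H x = f (star (e x)) := conjQ_eq_star α β e x
  rw [hφx, hc, hf, hf]
  simp [hσi, hσj]

end NormalForm

/-! ### The Hermitian matrices and the Clifford relations -/

section Hermitian

variable {F : Type u} [Field F] {H : Type v} [Ring H] [Algebra F H]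
  {R S : Type u} [CommRing R] [Algebra F R] [CommRing S] [Algebra F S]

variable (F H) in
theorem IsQuaternionAlgebra.nontrivial [h : IsQuaternionAlgebra F H] : Nontrivial H := by
  obtain ⟨a, b, -, -, ⟨e⟩⟩ := h.exists_algEquiv
  exact e.toEquiv.nontrivial

/-- Lets identities between scalars of `R` be checked inside the noncommutative ring `R ⊗ H`, where
`z z̄` lives. -/
theorem smul_one_injective [IsQuaternionAlgebra F H] :
    Function.Injective fun r : R => r • (1 : R ⊗[F] H) := by
  intro r s hrs
  have := IsQuaternionAlgebra.nontrivial F H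
  have h := Algebra.TensorProduct.includeLeft_injective (R := F) (S := R) (A := R) (B := H)
    (FaithfulSMul.algebraMap_injective F H)
  apply h
  simpa [Algebra.TensorProduct.one_def, TensorProduct.smul_tmul'] using hrs

variable {φ : H →ₗ[F] H}

variable (R φ) in
/-- The entry `s` of a Hermitian matrix. -/
def hermS : R ⊗[F] (F × F × symmPart φ) →ₗ[R] R :=
  LinearMap.liftBaseChange R (Algebra.linearMap F R ∘ₗ LinearMap.fst F F (F × symmPart φ))

variable (R φ) in
/-- The entry `t` of a Hermitian matrix. -/
def hermT : R ⊗[F] (F × F × symmPart φ) →ₗ[R] R :=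
  LinearMap.liftBaseChange R (Algebra.linearMap F R ∘ₗ LinearMap.fst F F (symmPart φ) ∘ₗ
    LinearMap.snd F F (F × symmPart φ))

variable (R φ) in
/-- The entry `z` of a Hermitian matrix. -/
def hermZ : R ⊗[F] (F × F × symmPart φ) →ₗ[R] R ⊗[F] H :=
  ((symmPart φ).subtype ∘ₗ LinearMap.snd F F (symmPart φ) ∘ₗ
    LinearMap.snd F F (F × symmPart φ)).baseChange R

theorem hermS_tmul (r : R) (v : F × F × symmPart φ) :
    hermS R φ (r ⊗ₜ v) = r * algebraMap F R v.1 := by simp [hermS]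

theorem hermT_tmul (r : R) (v : F × F × symmPart φ) :
    hermT R φ (r ⊗ₜ v) = r * algebraMap F R v.2.1 := by simp [hermT]

theorem hermZ_tmul (r : R) (v : F × F × symmPart φ) :
    hermZ R φ (r ⊗ₜ v) = r ⊗ₜ v.2.2.1 := by simp [hermZ]

theorem algebraMap_tmul_eq (r : R) (s : F) :
    r ⊗ₜ[F] algebraMap F H s = (r * algebraMap F R s) • (1 : R ⊗[F] H) := by
  rw [Algebra.TensorProduct.one_def, TensorProduct.smul_tmul', smul_eq_mul, mul_one,
    Algebra.algebraMap_eq_smul_one, TensorProduct.tmul_smul, TensorProduct.smul_tmul',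
    Algebra.smul_def, mul_comm]

theorem baseChange_hermZ (v : R ⊗[F] (F × F × symmPart φ)) :
    φ.baseChange R (hermZ R φ v) = hermZ R φ v := by
  induction v with
  | zero => simp
  | add x y hx hy => rw [map_add, map_add, hx, hy]
  | tmul r v => rw [hermZ_tmul, LinearMap.baseChange_tmul]; congr 1; exact v.2.2.2

variable [Invertible (2 : F)]

theorem conjTransposeQ_eq (M : Matrix (Fin 2) (Fin 2) (R ⊗[F] H)) :
    conjTransposeQ M = ddagTranspose (conjQ F H) M := rfl

theorem conjTransposeQ_smul (r : R) (M : Matrix (Fin 2) (Fin 2) (R ⊗[F] H)) :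
    conjTransposeQ (r • M) = r • conjTransposeQ M := by
  ext i j
  simp [conjTransposeQ]

variable (F H R) in
/-- The reduced trace on `R ⊗ H`. -/
def redTraceR : R ⊗[F] H →ₗ[R] R :=
  LinearMap.liftBaseChange R (Algebra.linearMap F R ∘ₗ redTrace F H)

theorem redTraceR_tmul (r : R) (x : H) :
    redTraceR F H R (r ⊗ₜ x) = r * algebraMap F R (redTrace F H x) := by
  simp [redTraceR]

theorem add_conjQ_baseChange (x : R ⊗[F] H) :
    x + (conjQ F H).baseChange R x = redTraceR F H R x • 1 := by
  induction x with
  | zero => simp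
  | add x y hx hy => rw [map_add, map_add, add_smul, ← hx, ← hy]; abel
  | tmul r x =>
    rw [LinearMap.baseChange_tmul, ← TensorProduct.tmul_add, add_conjQ, redTraceR_tmul,
      Algebra.TensorProduct.one_def, TensorProduct.smul_tmul', smul_eq_mul, mul_one,
      Algebra.algebraMap_eq_smul_one, TensorProduct.tmul_smul, TensorProduct.smul_tmul',
      Algebra.smul_def, mul_comm]

theorem redTraceR_conjQ [IsQuaternionAlgebra F H] (x : R ⊗[F] H)
    (hc : (conjQ F H).baseChange R ((conjQ F H).baseChange R x) = x) :
    redTraceR F H R ((conjQ F H).baseChange R x) = redTraceR F H R x := by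
  apply smul_one_injective (F := F) (H := H)
  simp only
  rw [← add_conjQ_baseChange, ← add_conjQ_baseChange, hc, add_comm]

theorem toHermitian_eq (v : R ⊗[F] (F × F × symmPart φ)) :
    toHermitian R φ v = !![hermS R φ v • 1, hermZ R φ v;
      (conjQ F H).baseChange R (hermZ R φ v), hermT R φ v • 1] := by
  have h1 : (Algebra.linearMap F H ∘ₗ LinearMap.fst F F (F × symmPart φ)).baseChange R v =
      hermS R φ v • 1 := by
    induction v with
    | zero => simp
    | add x y hx hy => rw [map_add, map_add, hx, hy, add_smul]
    | tmul r v => rw [hermS_tmul, ← algebraMap_tmul_eq]; rfl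
  have h2 : (Algebra.linearMap F H ∘ₗ LinearMap.fst F F (symmPart φ) ∘ₗ
      LinearMap.snd F F (F × symmPart φ)).baseChange R v = hermT R φ v • 1 := by
    clear h1
    induction v with
    | zero => simp
    | add x y hx hy => rw [map_add, map_add, hx, hy, add_smul]
    | tmul r v => rw [hermT_tmul, ← algebraMap_tmul_eq]; rfl
  have h3 : (conjQ F H ∘ₗ ((symmPart φ).subtype ∘ₗ LinearMap.snd F F (symmPart φ) ∘ₗ
      LinearMap.snd F F (F × symmPart φ))).baseChange R v =
      (conjQ F H).baseChange R (hermZ R φ v) := by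
    rw [LinearMap.baseChange_comp]; rfl
  rw [toHermitian, h1, h2, h3]
  rfl

variable (R φ) in
/-- `toHermitian` as a linear map. -/
def toHermitianLin : R ⊗[F] (F × F × symmPart φ) →ₗ[R] Matrix (Fin 2) (Fin 2) (R ⊗[F] H) where
  toFun := toHermitian R φ
  map_add' v w := by
    simp only [toHermitian_eq, map_add, add_smul]
    ext i j
    fin_cases i <;> fin_cases j <;> simp
  map_smul' r v := by
    simp only [toHermitian_eq, map_smul, smul_assoc]
    ext i j
    fin_cases i <;> fin_cases j <;> simp

variable (R φ) in
/-- A linear map from matrices to vectors, which is inverse to `toHermitian` on Hermitian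
matrices. -/
def ofHermitian (h1 : ∀ x, φ (φ x) = x) :
    Matrix (Fin 2) (Fin 2) (R ⊗[F] H) →ₗ[R] R ⊗[F] (F × F × symmPart φ) :=
  -- The projector `(1 + φ)/2` onto `H⁺`; each diagonal entry is recovered as half its reduced
  -- trace.
  let proj : H →ₗ[F] symmPart φ := (⅟(2 : F) • (LinearMap.id + φ)).codRestrict _ fun x => by
    change φ _ = _
    simp [h1, add_comm]
  (redTraceR F H R ∘ₗ Matrix.entryLinearMap R (R ⊗[F] H) 0 0).smulRight (1 ⊗ₜ (⅟2, 0, 0)) +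
    (redTraceR F H R ∘ₗ Matrix.entryLinearMap R (R ⊗[F] H) 1 1).smulRight (1 ⊗ₜ (0, ⅟2, 0)) +
    ((LinearMap.inr F F (F × symmPart φ) ∘ₗ LinearMap.inr F F (symmPart φ) ∘ₗ proj).baseChange R ∘ₗ
      Matrix.entryLinearMap R (R ⊗[F] H) 0 1)

theorem smul_half_two {M : Type*} [AddCommGroup M] [Module F M] (x : M) :
    ⅟(2 : F) • (x + x) = x := by
  rw [← two_smul F, smul_smul, invOf_mul_self, one_smul]

theorem ofHermitian_toHermitian [IsQuaternionAlgebra F H] (h1 : ∀ x, φ (φ x) = x)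
    (v : R ⊗[F] (F × F × symmPart φ)) : ofHermitian R φ h1 (toHermitian R φ v) = v := by
  have : (ofHermitian R φ h1) ∘ₗ toHermitianLin R φ = LinearMap.id := by
    refine ext_one_tmul fun v => ?_
    change ofHermitian R φ h1 (toHermitian R φ _) = _
    obtain ⟨s, t, z⟩ := v
    have hone : algebraMap F R s • (1 : R ⊗[F] H) = 1 ⊗ₜ algebraMap F H s := by
      rw [algebraMap_tmul_eq, one_mul]
    have hone' : algebraMap F R t • (1 : R ⊗[F] H) = 1 ⊗ₜ algebraMap F H t := by
      rw [algebraMap_tmul_eq, one_mul]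
    have htr (s : F) : redTrace F H (algebraMap F H s) = s * 2 := by
      rw [Algebra.algebraMap_eq_smul_one, map_smul, redTrace_one, smul_eq_mul]
    have hz : ⅟(2 : F) • (z.1 + φ z.1) = z.1 := by
      rw [show φ z.1 = z.1 from z.2, smul_half_two]
    simp only [toHermitian_eq, ofHermitian, LinearMap.add_apply, LinearMap.comp_apply,
      Matrix.entryLinearMap_apply, Matrix.of_apply, Matrix.cons_val', Matrix.cons_val_zero,
      Matrix.cons_val_one, Matrix.cons_val_fin_one, hermS_tmul, hermT_tmul, hermZ_tmul, one_mul,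
      hone, hone', LinearMap.baseChange_tmul, LinearMap.smulRight_apply, redTraceR_tmul, htr,
      algebraMap_smul, ← TensorProduct.tmul_smul, ← TensorProduct.tmul_add]
    rw [LinearMap.id_apply]
    congr 1
    refine Prod.ext ?_ (Prod.ext ?_ (Subtype.ext ?_))
    · simp [Invertible.ne_zero (2 : F)]
    · simp [Invertible.ne_zero (2 : F)]
    · simpa using hz
  exact LinearMap.congr_fun this v

theorem toHermitian_injective [IsQuaternionAlgebra F H] (h1 : ∀ x, φ (φ x) = x) :
    Function.Injective (toHermitian R φ) :=
  Function.LeftInverse.injective (ofHermitian_toHermitian h1)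

theorem conjTransposeQ_toHermitian [IsQuaternionAlgebra F H]
    (v : R ⊗[F] (F × F × symmPart φ)) :
    conjTransposeQ (toHermitian R φ v) = toHermitian R φ v := by
  have h1 : (conjQ F H).baseChange R (1 : R ⊗[F] H) = 1 := by
    simp [Algebra.TensorProduct.one_def, map_one_of_invol (conjQ_mul (F := F) (H := H)) conjQ_conjQ]
  rw [toHermitian_eq]
  ext i j
  fin_cases i <;> fin_cases j <;>
    simp [conjTransposeQ, h1, baseChange_invol (conjQ_conjQ (F := F) (H := H))]

theorem toHermitian_ofHermitian [IsQuaternionAlgebra F H] (h1 : ∀ x, φ (φ x) = x)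
    {M : Matrix (Fin 2) (Fin 2) (R ⊗[F] H)} (hM : M ∈ hermitianMatrices R φ) :
    toHermitian R φ (ofHermitian R φ h1 M) = M := by
  obtain ⟨hM, hφM⟩ := hM
  have h00 : (conjQ F H).baseChange R (M 0 0) = M 0 0 := congrFun₂ hM 0 0
  have h11 : (conjQ F H).baseChange R (M 1 1) = M 1 1 := congrFun₂ hM 1 1
  have h10 : (conjQ F H).baseChange R (M 0 1) = M 1 0 := congrFun₂ hM 1 0
  have hhalf {x : R ⊗[F] H} (hx : (conjQ F H).baseChange R x = x) :
      (algebraMap F R ⅟2 * redTraceR F H R x) • (1 : R ⊗[F] H) = x := by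
    rw [mul_smul, ← add_conjQ_baseChange, hx, algebraMap_smul, smul_half_two]
  have hhalf' {x : R ⊗[F] H} (hx : φ.baseChange R x = x) :
      ⅟(2 : F) • (x + φ.baseChange R x) = x := by rw [hx, smul_half_two]
  have hV (x : R ⊗[F] H) (f : H →ₗ[F] symmPart φ) :
      hermS R φ ((LinearMap.inr F F (F × symmPart φ) ∘ₗ LinearMap.inr F F (symmPart φ) ∘ₗ
        f).baseChange R x) = 0 ∧
      hermT R φ ((LinearMap.inr F F (F × symmPart φ) ∘ₗ LinearMap.inr F F (symmPart φ) ∘ₗ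
        f).baseChange R x) = 0 ∧
      hermZ R φ ((LinearMap.inr F F (F × symmPart φ) ∘ₗ LinearMap.inr F F (symmPart φ) ∘ₗ
        f).baseChange R x) = ((symmPart φ).subtype ∘ₗ f).baseChange R x := by
    induction x with
    | zero => simp
    | add x y hx hy => simp only [map_add, hx, hy, add_zero, and_self]
    | tmul r x => simp [hermS_tmul, hermT_tmul, hermZ_tmul]
  have hS : hermS R φ (ofHermitian R φ h1 M) = algebraMap F R ⅟2 * redTraceR F H R (M 0 0) := by
    simp [ofHermitian, hermS_tmul, hV, mul_comm]
  have hT : hermT R φ (ofHermitian R φ h1 M) = algebraMap F R ⅟2 * redTraceR F H R (M 1 1) := by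
    simp [ofHermitian, hermT_tmul, hV, mul_comm]
  have hZ : hermZ R φ (ofHermitian R φ h1 M) = M 0 1 := by
    rw [← hhalf' hφM]
    simp only [ofHermitian, LinearMap.add_apply, LinearMap.comp_apply, LinearMap.smulRight_apply,
      map_add, map_smul, hermZ_tmul, hV, LinearMap.subtype_comp_codRestrict,
      Matrix.entryLinearMap_apply, LinearMap.baseChange_smul, LinearMap.baseChange_add,
      LinearMap.baseChange_id, LinearMap.smul_apply, LinearMap.id_apply]
    simp
  rw [toHermitian_eq, hS, hT, hZ, hhalf h00, hhalf h11, h10]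
  exact (Matrix.eta_fin_two M).symm

theorem toHermitian_mem [IsQuaternionAlgebra F H] (v : R ⊗[F] (F × F × symmPart φ)) :
    toHermitian R φ v ∈ hermitianMatrices R φ :=
  ⟨conjTransposeQ_toHermitian v, by rw [toHermitian_eq]; exact baseChange_hermZ v⟩

theorem bijOn_toHermitian [IsQuaternionAlgebra F H] (h1 : ∀ x, φ (φ x) = x) :
    Set.BijOn (toHermitian R φ) Set.univ (hermitianMatrices R φ) :=
  ⟨fun v _ => toHermitian_mem v, (toHermitian_injective h1).injOn,
    fun _ hM => ⟨_, Set.mem_univ _, toHermitian_ofHermitian h1 hM⟩⟩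

theorem toHermitian_rTensor (f : R →ₐ[F] S) (v : R ⊗[F] (F × F × symmPart φ)) :
    toHermitian S φ (f.toLinearMap.rTensor _ v) =
      (Algebra.TensorProduct.map f (AlgHom.id F H)).mapMatrix (toHermitian R φ v) := by
  have hL (L : F × F × symmPart φ →ₗ[F] H) : L.baseChange S (f.toLinearMap.rTensor _ v) =
      Algebra.TensorProduct.map f (AlgHom.id F H) (L.baseChange R v) := by
    induction v with
    | zero => simp
    | add x y hx hy => simp only [map_add, hx, hy]
    | tmul r v => simp
  ext i j
  fin_cases i <;> fin_cases j <;> exact hL _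

/-- `q_H(M) = s t - z z̄`, in polarized form. -/
theorem polar_qH_smul_one [IsQuaternionAlgebra F H] (v w : R ⊗[F] (F × F × symmPart φ)) :
    QuadraticMap.polar ((qH φ).baseChange R) v w • (1 : R ⊗[F] H) =
      (hermS R φ v * hermT R φ w + hermS R φ w * hermT R φ v) • 1 -
        (hermZ R φ v * (conjQ F H).baseChange R (hermZ R φ w) +
          hermZ R φ w * (conjQ F H).baseChange R (hermZ R φ v)) := by
  induction v with
  | zero => simp
  | add x y hx hy =>
    rw [QuadraticMap.polar_add_left, add_smul, hx, hy]
    simp only [map_add, add_mul, mul_add, add_smul]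
    abel
  | tmul a v =>
    induction w with
    | zero => simp
    | add x y hx hy =>
      rw [QuadraticMap.polar_add_right, add_smul, hx, hy]
      simp only [map_add, add_mul, mul_add, add_smul]
      abel
    | tmul b w =>
      have h1 : algebraMap F H (QuadraticMap.polar (qH φ) v w) =
          algebraMap F H (v.1 * w.2.1 + w.1 * v.2.1) -
            (v.2.2.1 * conjQ F H w.2.2.1 + w.2.2.1 * conjQ F H v.2.2.1) := by
        obtain ⟨s, t, z⟩ := v
        obtain ⟨s', t', z'⟩ := w
        simp only [QuadraticMap.polar, Prod.mk_add_mk, qH_apply, map_sub, map_mul, map_add,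
          algebraMap_nrmQ, Submodule.coe_add]
        noncomm_ring
      have h2 : (a * b * algebraMap F R (QuadraticMap.polar (qH φ) v w)) • (1 : R ⊗[F] H) =
          (a * b) ⊗ₜ algebraMap F H (QuadraticMap.polar (qH φ) v w) := by
        rw [algebraMap_tmul_eq]
      rw [polar_baseChange_tmul, h2, h1, TensorProduct.tmul_sub, algebraMap_tmul_eq]
      simp only [hermS_tmul, hermT_tmul, hermZ_tmul, LinearMap.baseChange_tmul,
        Algebra.TensorProduct.tmul_mul_tmul, TensorProduct.tmul_add, map_add, map_mul, mul_comm b a]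
      congr 2
      ring

theorem qH_smul_one [IsQuaternionAlgebra F H] (v : R ⊗[F] (F × F × symmPart φ)) :
    (qH φ).baseChange R v • (1 : R ⊗[F] H) = (hermS R φ v * hermT R φ v) • 1 -
      hermZ R φ v * (conjQ F H).baseChange R (hermZ R φ v) := by
  have h := polar_qH_smul_one (R := R) v v
  rw [QuadraticMap.polar_self, two_smul, add_smul, add_smul] at h
  apply (isUnit_two_of_algebra F R).smul_left_cancel.mp
  rw [two_smul, two_smul, h]
  abel

end Hermitian

/-! ### Twisting the involution by a pure quaternion, and the Clifford relation. -/

section Clifford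

variable {F : Type u} [Field F] [Invertible (2 : F)] {H : Type v} [Ring H] [Algebra F H]
  {R S : Type u} [CommRing R] [Algebra F R] [CommRing S] [Algebra F S] {φ : H →ₗ[F] H}
  {κ : F} {k : H}

/-- The involution `φ` is the composition of the standard involution with the conjugation by the
pure quaternion `k`, where `k² = -κ`. -/
structure IsTwist (φ : H →ₗ[F] H) (κ : F) (k : H) : Prop where
  ne_zero : κ ≠ 0
  mul_self : k * k = algebraMap F H (-κ)
  conjQ_eq : conjQ F H k = -k
  map_mul_eq : ∀ x, φ x * k = k * conjQ F H x

/-- In the normal form take `k = ij`: conjugation by `k` negates `i` and `j` and fixes `k`, which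
corrects the standard involution on exactly `i` and `j`. -/
theorem IsOrthogonalInvolution.exists_isTwist [IsQuaternionAlgebra F H]
    (hφ : IsOrthogonalInvolution φ) : ∃ (κ : F) (k : H), IsTwist φ κ k := by
  obtain ⟨α, β, hα, hβ, e, he⟩ := hφ.exists_algEquiv
  refine ⟨α * β, e.symm ⟨0, 0, 0, 1⟩, mul_ne_zero hα hβ, ?_, ?_, fun x => ?_⟩
  · apply e.injective
    rw [_root_.map_mul, e.apply_symm_apply, AlgEquiv.commutes]
    ext <;> simp
  · rw [conjQ_eq_star α β e, e.apply_symm_apply, ← map_neg]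
    congr 1
    ext <;> simp
  · apply e.injective
    rw [_root_.map_mul, _root_.map_mul, he, conjQ_eq_star α β e, e.apply_symm_apply,
      e.apply_symm_apply]
    ext <;> simp

theorem IsOrthogonalInvolution.finrank_symmPart [IsQuaternionAlgebra F H]
    (hφ : IsOrthogonalInvolution φ) : Module.finrank F (symmPart φ) = 3 := by
  obtain ⟨α, β, hα, hβ, e, he⟩ := hφ.exists_algEquiv
  have h2 : (2 : F) ≠ 0 := Invertible.ne_zero 2
  have hmem (x : H) : x ∈ symmPart φ ↔ (e x).imK = 0 := by
    change φ x = x ↔ _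
    rw [← e.injective.eq_iff, he, QuaternionAlgebra.ext_iff]
    simp only [true_and]
    constructor
    · intro h
      exact (mul_eq_zero.mp (by linear_combination -h : 2 * (e x).imK = 0)).resolve_left h2
    · intro h; rw [h, neg_zero]
  let g : (Fin 3 → F) →ₗ[F] H := e.symm.toLinearMap ∘ₗ
    { toFun := fun c => ⟨c 0, c 1, c 2, 0⟩
      map_add' := fun c d => by ext <;> simp
      map_smul' := fun r c => by ext <;> simp }
  have hg (c) : e (g c) = ⟨c 0, c 1, c 2, 0⟩ := e.apply_symm_apply _
  let E : (Fin 3 → F) ≃ₗ[F] symmPart φ := LinearEquiv.ofBijective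
    (g.codRestrict _ fun c => (hmem _).mpr (by rw [hg])) (by
      constructor
      · intro c d hcd
        have := congrArg (fun t : symmPart φ => e t.1) hcd
        simp only [LinearMap.codRestrict_apply, hg, QuaternionAlgebra.mk.injEq] at this
        funext i
        fin_cases i
        · exact this.1
        · exact this.2.1
        · exact this.2.2.1
      · intro x
        refine ⟨![(e x.1).re, (e x.1).imI, (e x.1).imJ], Subtype.ext (e.injective ?_)⟩
        rw [LinearMap.codRestrict_apply, hg]
        ext
        · rfl
        · rfl
        · rfl
        · exact ((hmem _).mp x.2).symm)
  rw [← E.finrank_eq, Module.finrank_fin_fun]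

/-- The centralizer of `H⁺` in `R ⊗ H` is `R`. -/
theorem IsOrthogonalInvolution.exists_smul_one [IsQuaternionAlgebra F H]
    (hφ : IsOrthogonalInvolution φ) {x : R ⊗[F] H}
    (hx : ∀ z : H, φ z = z → x * (1 ⊗ₜ z) = (1 ⊗ₜ z) * x) : ∃ r : R, x = r • 1 := by
  obtain ⟨α, β, hα, hβ, e, he⟩ := hφ.exists_algEquiv
  have h2 : (2 : F) ≠ 0 := Invertible.ne_zero 2
  set i : H := e.symm ⟨0, 1, 0, 0⟩ with hi
  set j : H := e.symm ⟨0, 0, 1, 0⟩ with hj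
  have hei : e i = ⟨0, 1, 0, 0⟩ := e.apply_symm_apply _
  have hej : e j = ⟨0, 0, 1, 0⟩ := e.apply_symm_apply _
  have hφi : φ i = i := by apply e.injective; rw [he, hei]; ext <;> simp
  have hφj : φ j = j := by apply e.injective; rw [he, hej]; ext <;> simp
  have hxi := hx i hφi
  have hxj := hx j hφj
  -- This is `∑ b h b⁻¹ = 2 trd(h)` over `b = 1, i, j, ij`, rewritten with the differences `b h b⁻¹
  -- - h`. These vanish when `h` commutes with `i` and `j`, leaving `4 h = 2 trd(h)`.
  have key (h : H) : (4 : F) • h + (α⁻¹ • (i * (h * i) - h * (i * i)) +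
      β⁻¹ • (j * (h * j) - h * (j * j)) -
      (α⁻¹ * β⁻¹) • (i * (j * (h * (i * j))) - h * (i * (j * (i * j))))) =
      algebraMap F H (2 * redTrace F H h) := by
    apply e.injective
    obtain ⟨t, ht⟩ : ∃ t, t = 2 * (2 * (e h).re) := ⟨_, rfl⟩
    rw [redTrace_eq α β e, ← ht]
    simp only [_root_.map_add, _root_.map_sub, _root_.map_mul, _root_.map_smul, AlgEquiv.commutes,
      hei, hej]
    ext <;> simp <;> subst ht <;> field_simp <;> ring
  have keyR (x : R ⊗[F] H) : (4 : F) • x + (α⁻¹ • (1 ⊗ₜ i * (x * 1 ⊗ₜ i) - x * (1 ⊗ₜ i * 1 ⊗ₜ i)) +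
      β⁻¹ • (1 ⊗ₜ j * (x * 1 ⊗ₜ j) - x * (1 ⊗ₜ j * 1 ⊗ₜ j)) -
      (α⁻¹ * β⁻¹) • (1 ⊗ₜ i * (1 ⊗ₜ j * (x * (1 ⊗ₜ i * 1 ⊗ₜ j))) -
        x * (1 ⊗ₜ i * (1 ⊗ₜ j * (1 ⊗ₜ i * 1 ⊗ₜ j))))) =
      (2 * redTraceR F H R x) • (1 : R ⊗[F] H) := by
    induction x with
    | zero => simp
    | add x y hx hy =>
      rw [_root_.map_add, mul_add (2 : R), add_smul, ← hx, ← hy]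
      simp only [mul_add, add_mul, smul_add, smul_sub]
      abel
    | tmul r h =>
      simp only [Algebra.TensorProduct.tmul_mul_tmul, one_mul, mul_one, ← TensorProduct.tmul_smul,
        ← TensorProduct.tmul_add, ← TensorProduct.tmul_sub, key, redTraceR_tmul]
      rw [algebraMap_tmul_eq, _root_.map_mul, map_ofNat]
      congr 1
      ring
  have h := keyR x
  have hc1 : (1 : R) ⊗ₜ i * (x * (1 : R) ⊗ₜ i) = x * (1 ⊗ₜ i * 1 ⊗ₜ i) := by
    rw [← mul_assoc, ← hxi, mul_assoc]
  have hc2 : (1 : R) ⊗ₜ j * (x * (1 : R) ⊗ₜ j) = x * (1 ⊗ₜ j * 1 ⊗ₜ j) := by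
    rw [← mul_assoc, ← hxj, mul_assoc]
  have hc3 : (1 : R) ⊗ₜ i * ((1 : R) ⊗ₜ j * (x * (1 ⊗ₜ i * 1 ⊗ₜ j))) =
      x * (1 ⊗ₜ i * (1 ⊗ₜ j * (1 ⊗ₜ i * 1 ⊗ₜ j))) := by
    rw [← mul_assoc ((1 : R) ⊗ₜ[F] j) x, ← hxj, mul_assoc x, ← mul_assoc ((1 : R) ⊗ₜ[F] i) x, ← hxi,
      mul_assoc x]
  rw [hc1, hc2, hc3, sub_self, sub_self, sub_self, smul_zero, smul_zero, smul_zero, add_zero,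
    sub_zero, add_zero] at h
  have h4 : (4 : F) ≠ 0 := by
    rw [show (4 : F) = 2 * 2 by norm_num]; exact mul_ne_zero h2 h2
  refine ⟨algebraMap F R 4⁻¹ * (2 * redTraceR F H R x), ?_⟩
  rw [mul_smul, ← h, algebraMap_smul, smul_smul, inv_mul_cancel₀ h4, one_smul]

variable (F R k) in
/-- The matrix with `γ K γ̄ᵀ = K` for `γ` in `SL^‡(2, H)`. -/
def twistMatrix : Matrix (Fin 2) (Fin 2) (R ⊗[F] H) := !![0, 1 ⊗ₜ k; -(1 ⊗ₜ k), 0]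

variable (R φ k) in
/-- The Clifford map, from vectors to matrices. -/
def cliff (v : R ⊗[F] (F × F × symmPart φ)) : Matrix (Fin 2) (Fin 2) (R ⊗[F] H) :=
  toHermitian R φ v * twistMatrix F R k

theorem cliff_eq (v : R ⊗[F] (F × F × symmPart φ)) :
    cliff R φ k v = !![-(hermZ R φ v * (1 ⊗ₜ k)), hermS R φ v • (1 ⊗ₜ k);
      -(hermT R φ v • (1 ⊗ₜ k)), (conjQ F H).baseChange R (hermZ R φ v) * (1 ⊗ₜ k)] := by
  rw [cliff, toHermitian_eq]
  ext i j
  fin_cases i <;> fin_cases j <;>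
    simp [twistMatrix, Matrix.mul_apply, Fin.sum_univ_two]

namespace IsTwist

variable (hk : IsTwist φ κ k)

include hk

theorem tmul_mul_tmul : ((1 : R) ⊗ₜ[F] k) * (1 ⊗ₜ k) = -(algebraMap F R κ • 1) := by
  rw [Algebra.TensorProduct.tmul_mul_tmul, hk.mul_self, algebraMap_tmul_eq, map_neg]
  simp

theorem isUnit_algebraMap : IsUnit (algebraMap F R κ) := hk.ne_zero.isUnit.map _

theorem isUnit_tmul : IsUnit ((1 : R) ⊗ₜ[F] k) := by
  have h : IsUnit k := by
    have h1 : IsUnit (k * k) := by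
      rw [hk.mul_self]; exact (neg_ne_zero.mpr hk.ne_zero).isUnit.map _
    exact ((Commute.refl k).isUnit_mul_iff.mp h1).1
  exact h.map (Algebra.TensorProduct.includeRight : H →ₐ[F] R ⊗[F] H)

theorem baseChange_mul (x : R ⊗[F] H) :
    φ.baseChange R x * (1 ⊗ₜ k) = (1 ⊗ₜ k) * (conjQ F H).baseChange R x := by
  induction x with
  | zero => simp
  | add x y hx hy => rw [map_add, map_add, add_mul, mul_add, hx, hy]
  | tmul r x => simp [hk.map_mul_eq]

theorem conjQ_tmul : (conjQ F H).baseChange R (1 ⊗ₜ k) = -(1 ⊗ₜ k) := by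
  rw [LinearMap.baseChange_tmul, hk.conjQ_eq, TensorProduct.tmul_neg]

theorem twistMatrix_mul_self :
    twistMatrix F R k * twistMatrix F R k = algebraMap F R κ • 1 := by
  ext i j
  fin_cases i <;> fin_cases j <;>
    simp [twistMatrix, Matrix.mul_apply, Fin.sum_univ_two, hk.tmul_mul_tmul, -algebraMap_smul,
      -Algebra.TensorProduct.tmul_mul_tmul]

theorem isUnit_twistMatrix : IsUnit (twistMatrix F R k) := by
  have h1 : IsUnit (twistMatrix F R k * twistMatrix F R k) := by
    rw [hk.twistMatrix_mul_self, ← Algebra.algebraMap_eq_smul_one]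
    exact hk.isUnit_algebraMap.map _
  exact ((Commute.refl _).isUnit_mul_iff.mp h1).1

theorem conjTransposeQ_twistMatrix : conjTransposeQ (twistMatrix F R k) = twistMatrix F R k := by
  ext i j
  fin_cases i <;> fin_cases j <;>
    simp [twistMatrix, conjTransposeQ, hk.conjQ_eq, TensorProduct.tmul_neg]

/-- With `J = (0, 1; -1, 0)` and `D = diag(k, k)` one has `K = J D`, and `D` carries the
`φ`-transpose to the conjugate transpose, so the condition `γ J γ^‡ᵀ = J` multiplied by `D` is the
unitary one. -/
theorem isSLddag_iff (h1 : ∀ x y, φ (x * y) = φ y * φ x) (h2 : ∀ x, φ (φ x) = x)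
    (γ : Matrix (Fin 2) (Fin 2) (R ⊗[F] H)) :
    IsSLddag φ γ ↔ γ * twistMatrix F R k * conjTransposeQ γ = twistMatrix F R k := by
  rw [_root_.isSLddag_iff h1 h2]
  let D : Matrix (Fin 2) (Fin 2) (R ⊗[F] H) := Matrix.diagonal fun _ => 1 ⊗ₜ k
  have hD : IsUnit D := by
    have : D = ((Matrix.scalar (Fin 2)) ((1 : R) ⊗ₜ[F] k)) := rfl
    rw [this]
    exact hk.isUnit_tmul.map _
  have hJD : !![0, 1; -1, 0] * D = twistMatrix F R k := by
    ext i j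
    fin_cases i <;> fin_cases j <;> simp [D, twistMatrix]
  have hγD : ddagTranspose φ γ * D = D * conjTransposeQ γ := by
    ext i j
    simp only [D, Matrix.mul_diagonal, Matrix.diagonal_mul]
    exact hk.baseChange_mul _
  rw [← hJD, ← mul_assoc, mul_assoc _ D, ← hγD, ← mul_assoc, hD.mul_left_inj]

theorem hermZ_mul (v : R ⊗[F] (F × F × symmPart φ)) :
    hermZ R φ v * (1 ⊗ₜ k) = (1 ⊗ₜ k) * (conjQ F H).baseChange R (hermZ R φ v) := by
  rw [← hk.baseChange_mul, baseChange_hermZ]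

theorem mul_hermZ (v : R ⊗[F] (F × F × symmPart φ)) :
    (1 ⊗ₜ k) * hermZ R φ v = (conjQ F H).baseChange R (hermZ R φ v) * (1 ⊗ₜ k) := by
  apply hk.isUnit_tmul.mul_right_cancel
  rw [mul_assoc, hk.hermZ_mul, ← mul_assoc, mul_assoc _ (1 ⊗ₜ k) (1 ⊗ₜ k), hk.tmul_mul_tmul]
  simp

variable [IsQuaternionAlgebra F H]

/-- For `z` in `H_R⁺` one has `z k = k z̄`. Hence the off-diagonal terms cancel and both diagonal
entries become `κ (s t - z z̄)`. -/
theorem cliff_mul_self (v : R ⊗[F] (F × F × symmPart φ)) :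
    cliff R φ k v * cliff R φ k v = (algebraMap F R κ * (qH φ).baseChange R v) • 1 := by
  have hq := qH_smul_one v
  have hz := hk.hermZ_mul v
  have hz' := hk.mul_hermZ v
  have hkk := hk.tmul_mul_tmul (R := R)
  have hzz : (conjQ F H).baseChange R (hermZ R φ v) * hermZ R φ v =
      hermZ R φ v * (conjQ F H).baseChange R (hermZ R φ v) := by
    rw [eq_sub_of_add_eq' (add_conjQ_baseChange (hermZ R φ v)), sub_mul, mul_sub]
    simp
  rw [cliff_eq]
  generalize hermZ R φ v = z at *
  generalize (conjQ F H).baseChange R z = z' at *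
  generalize hermS R φ v = s at *
  generalize hermT R φ v = t at *
  generalize (qH φ).baseChange R v = q at *
  generalize (1 : R) ⊗ₜ[F] k = k' at *
  have e1 : z * k' * (z * k') = -(algebraMap F R κ • (z * z')) := by
    rw [hz, mul_assoc, ← mul_assoc z' k' z', ← hz', mul_assoc k' z z', ← mul_assoc, hkk]
    simp
  have e2 : z' * k' * (z' * k') = -(algebraMap F R κ • (z * z')) := by
    rw [← hz', mul_assoc, ← mul_assoc z k' z, hz, mul_assoc k' z' z, ← mul_assoc, hkk, hzz]
    simp
  have e3 : z * k' * k' = k' * (z' * k') := by rw [hz, mul_assoc]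
  ext i j
  rw [mul_smul, Matrix.smul_apply, Matrix.smul_apply]
  fin_cases i <;> fin_cases j
  · simp [Matrix.mul_apply, Fin.sum_univ_two, e1, hkk, hq]
    rw [smul_sub, mul_smul, smul_comm κ s, smul_comm κ t, smul_comm t s]
    abel
  · simp [Matrix.mul_apply, Fin.sum_univ_two, e3]
  · simp [Matrix.mul_apply, Fin.sum_univ_two]
    rw [← mul_assoc k' z k', hz', add_neg_cancel]
  · simp [Matrix.mul_apply, Fin.sum_univ_two, e2, hkk, hq]
    rw [smul_sub, mul_smul, smul_comm κ s, smul_comm κ t]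
    abel

end IsTwist

end Clifford

/-! ### The action on Hermitian matrices as conjugation. -/

section CliffordAction

variable {F : Type u} [Field F] [Invertible (2 : F)] {H : Type v} [Ring H] [Algebra F H]
  {R S : Type u} [CommRing R] [Algebra F R] [CommRing S] [Algebra F S] {φ : H →ₗ[F] H}
  {κ : F} {k : H}

theorem cliff_add (v w : R ⊗[F] (F × F × symmPart φ)) :
    cliff R φ k (v + w) = cliff R φ k v + cliff R φ k w := by
  rw [cliff, cliff, cliff, ← add_mul]
  exact congrArg (· * _) ((toHermitianLin R φ).map_add v w)

theorem cliff_smul (r : R) (v : R ⊗[F] (F × F × symmPart φ)) :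
    cliff R φ k (r • v) = r • cliff R φ k v := by
  rw [cliff, cliff, ← smul_mul_assoc]
  exact congrArg (· * _) ((toHermitianLin R φ).map_smul r v)

theorem cliff_sub (v w : R ⊗[F] (F × F × symmPart φ)) :
    cliff R φ k (v - w) = cliff R φ k v - cliff R φ k w := by
  rw [cliff, cliff, cliff, ← sub_mul]
  exact congrArg (· * _) ((toHermitianLin R φ).map_sub v w)

theorem redTraceR_mul_comm [IsQuaternionAlgebra F H] (x y : R ⊗[F] H) :
    redTraceR F H R (x * y) = redTraceR F H R (y * x) := by
  induction x with
  | zero => simp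
  | add x x' hx hx' => simp only [add_mul, mul_add, map_add, hx, hx']
  | tmul r x =>
    induction y with
    | zero => simp
    | add y y' hy hy' => simp only [add_mul, mul_add, map_add, hy, hy']
    | tmul s y =>
      rw [Algebra.TensorProduct.tmul_mul_tmul, Algebra.TensorProduct.tmul_mul_tmul, redTraceR_tmul,
        redTraceR_tmul, redTrace_mul_comm, mul_comm r]

variable (φ) in
/-- The linear map on vectors which corresponds to `M ↦ γ M γ̄ᵀ` on Hermitian matrices. -/
def hermAction (h1 : ∀ x, φ (φ x) = x) (γ : Matrix (Fin 2) (Fin 2) (R ⊗[F] H)) :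
    Module.End R (R ⊗[F] (F × F × symmPart φ)) :=
  ofHermitian R φ h1 ∘ₗ LinearMap.mulRight R (conjTransposeQ γ) ∘ₗ LinearMap.mulLeft R γ ∘ₗ
    toHermitianLin R φ

variable [IsQuaternionAlgebra F H]

/-- The matrix trace over a noncommutative ring is not symmetric in the factors, but its reduced
trace is. -/
theorem trace_mul_redTraceR (M N : Matrix (Fin 2) (Fin 2) (R ⊗[F] H)) :
    redTraceR F H R (M * N).trace = redTraceR F H R (N * M).trace := by
  simp only [Matrix.trace, Matrix.diag_apply, Matrix.mul_apply, Fin.sum_univ_two, map_add]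
  rw [redTraceR_mul_comm (M 0 0), redTraceR_mul_comm (M 0 1), redTraceR_mul_comm (M 1 0),
    redTraceR_mul_comm (M 1 1)]
  ring

omit [Invertible (2 : F)] in
theorem smul_one_matrix_injective :
    Function.Injective fun r : R => r • (1 : Matrix (Fin 2) (Fin 2) (R ⊗[F] H)) := by
  intro r s hrs
  apply smul_one_injective (F := F) (H := H)
  simpa using congrFun₂ hrs 0 0

namespace IsTwist

variable (hk : IsTwist φ κ k)

include hk

theorem cliff_mul_add_cliff_mul (v w : R ⊗[F] (F × F × symmPart φ)) :
    cliff R φ k v * cliff R φ k w + cliff R φ k w * cliff R φ k v =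
      (algebraMap F R κ * QuadraticMap.polar ((qH φ).baseChange R) v w) • 1 := by
  have h := hk.cliff_mul_self (v + w)
  rw [cliff_add, add_mul, mul_add, mul_add, hk.cliff_mul_self, hk.cliff_mul_self] at h
  rw [QuadraticMap.polar, mul_sub, mul_sub, sub_smul, sub_smul, ← h]
  abel

/-- As `k̄ = -k`, `(φ(y) - y) k = k ȳ - y k` is minus the sum of `y k` and its conjugate, that is
`-trd(y k)`, and `k` is invertible. -/
theorem baseChange_eq_self_iff (y : R ⊗[F] H) :
    φ.baseChange R y = y ↔ redTraceR F H R (y * (1 ⊗ₜ k)) = 0 := by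
  have h : (φ.baseChange R y - y) * (1 ⊗ₜ k) = -(redTraceR F H R (y * (1 ⊗ₜ k)) • 1) := by
    rw [← add_conjQ_baseChange, baseChange_mul_rev conjQ_mul, hk.conjQ_tmul, sub_mul,
      hk.baseChange_mul]
    noncomm_ring
  constructor
  · intro hy
    rw [hy, sub_self, zero_mul, eq_comm, neg_eq_zero] at h
    exact smul_one_injective (F := F) (H := H) (by simpa using h)
  · intro hy
    rw [hy, zero_smul, neg_zero] at h
    exact sub_eq_zero.mp (hk.isUnit_tmul.mul_left_eq_zero.mp h)

/-- The Hermitian matrices with off-diagonal entries in `H⁺` are given by a trace condition. -/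
theorem mem_hermitianMatrices_iff {M : Matrix (Fin 2) (Fin 2) (R ⊗[F] H)}
    (hM : conjTransposeQ M = M) : M ∈ hermitianMatrices R φ ↔
      redTraceR F H R (M * twistMatrix F R k).trace = 0 := by
  have h10 : (conjQ F H).baseChange R (M 0 1) = M 1 0 := congrFun₂ hM 1 0
  have htr : (M * twistMatrix F R k).trace = -(M 0 1 * (1 ⊗ₜ k)) + M 1 0 * (1 ⊗ₜ k) := by
    simp [Matrix.trace, Matrix.mul_apply, Fin.sum_univ_two, twistMatrix]
  have h1 : redTraceR F H R (M 1 0 * (1 ⊗ₜ k)) = -redTraceR F H R (M 0 1 * (1 ⊗ₜ k)) := by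
    rw [← redTraceR_conjQ _ (baseChange_invol conjQ_conjQ _), baseChange_mul_rev conjQ_mul,
      ← h10, baseChange_invol conjQ_conjQ, hk.conjQ_tmul, neg_mul, map_neg, redTraceR_mul_comm]
  rw [hermitianMatrices, Set.mem_ofPred_eq, hk.baseChange_eq_self_iff, htr, map_add, map_neg, h1]
  simp only [hM, true_and]
  rw [← neg_add, neg_eq_zero, ← two_mul]
  exact ((isUnit_two_of_algebra F R).mul_right_eq_zero).symm

-- Follows by cancelling `γ K` on the left, as `K² = κ`. This identity is what turns the Hermitian
-- action into a conjugation.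
omit [IsQuaternionAlgebra F H] in
theorem conjTransposeQ_mul_twistMatrix {γ : (Matrix (Fin 2) (Fin 2) (R ⊗[F] H))ˣ}
    (hγ : γ.val * twistMatrix F R k * conjTransposeQ γ.val = twistMatrix F R k) :
    conjTransposeQ γ.val * twistMatrix F R k = twistMatrix F R k * γ⁻¹.val := by
  apply (hk.isUnit_twistMatrix (R := R)).mul_left_cancel
  apply γ.isUnit.mul_left_cancel
  rw [← mul_assoc, ← mul_assoc, hγ, ← mul_assoc, ← mul_assoc, mul_assoc γ.val,
    hk.twistMatrix_mul_self, mul_smul_comm, mul_one, smul_mul_assoc, Units.mul_inv]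

/-- The subtle point is that the off-diagonal entry stays in `H_R⁺`. That is the vanishing of the
reduced trace of `M K`, and `M K` is merely conjugated by `γ`. -/
theorem mul_mul_mem {γ : (Matrix (Fin 2) (Fin 2) (R ⊗[F] H))ˣ}
    (hγ : γ.val * twistMatrix F R k * conjTransposeQ γ.val = twistMatrix F R k)
    {M : Matrix (Fin 2) (Fin 2) (R ⊗[F] H)} (hM : M ∈ hermitianMatrices R φ) :
    γ.val * M * conjTransposeQ γ.val ∈ hermitianMatrices R φ := by
  have h1 : conjTransposeQ (γ.val * M * conjTransposeQ γ.val) =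
      γ.val * M * conjTransposeQ γ.val := by
    have h2 : conjTransposeQ (conjTransposeQ γ.val) = γ.val := by
      ext i j
      simp [conjTransposeQ, baseChange_invol (conjQ_conjQ (F := F) (H := H))]
    rw [conjTransposeQ_eq, ddagTranspose_mul conjQ_mul, ddagTranspose_mul conjQ_mul,
      ← conjTransposeQ_eq, ← conjTransposeQ_eq, ← conjTransposeQ_eq, hM.1, h2, mul_assoc]
  rw [hk.mem_hermitianMatrices_iff h1, mul_assoc, hk.conjTransposeQ_mul_twistMatrix hγ,
    trace_mul_redTraceR, ← mul_assoc, mul_assoc _ γ⁻¹.val, Units.inv_mul, mul_one,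
    trace_mul_redTraceR]
  exact (hk.mem_hermitianMatrices_iff hM.1).mp hM

variable (h1 : ∀ x, φ (φ x) = x)
include h1

theorem toHermitian_hermAction {γ : (Matrix (Fin 2) (Fin 2) (R ⊗[F] H))ˣ}
    (hγ : γ.val * twistMatrix F R k * conjTransposeQ γ.val = twistMatrix F R k)
    (v : R ⊗[F] (F × F × symmPart φ)) :
    toHermitian R φ (hermAction φ h1 γ.val v) =
      γ.val * toHermitian R φ v * conjTransposeQ γ.val :=
  toHermitian_ofHermitian h1 (hk.mul_mul_mem hγ (toHermitian_mem v))

theorem cliff_hermAction {γ : (Matrix (Fin 2) (Fin 2) (R ⊗[F] H))ˣ}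
    (hγ : γ.val * twistMatrix F R k * conjTransposeQ γ.val = twistMatrix F R k)
    (v : R ⊗[F] (F × F × symmPart φ)) :
    cliff R φ k (hermAction φ h1 γ.val v) = γ.val * cliff R φ k v * γ⁻¹.val := by
  rw [cliff, hk.toHermitian_hermAction h1 hγ, mul_assoc, hk.conjTransposeQ_mul_twistMatrix hγ,
    cliff, ← mul_assoc, ← mul_assoc]

theorem cliff_injective : Function.Injective (cliff R φ k) := fun _ _ h =>
  toHermitian_injective h1 (hk.isUnit_twistMatrix.mul_right_cancel h)

/-- Conjugation does not change the scalar `c(v)² = κ q(v)`, and `κ` can be cancelled. -/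
theorem map_hermAction {γ : (Matrix (Fin 2) (Fin 2) (R ⊗[F] H))ˣ}
    (hγ : γ.val * twistMatrix F R k * conjTransposeQ γ.val = twistMatrix F R k)
    (v : R ⊗[F] (F × F × symmPart φ)) :
    (qH φ).baseChange R (hermAction φ h1 γ.val v) = (qH φ).baseChange R v := by
  apply (hk.isUnit_algebraMap (R := R)).mul_left_cancel
  apply smul_one_matrix_injective (F := F) (H := H)
  simp only
  rw [← hk.cliff_mul_self, ← hk.cliff_mul_self, hk.cliff_hermAction h1 hγ, mul_assoc,
    ← mul_assoc γ⁻¹.val, ← mul_assoc γ⁻¹.val, Units.inv_mul, one_mul, mul_assoc, ← mul_assoc _ _ γ⁻¹.val,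
    hk.cliff_mul_self, smul_mul_assoc, one_mul, mul_smul_comm, Units.mul_inv]

end IsTwist

end CliffordAction

/-! ### Centralizer of the Clifford image, and lifting of rotations. -/

section CliffordGroup

variable {F : Type u} [Field F] [Invertible (2 : F)] {H : Type v} [Ring H] [Algebra F H]
  [IsQuaternionAlgebra F H] {R S : Type u} [CommRing R] [Algebra F R] [CommRing S] [Algebra F S]
  {φ : H →ₗ[F] H} {κ : F} {k : H}

theorem polar_qH (v w : F × F × symmPart φ) : QuadraticMap.polar (qH φ) v w =
    v.1 * w.2.1 + w.1 * v.2.1 - redTrace F H (v.2.2.1 * conjQ F H w.2.2.1) := by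
  have := IsQuaternionAlgebra.nontrivial F H
  apply FaithfulSMul.algebraMap_injective F H
  rw [map_sub, ← add_conjQ, conjQ_mul, conjQ_conjQ]
  obtain ⟨s, t, z⟩ := v
  obtain ⟨s', t', z'⟩ := w
  simp only [QuadraticMap.polar, Prod.mk_add_mk, qH_apply, map_sub, map_mul, map_add,
    algebraMap_nrmQ, Submodule.coe_add]
  noncomm_ring

/-- The five-dimensional quadratic space of Hermitian matrices has an orthogonal basis of
anisotropic vectors. -/
theorem IsOrthogonalInvolution.exists_isRegularOrthogonal (hφ : IsOrthogonalInvolution φ) :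
    ∃ e : Module.Basis (Fin 5) F (F × F × symmPart φ), IsRegularOrthogonal (qH φ) e := by
  have hrank : Module.finrank F (F × F × symmPart φ) = 5 := by
    rw [Module.finrank_prod, Module.finrank_prod, hφ.finrank_symmPart, Module.finrank_self]
  -- Nondegeneracy: pairing with the two isotropic coordinate vectors kills `s` and `t`, pairing
  -- with `1, i, j` in `H⁺` kills `z`. Consequently no vector of an orthogonal basis can be
  -- isotropic.
  have hnd : ∀ v, (∀ w, QuadraticMap.polar (qH φ) v w = 0) → v = 0 := by
    rintro ⟨s, t, z⟩ h
    obtain ⟨α, β, hα, hβ, e, he⟩ := hφ.exists_algEquiv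
    have h2 : (2 : F) ≠ 0 := Invertible.ne_zero 2
    have hmem (x : H) (hx : (e x).imK = 0) : φ x = x := by
      apply e.injective
      rw [he, hx]
      ext <;> simp [hx]
    have hz (x : ℍ[F,α,β]) (hx : x.imK = 0) : (e z * star x).re = 0 := by
      have h1 := h (0, 0, ⟨e.symm x, hmem _ (by rwa [e.apply_symm_apply])⟩)
      rw [polar_qH] at h1
      simp only [mul_zero, zero_mul, add_zero, zero_sub, neg_eq_zero] at h1
      rw [redTrace_eq α β e, _root_.map_mul, conjQ_eq_star α β e, e.apply_symm_apply,
        e.apply_symm_apply] at h1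
      exact (mul_eq_zero.mp h1).resolve_left h2
    have hs : s = 0 := by simpa [polar_qH] using h (0, 1, 0)
    have ht : t = 0 := by simpa [polar_qH] using h (1, 0, 0)
    have hz0 : z = 0 := by
      have h1 := hz 1 rfl
      have hi := hz ⟨0, 1, 0, 0⟩ rfl
      have hj := hz ⟨0, 0, 1, 0⟩ rfl
      have hk : (e z).imK = 0 := by
        have h3 : e (φ z) = e z := congrArg e z.2
        rw [he] at h3
        have h4 := congrArg QuaternionAlgebra.imK h3
        simp only at h4
        exact (mul_eq_zero.mp (by linear_combination -h4 : 2 * (e z).imK = 0)).resolve_left h2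
      simp [hα, hβ] at h1 hi hj
      apply Subtype.ext
      apply e.injective
      rw [ZeroMemClass.coe_zero, _root_.map_zero]
      ext <;> assumption
    rw [hs, ht, hz0]
    rfl
  have hsymm : ((qH φ).polarBilin).IsSymm := ⟨fun v w => QuadraticMap.polar_comm _ _ _⟩
  obtain ⟨e₀, he₀⟩ := LinearMap.BilinForm.exists_orthogonal_basis hsymm
  have hreg : IsRegularOrthogonal (qH φ) e₀ := by
    have hp (i j) (hij : i ≠ j) : QuadraticMap.polar (qH φ) (e₀ i) (e₀ j) = 0 := he₀ hij
    refine ⟨hp, fun i hi => ?_⟩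
    refine e₀.ne_zero i (hnd _ fun w => ?_)
    have h0 : (qH φ).polarBilin (e₀ i) = 0 := by
      refine e₀.ext fun j => ?_
      by_cases hij : i = j
      · subst hij
        simp [hi]
      · simpa using hp i j hij
    exact LinearMap.congr_fun h0 w
  refine ⟨e₀.reindex (finCongr hrank), fun i j hij => ?_, fun i => ?_⟩
  · rw [Module.Basis.reindex_apply, Module.Basis.reindex_apply]
    exact hreg.polar_eq_zero _ _ (by simpa using hij)
  · rw [Module.Basis.reindex_apply]
    exact hreg.ne_zero _

/-- Commutation signs multiply along a product; used to move a basis vector past the product of all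
of them. -/
theorem mul_mul_eq_smul {A : Type*} [Ring A] {y a b : A} {m n : ℤ} (ha : y * a = m • (a * y))
    (hb : y * b = n • (b * y)) : y * (a * b) = (m * n) • (a * b * y) := by
  rw [← mul_assoc, ha, smul_mul_assoc, mul_assoc, hb, mul_smul_comm, smul_smul, ← mul_assoc]

omit [IsQuaternionAlgebra F H] in
variable (φ k) in
theorem cliff_one_tmul (s t : F) (z : symmPart φ) : cliff R φ k (1 ⊗ₜ (s, t, z)) =
    !![-((1 ⊗ₜ z.1) * (1 ⊗ₜ k)), algebraMap F R s • (1 ⊗ₜ k); -(algebraMap F R t • (1 ⊗ₜ k)),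
      (1 ⊗ₜ conjQ F H z.1) * (1 ⊗ₜ k)] := by
  rw [cliff_eq, hermS_tmul, hermT_tmul, hermZ_tmul, one_mul, one_mul, LinearMap.baseChange_tmul]

/-- The centralizer of the image of the Clifford map consists of the scalars. -/
theorem IsTwist.exists_smul_one (hk : IsTwist φ κ k) (hφ : IsOrthogonalInvolution φ)
    {X : Matrix (Fin 2) (Fin 2) (R ⊗[F] H)}
    (hX : ∀ v, X * cliff R φ k v = cliff R φ k v * X) : ∃ r : R, X = r • 1 := by
  have hu := hk.isUnit_tmul (R := R)
  have hS := hX (1 ⊗ₜ (1, 0, 0))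
  have hT := hX (1 ⊗ₜ (0, 1, 0))
  have hone : φ 1 = 1 := map_one_of_invol hφ.map_mul hφ.involutive
  have hZ (z : H) (hz : φ z = z) := hX (1 ⊗ₜ (0, 0, ⟨z, hz⟩))
  simp only [cliff_one_tmul] at hS hT hZ
  have hc1 : conjQ F H 1 = 1 := map_one_of_invol conjQ_mul conjQ_conjQ
  -- Commuting with the isotropic vectors makes `X` diagonal. The vector `z = 1` then makes `X 0 0`
  -- commute with `k` and equal `X 1 1`, and the other `z` make it centralize `H⁺`.
  have h10 : X 1 0 = 0 := by
    have := congrFun₂ hS 0 0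
    simp [Matrix.mul_apply, Fin.sum_univ_two, -Algebra.TensorProduct.tmul_mul_tmul] at this
    exact hu.mul_right_eq_zero.mp this.symm
  have h01 : X 0 1 = 0 := by
    have := congrFun₂ hT 0 0
    simp [Matrix.mul_apply, Fin.sum_univ_two, -Algebra.TensorProduct.tmul_mul_tmul] at this
    exact hu.mul_left_eq_zero.mp this
  have h11 : X 0 0 * (1 ⊗ₜ k) = (1 ⊗ₜ k) * X 1 1 := by
    have := congrFun₂ hS 0 1
    simpa [Matrix.mul_apply, Fin.sum_univ_two, -Algebra.TensorProduct.tmul_mul_tmul] using this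
  have hz0 (z : H) (hz : φ z = z) :
      X 0 0 * ((1 ⊗ₜ z) * (1 ⊗ₜ k)) = (1 ⊗ₜ z) * (1 ⊗ₜ k) * X 0 0 := by
    have := congrFun₂ (hZ z hz) 0 0
    simpa [Matrix.mul_apply, Fin.sum_univ_two, -Algebra.TensorProduct.tmul_mul_tmul] using this
  have hk0 : X 0 0 * (1 ⊗ₜ k) = (1 ⊗ₜ k) * X 0 0 := by
    have := hz0 1 hone
    rwa [← Algebra.TensorProduct.one_def, one_mul] at this
  have h110 : X 1 1 = X 0 0 := hu.mul_left_cancel (h11.symm.trans hk0)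
  obtain ⟨r, hr⟩ := hφ.exists_smul_one (x := X 0 0) fun z hz => by
    have := hz0 z hz
    rw [mul_assoc (1 ⊗ₜ z), ← hk0, ← mul_assoc, ← mul_assoc] at this
    exact hu.mul_right_cancel this
  refine ⟨r, ?_⟩
  rw [Matrix.eta_fin_two X, h10, h01, h110, hr]
  ext i j
  fin_cases i <;> fin_cases j <;> simp

variable (h1 : ∀ x, φ (φ x) = x)

omit [IsQuaternionAlgebra F H] in
theorem hermAction_apply (γ : Matrix (Fin 2) (Fin 2) (R ⊗[F] H))
    (v : R ⊗[F] (F × F × symmPart φ)) : hermAction φ h1 γ v =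
      ofHermitian R φ h1 (γ * toHermitian R φ v * conjTransposeQ γ) := rfl

variable (φ) in
theorem hermAction_one : hermAction φ h1 (1 : Matrix (Fin 2) (Fin 2) (R ⊗[F] H)) = 1 := by
  refine LinearMap.ext fun v => ?_
  have hc : conjTransposeQ (1 : Matrix (Fin 2) (Fin 2) (R ⊗[F] H)) = 1 :=
    ddagTranspose_one conjQ_mul conjQ_conjQ
  rw [hermAction_apply, hc, one_mul, mul_one, ofHermitian_toHermitian, Module.End.one_apply]

/-- The matrices `γ` with `γ K γ̄ᵀ = K`. -/
def IsTwistUnitary (F : Type u) [Field F] [Invertible (2 : F)] {H : Type v} [Ring H] [Algebra F H]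
    {R : Type u} [CommRing R] [Algebra F R] (k : H)
    (γ : (Matrix (Fin 2) (Fin 2) (R ⊗[F] H))ˣ) : Prop :=
  γ.val * twistMatrix F R k * conjTransposeQ γ.val = twistMatrix F R k

theorem IsTwistUnitary.mul {γ δ : (Matrix (Fin 2) (Fin 2) (R ⊗[F] H))ˣ}
    (hγ : IsTwistUnitary F k γ) (hδ : IsTwistUnitary F k δ) : IsTwistUnitary F k (γ * δ) := by
  rw [IsTwistUnitary] at *
  rw [Units.val_mul, conjTransposeQ_eq, ddagTranspose_mul conjQ_mul, ← conjTransposeQ_eq,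
    ← conjTransposeQ_eq, ← mul_assoc, mul_assoc γ.val, mul_assoc γ.val, hδ, hγ]

namespace IsTwist

variable (hk : IsTwist φ κ k)
include hk

theorem hermAction_mul {γ δ : (Matrix (Fin 2) (Fin 2) (R ⊗[F] H))ˣ}
    (hγ : IsTwistUnitary F k γ) (hδ : IsTwistUnitary F k δ) :
    hermAction φ h1 (γ * δ).val = hermAction φ h1 γ.val * hermAction φ h1 δ.val := by
  refine LinearMap.ext fun v => ?_
  apply toHermitian_injective h1
  rw [hk.toHermitian_hermAction h1 (hγ.mul hδ), Module.End.mul_apply,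
    hk.toHermitian_hermAction h1 hγ, hk.toHermitian_hermAction h1 hδ, Units.val_mul,
    conjTransposeQ_eq, ddagTranspose_mul conjQ_mul, ← conjTransposeQ_eq, ← conjTransposeQ_eq]
  simp only [mul_assoc]

omit [IsQuaternionAlgebra F H] in
omit hk in
theorem _root_.conjTransposeQ_map (f : R →ₐ[F] S) (M : Matrix (Fin 2) (Fin 2) (R ⊗[F] H)) :
    conjTransposeQ ((Algebra.TensorProduct.map f (AlgHom.id F H)).mapMatrix M) =
      (Algebra.TensorProduct.map f (AlgHom.id F H)).mapMatrix (conjTransposeQ M) := by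
  ext i j
  simp [conjTransposeQ, baseChange_map]

omit hk [IsQuaternionAlgebra F H] in
theorem _root_.IsTwistUnitary.map {γ : (Matrix (Fin 2) (Fin 2) (R ⊗[F] H))ˣ}
    (hγ : IsTwistUnitary F k γ) (f : R →ₐ[F] S) : IsTwistUnitary F k (mapGL f γ) := by
  have h := congrArg (Algebra.TensorProduct.map f (AlgHom.id F H)).mapMatrix hγ
  have hK : (Algebra.TensorProduct.map f (AlgHom.id F H)).mapMatrix (twistMatrix F R k) =
      twistMatrix F S k := by
    ext i j
    fin_cases i <;> fin_cases j <;> simp [twistMatrix]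
  rwa [map_mul, map_mul, ← conjTransposeQ_map, hK] at h

theorem extendScalars_hermAction {γ : (Matrix (Fin 2) (Fin 2) (R ⊗[F] H))ˣ}
    (hγ : IsTwistUnitary F k γ) (f : R →ₐ[F] S) :
    extendScalars f (hermAction φ h1 γ.val) = hermAction φ h1 (mapGL f γ).val := by
  refine ext_one_tmul fun v => ?_
  apply toHermitian_injective h1
  have hv : ((1 : S) ⊗ₜ[F] v) = f.toLinearMap.rTensor _ (1 ⊗ₜ v) := by simp
  rw [extendScalars_one_tmul, toHermitian_rTensor, hk.toHermitian_hermAction h1 hγ,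
    hk.toHermitian_hermAction h1 (hγ.map f), hv, toHermitian_rTensor, map_mul, map_mul,
    ← conjTransposeQ_map]
  rfl

-- The Clifford relation replaces `c(a) c(v)` by `κ polar(a, v) - c(v) c(a)`, and `c(a)² = κ q(a)`;
-- this is minus the reflection formula, scaled by `κ q(a)`.
omit h1 in
theorem cliff_mul_cliff_mul_cliff {a : R ⊗[F] (F × F × symmPart φ)}
    (ha : IsUnit ((qH φ).baseChange R a)) (v : R ⊗[F] (F × F × symmPart φ)) :
    cliff R φ k a * cliff R φ k v * cliff R φ k a = -((algebraMap F R κ * (qH φ).baseChange R a) •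
      cliff R φ k (reflectionIn ((qH φ).baseChange R) a v)) := by
  have h := hk.cliff_mul_add_cliff_mul a v
  rw [eq_sub_of_add_eq h, sub_mul, mul_assoc, hk.cliff_mul_self, reflectionIn_apply, cliff_sub,
    cliff_smul, smul_sub, smul_smul, mul_smul_comm, mul_one, smul_mul_assoc, one_mul, neg_sub]
  congr 2
  linear_combination (-algebraMap F R κ *
    QuadraticMap.polar ((qH φ).baseChange R) a v) * Ring.inverse_mul_cancel _ ha

/-- The product of two reflections lifts, if the product of the norms is a square. -/
theorem exists_hermAction_eq {a b : R ⊗[F] (F × F × symmPart φ)}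
    (ha : IsUnit ((qH φ).baseChange R a)) (hb : IsUnit ((qH φ).baseChange R b)) {m : R}
    (hm : m * m = (qH φ).baseChange R a * (qH φ).baseChange R b) :
    ∃ γ : (Matrix (Fin 2) (Fin 2) (R ⊗[F] H))ˣ, IsTwistUnitary F k γ ∧
      hermAction φ h1 γ.val =
        reflectionIn ((qH φ).baseChange R) a * reflectionIn ((qH φ).baseChange R) b := by
  have hmu : IsUnit m := isUnit_of_mul_isUnit_left (hm ▸ ha.mul hb)
  -- `n = 1 / (κ m)` is the normalization for which `n c(a) c(b)` has inverse `n c(b) c(a)`.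
  obtain ⟨n, hn⟩ := isUnit_iff_exists_inv.mp ((hk.isUnit_algebraMap (R := R)).mul hmu)
  have hn2 : n * n * (algebraMap F R κ * (qH φ).baseChange R b *
      (algebraMap F R κ * (qH φ).baseChange R a)) = 1 := by
    linear_combination (n * algebraMap F R κ * m + 1) * hn -
      (n * n * algebraMap F R κ * algebraMap F R κ) * hm
  have hinv {a b : R ⊗[F] (F × F × symmPart φ)} (hab : n * n * (algebraMap F R κ *
      (qH φ).baseChange R b * (algebraMap F R κ * (qH φ).baseChange R a)) = 1) :
      (n • (cliff R φ k a * cliff R φ k b)) * (n • (cliff R φ k b * cliff R φ k a)) = 1 := by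
    rw [smul_mul_smul_comm, mul_assoc, ← mul_assoc (cliff R φ k b), hk.cliff_mul_self,
      smul_mul_assoc, one_mul, mul_smul_comm, hk.cliff_mul_self, smul_smul, smul_smul,
      mul_assoc (n * n), hab, one_smul]
  let γ : (Matrix (Fin 2) (Fin 2) (R ⊗[F] H))ˣ :=
    { val := n • (cliff R φ k a * cliff R φ k b)
      inv := n • (cliff R φ k b * cliff R φ k a)
      val_inv := hinv hn2
      inv_val := hinv (by rw [← hn2]; ring) }
  have hcconj (v : R ⊗[F] (F × F × symmPart φ)) :
      conjTransposeQ (cliff R φ k v) = twistMatrix F R k * toHermitian R φ v := by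
    rw [cliff, conjTransposeQ_eq, ddagTranspose_mul conjQ_mul, ← conjTransposeQ_eq,
      ← conjTransposeQ_eq, hk.conjTransposeQ_twistMatrix, conjTransposeQ_toHermitian]
  have hγ : IsTwistUnitary F k γ := by
    -- The conjugate transpose of `c(v) = M K` is `K M`. So it reverses the product `c(a) c(b)` up
    -- to moving one `K` across, which is the unitary condition in the form `γ̄ᵀ K = K γ⁻¹`.
    have h2 : conjTransposeQ γ.val * twistMatrix F R k = twistMatrix F R k * γ⁻¹.val := by
      change conjTransposeQ (n • _) * _ = _ * (n • _)
      rw [conjTransposeQ_smul, conjTransposeQ_eq, ddagTranspose_mul conjQ_mul,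
        ← conjTransposeQ_eq, ← conjTransposeQ_eq, hcconj, hcconj, smul_mul_assoc, mul_smul_comm,
        cliff, cliff]
      simp only [mul_assoc]
    rw [IsTwistUnitary]
    apply (hk.isUnit_twistMatrix (R := R)).mul_right_cancel
    rw [mul_assoc, h2, mul_assoc, ← mul_assoc _ _ γ⁻¹.val, hk.twistMatrix_mul_self]
    rw [smul_one_mul, mul_smul_comm, Units.mul_inv]
  refine ⟨γ, hγ, ?_⟩
  refine LinearMap.ext fun v => ?_
  apply hk.cliff_injective h1
  rw [hk.cliff_hermAction h1 hγ]
  change n • (cliff R φ k a * cliff R φ k b) * cliff R φ k v *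
    (n • (cliff R φ k b * cliff R φ k a)) = _
  have h3 : n • (cliff R φ k a * cliff R φ k b) * cliff R φ k v *
      (n • (cliff R φ k b * cliff R φ k a)) = (n * n) • (cliff R φ k a *
        (cliff R φ k b * cliff R φ k v * cliff R φ k b) * cliff R φ k a) := by
    rw [smul_mul_assoc, smul_mul_smul_comm]
    simp only [mul_assoc]
  -- The two minus signs from the two reflections cancel; a single `c(a)` would give the negative of
  -- a reflection.
  rw [h3, hk.cliff_mul_cliff_mul_cliff hb, mul_neg, neg_mul, mul_smul_comm, smul_mul_assoc,
    hk.cliff_mul_cliff_mul_cliff ha, smul_neg, smul_neg, smul_neg, neg_neg, smul_smul, smul_smul, Module.End.mul_apply]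
  rw [mul_assoc (n * n), hn2, one_smul]

/-- Products of reflections lift locally. -/
theorem exists_cover_hermAction_eq
    {l : List ((R ⊗[F] (F × F × symmPart φ)) × (R ⊗[F] (F × F × symmPart φ)))}
    (hl : IsUnitList ((qH φ).baseChange R) l) :
    ∃ (S : CommAlgCat.{u} F) (f : R →ₐ[F] S), f.toRingHom.IsFppfCover ∧
      ∃ γ : (Matrix (Fin 2) (Fin 2) (S ⊗[F] H))ˣ, IsTwistUnitary F k γ ∧
        hermAction φ h1 γ.val = rotationProd ((qH φ).baseChange S) (mapPairs f l) := by
  induction l with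
  | nil =>
    refine ⟨CommAlgCat.of F R, AlgHom.id F R, .id R, 1, ?_, hermAction_one φ h1⟩
    have hc : conjTransposeQ (1 : Matrix (Fin 2) (Fin 2) (R ⊗[F] H)) = 1 :=
      ddagTranspose_one conjQ_mul conjQ_conjQ
    rw [IsTwistUnitary, Units.val_one]
    erw [hc]
    rw [one_mul, mul_one]
  | cons p l ih =>
    rw [IsUnitList, List.forall_mem_cons] at hl
    obtain ⟨S, f, hf, γ, hγ, hγl⟩ := ih hl.2
    have hp := IsUnitList.map (l := [p]) (by simpa [IsUnitList] using hl.1) f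
    -- The extension adjoins the square root of `q(a) q(b)` needed to normalize `c(a) c(b)`.
    obtain ⟨T, f', hf', m, hm⟩ := exists_isFppfCover_sqrt (F := F)
      ((qH φ).baseChange S (f.toLinearMap.rTensor _ p.1) *
        (qH φ).baseChange S (f.toLinearMap.rTensor _ p.2))
    simp only [mapPairs, IsUnitList, List.map_cons, List.map_nil, List.mem_singleton,
      forall_eq, Prod.map_fst, Prod.map_snd] at hp
    rw [map_mul, ← baseChange_rTensor, ← baseChange_rTensor] at hm
    obtain ⟨δ, hδ, hδp⟩ := hk.exists_hermAction_eq h1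
      (by rw [baseChange_rTensor]; exact hp.1.map f')
      (by rw [baseChange_rTensor]; exact hp.2.map f') hm
    refine ⟨T, f'.comp f, hf'.comp hf, δ * mapGL f' γ, hδ.mul (hγ.map f'), ?_⟩
    have hmap {V : Type _} [AddCommGroup V] [Module F V]
        (l : List ((R ⊗[F] V) × (R ⊗[F] V))) :
        mapPairs (f'.comp f) l = mapPairs f' (mapPairs f l) := by
      simp only [mapPairs, List.map_map]
      congr 1
      funext p
      simp only [Function.comp_apply, Prod.map, AlgHom.comp_toLinearMap, LinearMap.rTensor_comp,
        LinearMap.comp_apply]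
    rw [hk.hermAction_mul h1 hδ (hγ.map f'), hδp, ← hk.extendScalars_hermAction h1 hγ, hγl,
      extendScalars_rotationProd f' (IsUnitList.map (q := qH φ) hl.2 f), hmap]
    exact (rotationProd_cons (Q := (qH φ).baseChange T) (_, _) _).symm

end IsTwist

end CliffordGroup

/-! ### The action has determinant one. -/

section SpinorAction

variable {F : Type u} [Field F] [Invertible (2 : F)] {H : Type v} [Ring H] [Algebra F H]
  [IsQuaternionAlgebra F H] {R : Type u} [CommRing R] [Algebra F R]
  {φ : H →ₗ[F] H} {κ : F} {k : H}

theorem IsTwist.isUnit_cliff (hk : IsTwist φ κ k) {v : R ⊗[F] (F × F × symmPart φ)}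
    (hv : IsUnit ((qH φ).baseChange R v)) : IsUnit (cliff R φ k v) := by
  rw [← isUnit_pow_iff two_ne_zero, sq, hk.cliff_mul_self]
  obtain ⟨r, hr⟩ := isUnit_iff_exists_inv.mp ((hk.isUnit_algebraMap (R := R)).mul hv)
  refine ⟨⟨_, r • 1, ?_, ?_⟩, rfl⟩
  · rw [smul_mul_smul_comm, hr, one_mul, one_smul]
  · rw [smul_mul_smul_comm, mul_comm, hr, one_mul, one_smul]

omit [IsQuaternionAlgebra F H] in
/-- A matrix commutes with the image of the Clifford map if it commutes with the images of the
vectors of a basis. -/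
theorem commute_cliff_of_basis {n : ℕ} (e : Module.Basis (Fin n) F (F × F × symmPart φ))
    {X : Matrix (Fin 2) (Fin 2) (R ⊗[F] H)}
    (hX : ∀ i, X * cliff R φ k (1 ⊗ₜ e i) = cliff R φ k (1 ⊗ₜ e i) * X)
    (v : R ⊗[F] (F × F × symmPart φ)) : X * cliff R φ k v = cliff R φ k v * X := by
  have h0 : cliff R φ k 0 = 0 := by simpa using cliff_smul (k := k) (φ := φ) (0 : R) 0
  induction (e.baseChange R).mem_span v using Submodule.span_induction with
  | mem x hx =>
    obtain ⟨i, rfl⟩ := hx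
    rw [Module.Basis.baseChange_apply, hX]
  | zero => rw [h0, mul_zero, zero_mul]
  | add x y _ _ hx hy => rw [cliff_add, mul_add, add_mul, hx, hy]
  | smul r x _ hx => rw [cliff_smul, mul_smul_comm, smul_mul_assoc, hx]

/-- An inner automorphism can not change the sign of just one vector of an orthogonal basis of a
quadratic space of dimension five, as the product of the basis vectors is central. -/
theorem IsTwist.eq_one_of_conj (hk : IsTwist φ κ k) (hφ : IsOrthogonalInvolution φ)
    {e : Module.Basis (Fin 5) F (F × F × symmPart φ)} (he : IsRegularOrthogonal (qH φ) e)
    {η : Matrix (Fin 2) (Fin 2) (R ⊗[F] H)} (hη : IsUnit η) {r : R}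
    (hfix : ∀ i, i ≠ 4 → η * cliff R φ k (1 ⊗ₜ e i) = cliff R φ k (1 ⊗ₜ e i) * η)
    (hlast : η * cliff R φ k (1 ⊗ₜ e 4) = r • (cliff R φ k (1 ⊗ₜ e 4) * η)) : r = 1 := by
  let c (i : Fin 5) := cliff R φ k (1 ⊗ₜ e i)
  let y := c 0 * (c 1 * (c 2 * (c 3 * c 4)))
  have hcomm (i j : Fin 5) : c j * c i = (if i = j then 1 else -1 : ℤ) • (c i * c j) := by
    split_ifs with h
    · rw [h, one_smul]
    · have := hk.cliff_mul_add_cliff_mul (R := R) (1 ⊗ₜ e j) (1 ⊗ₜ e i)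
      rw [he.polar_one_tmul (Ne.symm h), mul_zero, zero_smul] at this
      rw [neg_smul, one_smul]
      exact eq_neg_of_add_eq_zero_left this
  -- `c j` commutes with itself and anticommutes with the four other factors, so the total sign is
  -- `(-1)⁴ = 1`. Odd dimension is essential here.
  have hy (j : Fin 5) : y * c j = c j * y := by
    have h := mul_mul_eq_smul (hcomm 0 j) <| mul_mul_eq_smul (hcomm 1 j) <|
      mul_mul_eq_smul (hcomm 2 j) <| mul_mul_eq_smul (hcomm 3 j) (hcomm 4 j)
    rw [h]
    convert (one_smul ℤ (y * c j)).symm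
    fin_cases j <;> decide
  obtain ⟨s, hs⟩ := hk.exists_smul_one hφ (commute_cliff_of_basis e hy)
  have hyu : IsUnit y := by
    have hc (i) : IsUnit (c i) := hk.isUnit_cliff (he.isUnit_one_tmul i)
    exact (hc 0).mul <| (hc 1).mul <| (hc 2).mul <| (hc 3).mul (hc 4)
  have hηy : η * y = r • (y * η) := by
    have h0 : η * c 0 = c 0 * η := hfix 0 (by decide)
    have h1 : η * c 1 = c 1 * η := hfix 1 (by decide)
    have h2 : η * c 2 = c 2 * η := hfix 2 (by decide)
    have h3 : η * c 3 = c 3 * η := hfix 3 (by decide)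
    have h4 : η * c 4 = r • (c 4 * η) := hlast
    simp only [y]
    rw [← mul_assoc, h0, mul_assoc, ← mul_assoc η, h1, mul_assoc, ← mul_assoc η, h2, mul_assoc,
      ← mul_assoc η, h3, mul_assoc, h4]
    simp only [mul_smul_comm, mul_assoc]
  have hyη : y * η = η * y := by rw [hs, smul_one_mul, mul_smul_one]
  rw [hyη] at hηy
  have h5 : r • (1 : Matrix (Fin 2) (Fin 2) (R ⊗[F] H)) = (1 : R) • 1 := by
    apply (hη.mul hyu).mul_right_cancel
    rw [smul_one_mul, ← hηy, one_smul, one_mul]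
  exact smul_one_matrix_injective h5

variable (h1 : ∀ x, φ (φ x) = x)

/-- After a cover the action is a product of rotations times `h`, which scales only `e 4`, by the
determinant. After a second cover the rotations lift to some `δ`, so `δ⁻¹ γ` induces `h` by
conjugation and `IsTwist.eq_one_of_conj` applies. Covers are injective on rings, so the equation
descends. -/
theorem IsTwist.det_hermAction (hk : IsTwist φ κ k) (hφ : IsOrthogonalInvolution φ)
    {γ : (Matrix (Fin 2) (Fin 2) (R ⊗[F] H))ˣ} (hγ : IsTwistUnitary F k γ) :
    LinearMap.det (hermAction φ h1 γ.val) = 1 := by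
  obtain ⟨e, he⟩ := hφ.exists_isRegularOrthogonal
  obtain ⟨S, f, hf, l, -, hl, h, hfix, hlast, hgl⟩ := he.exists_cover (hk.map_hermAction h1 hγ)
  obtain ⟨T, f', hf', δ, hδ, hδl⟩ := hk.exists_cover_hermAction_eq h1 hl
  apply hf.injective
  apply hf'.injective
  rw [map_one, map_one]
  have h2 : hermAction φ h1 (mapGL f' (mapGL f γ)).val =
      hermAction φ h1 δ.val * extendScalars f' h := by
    rw [← hk.extendScalars_hermAction h1 (hγ.map f), ← hk.extendScalars_hermAction h1 hγ, hgl,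
      extendScalars_mul, extendScalars_rotationProd f' hl, hδl]
  have h3 (v : T ⊗[F] (F × F × symmPart φ)) :
      (δ⁻¹ * mapGL f' (mapGL f γ)).val * cliff T φ k v =
        cliff T φ k (extendScalars f' h v) * (δ⁻¹ * mapGL f' (mapGL f γ)).val := by
    have h4 := hk.cliff_hermAction h1 ((hγ.map f).map f') v
    rw [h2, Module.End.mul_apply, hk.cliff_hermAction h1 hδ] at h4
    have h5 := congrArg (fun M => δ⁻¹.val * M * (mapGL f' (mapGL f γ)).val) h4
    simp only [mul_assoc, Units.inv_mul_cancel_left, Units.inv_mul, mul_one] at h5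
    rw [Units.val_mul, mul_assoc, ← h5]
  refine hk.eq_one_of_conj hφ he (δ⁻¹ * mapGL f' (mapGL f γ)).isUnit (fun i hi => ?_) ?_
  · rw [h3, extendScalars_one_tmul, hfix i hi]
    simp
  · rw [h3, extendScalars_one_tmul]
    erw [hlast]
    rw [rTensor_smul, cliff_smul, smul_mul_assoc]
    simp

end SpinorAction

/-! ### The homomorphism to `SO(q_H)`, its kernel and its local surjectivity. -/

section ExactSequence

variable {F : Type u} [Field F] [Invertible (2 : F)] {H : Type v} [Ring H] [Algebra F H]
  {R : Type u} [CommRing R] [Algebra F R] {φ : H →ₗ[F] H} {κ : F} {k : H}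

omit [Invertible (2 : F)] in
theorem smul_add_smul_neg_one (e : R) :
    e • (1 : Matrix (Fin 2) (Fin 2) (R ⊗[F] H)) + (1 - e) • (-1) = (2 * e - 1) • 1 := by
  module

variable [IsQuaternionAlgebra F H]

omit [IsQuaternionAlgebra F H] in
theorem IsTwist.isTwistUnitary_iff (hk : IsTwist φ κ k) (hφ : IsOrthogonalInvolution φ)
    {γ : (Matrix (Fin 2) (Fin 2) (R ⊗[F] H))ˣ} : IsTwistUnitary F k γ ↔ γ ∈ slPoints R hφ :=
  (hk.isSLddag_iff hφ.map_mul hφ.involutive γ.val).symm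

theorem IsTwist.isTwistUnitary_smul_one_iff (hk : IsTwist φ κ k)
    {γ : (Matrix (Fin 2) (Fin 2) (R ⊗[F] H))ˣ} {r : R} (hγ : γ.val = r • 1) :
    IsTwistUnitary F k γ ↔ r * r = 1 := by
  have hc : conjTransposeQ (1 : Matrix (Fin 2) (Fin 2) (R ⊗[F] H)) = 1 :=
    ddagTranspose_one conjQ_mul conjQ_conjQ
  rw [IsTwistUnitary, hγ, conjTransposeQ_smul, hc, smul_one_mul, mul_smul_one, smul_smul]
  constructor
  · intro h
    apply smul_one_matrix_injective (F := F) (H := H)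
    apply (hk.isUnit_twistMatrix (R := R)).mul_right_cancel
    simp only
    rw [smul_one_mul, h, one_smul, one_mul]
  · intro h
    rw [h, one_smul]

namespace IsOrthogonalInvolution

variable (hφ : IsOrthogonalInvolution φ) (γ : slPoints R hφ)

theorem map_hermAction (v : R ⊗[F] (F × F × symmPart φ)) :
    (qH φ).baseChange R (hermAction φ hφ.involutive γ.1.val v) = (qH φ).baseChange R v := by
  obtain ⟨κ, k, hk⟩ := hφ.exists_isTwist
  exact hk.map_hermAction hφ.involutive ((hk.isTwistUnitary_iff hφ).mpr γ.2) v

theorem det_hermAction : LinearMap.det (hermAction φ hφ.involutive γ.1.val) = 1 := by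
  obtain ⟨κ, k, hk⟩ := hφ.exists_isTwist
  exact hk.det_hermAction hφ.involutive hφ ((hk.isTwistUnitary_iff hφ).mpr γ.2)

/-- The action of `SL^‡(2, H)` on the Hermitian matrices, as a homomorphism to `SO(q_H)`. -/
def actionHom : SLddag hφ ⟶ SO (qH φ) where
  app R := GrpCat.ofHom
    { toFun := fun γ : slPoints R hφ => soOfEnd (hermAction φ hφ.involutive γ.1.val)
        (hφ.map_hermAction γ) (hφ.det_hermAction γ)
      map_one' := soPoints_ext _ (hermAction_one φ hφ.involutive)
      map_mul' := fun γ δ => by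
        obtain ⟨κ, k, hk⟩ := hφ.exists_isTwist
        exact soPoints_ext _ (hk.hermAction_mul hφ.involutive ((hk.isTwistUnitary_iff hφ).mpr γ.2)
          ((hk.isTwistUnitary_iff hφ).mpr δ.2)) }
  naturality R S f := by
    obtain ⟨κ, k, hk⟩ := hφ.exists_isTwist
    refine GrpCat.ext fun γ => soPoints_ext _ ?_
    exact (hk.extendScalars_hermAction hφ.involutive ((hk.isTwistUnitary_iff hφ).mpr γ.2)
      f.hom).symm

/-- A `γ` acting trivially commutes with every `c(v)`, hence is a scalar `r`, and being unitary it
has `r² = 1`. The idempotent is `e = (1 + r)/2`. -/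
theorem hermAction_eq_one_iff :
    hermAction φ hφ.involutive γ.1.val = 1 ↔ γ ∈ pmPoints R hφ := by
  obtain ⟨κ, k, hk⟩ := hφ.exists_isTwist
  have hγ : IsTwistUnitary F k γ.1 := (hk.isTwistUnitary_iff hφ).mpr γ.2
  constructor
  · intro h
    obtain ⟨r, hr⟩ := hk.exists_smul_one hφ (X := γ.1.val) fun v => by
      have h1 := hk.cliff_hermAction hφ.involutive hγ v
      rw [h, Module.End.one_apply] at h1
      exact ((γ.1.eq_mul_inv_iff_mul_eq).mp h1).symm
    have hr2 := (hk.isTwistUnitary_smul_one_iff hr).mp hγ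
    obtain ⟨t, ht⟩ := isUnit_iff_exists_inv.mp (isUnit_two_of_algebra F R)
    refine ⟨t * (1 + r), by linear_combination t * t * hr2 + (t * (1 + r)) * ht, ?_⟩
    rw [smul_add_smul_neg_one, hr]
    congr 1
    linear_combination -(1 + r) * ht
  · rintro ⟨e, he, hγe⟩
    rw [smul_add_smul_neg_one] at hγe
    refine LinearMap.ext fun v => toHermitian_injective hφ.involutive ?_
    have hr2 := (hk.isTwistUnitary_smul_one_iff hγe).mp hγ
    have hc : conjTransposeQ (1 : Matrix (Fin 2) (Fin 2) (R ⊗[F] H)) = 1 :=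
      ddagTranspose_one conjQ_mul conjQ_conjQ
    rw [hk.toHermitian_hermAction hφ.involutive hγ, hγe, conjTransposeQ_smul, hc, smul_one_mul,
      mul_smul_one, smul_smul, hr2, one_smul, Module.End.one_apply]

theorem actionHom_eq_one_iff (R : CommAlgCat.{u} F) (γ : (SLddag hφ).obj R) :
    (actionHom hφ).app R γ = 1 ↔ γ ∈ Set.range ((plusMinusOneInclusion hφ).app R) := by
  have h : γ ∈ Set.range ((plusMinusOneInclusion hφ).app R) ↔
      (γ : slPoints R hφ) ∈ pmPoints R hφ := by
    constructor
    · rintro ⟨δ, rfl⟩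
      exact δ.2
    · exact fun h => ⟨⟨γ, h⟩, rfl⟩
  refine Iff.trans ?_ ((hφ.hermAction_eq_one_iff (γ : slPoints R hφ)).trans h.symm)
  constructor
  · exact fun h => congrArg (fun g : soPoints (qH φ) R =>
      (g.1 : R ⊗[F] (F × F × symmPart φ) →ₗ[R] R ⊗[F] (F × F × symmPart φ))) h
  · exact fun h => soPoints_ext _ h

/-- Two successive covers: one to write `g` as a product of rotations, one to adjoin the square
roots that lift them. -/
theorem exists_actionHom_eq (R : CommAlgCat.{u} F) (g : (SO (qH φ)).obj R) :
    ∃ (S : CommAlgCat.{u} F) (f : R ⟶ S), f.hom.toRingHom.FaithfullyFlat ∧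
      f.hom.toRingHom.FinitePresentation ∧
        ∃ γ : (SLddag hφ).obj S, (actionHom hφ).app S γ = (SO (qH φ)).map f g := by
  obtain ⟨κ, k, hk⟩ := hφ.exists_isTwist
  obtain ⟨e, he⟩ := hφ.exists_isRegularOrthogonal
  let g' : soPoints (qH φ) R := g
  obtain ⟨S, f, hf, l, -, hl, hgl⟩ := he.exists_cover_of_det_eq_one g'.2.1 g'.2.2
  obtain ⟨T, f', hf', γ, hγ, hγl⟩ := hk.exists_cover_hermAction_eq hφ.involutive hl
  refine ⟨T, CommAlgCat.ofHom (f'.comp f), (hf'.comp hf).1, (hf'.comp hf).2,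
    (⟨γ, (hk.isTwistUnitary_iff hφ).mp hγ⟩ : slPoints T hφ), ?_⟩
  refine soPoints_ext (qH φ) ?_
  change hermAction φ hφ.involutive γ.val = extendScalars (f'.comp f) g'.1.toLinearMap
  rw [extendScalars_compHom, hgl, extendScalars_rotationProd f' hl, hγl]

end IsOrthogonalInvolution

end ExactSequence

/-! ### Representability of `SL^‡(2, H)` and `{±I}`. -/

section Algebraicity

variable {F : Type u} [Field F] {H : Type v} [Ring H] [Algebra F H]
  {R S : Type u} [CommRing R] [Algebra F R] [CommRing S] [Algebra F S] {φ : H →ₗ[F] H}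

theorem repr_baseChange_map {ι : Type*} (b : Module.Basis ι F H) (f : R →ₐ[F] S) (x : R ⊗[F] H)
    (i : ι) : (b.baseChange S).repr (Algebra.TensorProduct.map f (AlgHom.id F H) x) i =
      f ((b.baseChange R).repr x i) := by
  induction x with
  | zero => simp
  | tmul a v => simp [Module.Basis.baseChange_repr_tmul]
  | add x y hx hy => simp [hx, hy]

/-- The matrix with given coordinates with respect to a basis of `H`. -/
def matrixOfCoords {m : ℕ} (b : Module.Basis (Fin m) F H) (y : Fin 2 × Fin 2 × Fin m → R) :
    Matrix (Fin 2) (Fin 2) (R ⊗[F] H) :=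
  Matrix.of fun i j => (b.baseChange R).equivFun.symm fun l => y (i, j, l)

theorem repr_matrixOfCoords {m : ℕ} (b : Module.Basis (Fin m) F H)
    (y : Fin 2 × Fin 2 × Fin m → R) (i j : Fin 2) (l : Fin m) :
    (b.baseChange R).repr (matrixOfCoords b y i j) l = y (i, j, l) := by
  rw [matrixOfCoords, Matrix.of_apply, ← Module.Basis.equivFun_apply, LinearEquiv.apply_symm_apply]

theorem matrixOfCoords_repr {m : ℕ} (b : Module.Basis (Fin m) F H)
    (M : Matrix (Fin 2) (Fin 2) (R ⊗[F] H)) :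
    matrixOfCoords b (fun p => (b.baseChange R).repr (M p.1 p.2.1) p.2.2) = M := by
  ext i j
  apply (b.baseChange R).repr.injective
  ext l
  exact repr_matrixOfCoords b _ i j l

theorem matrixOfCoords_comp {m : ℕ} (b : Module.Basis (Fin m) F H) (f : R →ₐ[F] S)
    (y : Fin 2 × Fin 2 × Fin m → R) : matrixOfCoords b (f ∘ y) =
      (Algebra.TensorProduct.map f (AlgHom.id F H)).mapMatrix (matrixOfCoords b y) := by
  ext i j
  apply (b.baseChange S).repr.injective
  ext l
  rw [repr_matrixOfCoords, AlgHom.mapMatrix_apply, Matrix.map_apply, repr_baseChange_map,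
    repr_matrixOfCoords, Function.comp_apply]

variable (φ) in
/-- The elements of `H_R` whose vanishing defines `SL^‡(2, H)`. -/
def slDefect (M : Matrix (Fin 2) (Fin 2) (R ⊗[F] H)) : Fin 3 → R ⊗[F] H :=
  ![φ.baseChange R (M 0 0 * φ.baseChange R (M 0 1)) - M 0 0 * φ.baseChange R (M 0 1),
    φ.baseChange R (M 1 0 * φ.baseChange R (M 1 1)) - M 1 0 * φ.baseChange R (M 1 1),
    M 0 0 * φ.baseChange R (M 1 1) - M 0 1 * φ.baseChange R (M 1 0) - 1]

theorem slDefect_eq_zero_iff (M : Matrix (Fin 2) (Fin 2) (R ⊗[F] H)) :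
    (∀ i, slDefect φ M i = 0) ↔ IsSLddag φ M := by
  simp only [Fin.forall_fin_succ, slDefect, IsSLddag, Matrix.cons_val_zero, Matrix.cons_val_succ,
    sub_eq_zero, IsEmpty.forall_iff, and_true]

theorem slDefect_map (f : R →ₐ[F] S) (M : Matrix (Fin 2) (Fin 2) (R ⊗[F] H)) (i : Fin 3) :
    slDefect φ ((Algebra.TensorProduct.map f (AlgHom.id F H)).mapMatrix M) i =
      Algebra.TensorProduct.map f (AlgHom.id F H) (slDefect φ M i) := by
  fin_cases i <;> simp [slDefect, ← baseChange_map]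

/-- A matrix in `SL^‡(2, H_R)` is invertible. -/
theorem IsSLddag.isUnit [Module.Finite F H] (h1 : ∀ x y, φ (x * y) = φ y * φ x)
    (h2 : ∀ x, φ (φ x) = x) {M : Matrix (Fin 2) (Fin 2) (R ⊗[F] H)} (hM : IsSLddag φ M) :
    IsUnit M := by
  rw [isSLddag_iff h1 h2] at hM
  let J : Matrix (Fin 2) (Fin 2) (R ⊗[F] H) := !![0, 1; -1, 0]
  have hJ : J * -J = 1 := by
    ext i j
    fin_cases i <;> fin_cases j <;> simp [J, Matrix.mul_apply, Fin.sum_univ_two]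
  let N := J * ddagTranspose φ M * -J
  have hMN : M * N = 1 := by
    rw [← hJ, ← mul_assoc, ← mul_assoc]
    exact congrArg (· * -J) hM
  -- The right inverse makes left multiplication by `M` surjective on a finite `R`-module, hence
  -- injective, so the right inverse is two-sided.
  have hinj : Function.Injective (LinearMap.mulLeft R M) := by
    refine OrzechProperty.injective_of_surjective_endomorphism _ fun X => ⟨N * X, ?_⟩
    rw [LinearMap.mulLeft_apply, ← mul_assoc, hMN, one_mul]
  have hNM : N * M = 1 := by
    apply hinj
    rw [LinearMap.mulLeft_apply, LinearMap.mulLeft_apply, ← mul_assoc, hMN, one_mul, mul_one]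
  exact ⟨⟨M, N, hMN, hNM⟩, rfl⟩

variable [Invertible (2 : F)]

/-- The coordinates are those of the four entries in a basis of `H`; the inverse needs none, because
the defining equations force invertibility. -/
theorem isAlgebraicGroup_SLddag [Module.Finite F H] (hφ : IsOrthogonalInvolution φ) :
    (SLddag hφ).IsAlgebraicGroup := by
  let b := Module.finBasis F H
  refine exists_corepresentableBy (SLddag hφ ⋙ forget GrpCat)
    (ι := Fin 2 × Fin 2 × Fin (Module.finrank F H))
    (fun R (γ : slPoints R hφ) p => (b.baseChange R).repr (γ.1.val p.1 p.2.1) p.2.2) ?_ ?_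
    (fun R y (p : Fin 3 × Fin (Module.finrank F H)) =>
      (b.baseChange R).repr (slDefect φ (matrixOfCoords b y) p.1) p.2) ?_ ?_
  · intro R (γ : slPoints R hφ) (δ : slPoints R hφ) h
    refine Subtype.ext (Units.ext ?_)
    rw [← matrixOfCoords_repr b γ.1.val, ← matrixOfCoords_repr b δ.1.val]
    exact congrArg _ h
  · intro R S f (γ : slPoints R hφ)
    funext p
    exact repr_baseChange_map b f.hom _ _
  · intro R S f y
    funext p
    have := matrixOfCoords_comp b f.hom y
    simp only [Function.comp_apply]
    erw [this]
    rw [slDefect_map, repr_baseChange_map]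
  · intro R y
    have h : (fun p : Fin 3 × Fin (Module.finrank F H) =>
        (b.baseChange R).repr (slDefect φ (matrixOfCoords b y) p.1) p.2) = 0 ↔
          IsSLddag φ (matrixOfCoords b y) := by
      rw [← slDefect_eq_zero_iff, funext_iff, Prod.forall]
      refine forall_congr' fun i => ?_
      rw [← LinearEquiv.map_eq_zero_iff (b.baseChange R).repr, Finsupp.ext_iff]
      rfl
    rw [h]
    constructor
    · rintro ⟨γ, rfl⟩
      let γ' : slPoints R hφ := γ
      have := matrixOfCoords_repr b γ'.1.val
      erw [this]
      exact γ'.2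
    · intro hy
      obtain ⟨γ, hγ⟩ := hy.isUnit hφ.map_mul hφ.involutive
      refine ⟨(⟨γ, ?_⟩ : slPoints R hφ), ?_⟩
      · change IsSLddag φ γ.val
        rwa [hγ]
      · funext p
        simp only [hγ]
        exact repr_matrixOfCoords b y _ _ _

/-- The only coordinate is the idempotent `e`, with equation `e² = e`. As `2` is a unit, the matrix
`(2e - 1) I` determines `e`, so the chosen `e` is natural in `R`. -/
theorem isAlgebraicGroup_PlusMinusOne [IsQuaternionAlgebra F H] (hφ : IsOrthogonalInvolution φ) :
    (PlusMinusOne hφ).IsAlgebraicGroup := by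
  have huniq {R : Type u} [CommRing R] [Algebra F R] {e e' : R}
      (h : e • (1 : Matrix (Fin 2) (Fin 2) (R ⊗[F] H)) + (1 - e) • (-1) =
        e' • 1 + (1 - e') • (-1)) : e = e' := by
    rw [smul_add_smul_neg_one, smul_add_smul_neg_one] at h
    exact (isUnit_two_of_algebra F R).mul_left_cancel
      (sub_left_inj.mp (smul_one_matrix_injective h))
  refine exists_corepresentableBy (PlusMinusOne hφ ⋙ forget GrpCat) (ι := Unit)
    (fun R (γ : pmPoints R hφ) _ => γ.2.choose) ?_ ?_
    (fun R y (_ : Unit) => y () * y () - y ()) ?_ ?_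
  · intro R (γ : pmPoints R hφ) (δ : pmPoints R hφ) h
    refine Subtype.ext (Subtype.ext (Units.ext ?_))
    rw [γ.2.choose_spec.2, δ.2.choose_spec.2, show γ.2.choose = δ.2.choose from congrFun h ()]
  · intro R S f (γ : pmPoints R hφ)
    funext _
    let δ : pmPoints S hφ := (PlusMinusOne hφ).map f γ
    refine huniq (δ.2.choose_spec.2.symm.trans ?_)
    change (Algebra.TensorProduct.map f.hom (AlgHom.id F H)).mapMatrix γ.1.1.val = _
    nth_rw 1 [γ.2.choose_spec.2]
    rw [smul_add_smul_neg_one, smul_add_smul_neg_one]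
    ext i j
    have h2 : f.hom (2 : R) = 2 := map_ofNat f.hom 2
    by_cases hij : i = j <;>
      simp [hij, h2, Algebra.TensorProduct.one_def, TensorProduct.smul_tmul']
  · intro R S f y
    funext _
    simp
  · intro R y
    constructor
    · rintro ⟨γ, rfl⟩
      let γ' : pmPoints R hφ := γ
      funext _
      exact sub_eq_zero.mpr γ'.2.choose_spec.1
    · intro hy
      have he : y () * y () = y () := sub_eq_zero.mp (congrFun hy ())
      have hr : (2 * y () - 1) * (2 * y () - 1) = 1 := by linear_combination 4 * he
      have hM : ((2 * y () - 1) • (1 : Matrix (Fin 2) (Fin 2) (R ⊗[F] H))) *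
          ((2 * y () - 1) • 1) = 1 := by
        rw [smul_mul_smul_comm, hr, one_mul, one_smul]
      let γ : (Matrix (Fin 2) (Fin 2) (R ⊗[F] H))ˣ := ⟨_, _, hM, hM⟩
      obtain ⟨κ, k, hk⟩ := hφ.exists_isTwist
      have hγ := (hk.isTwistUnitary_iff hφ).mp
        ((hk.isTwistUnitary_smul_one_iff (γ := γ) rfl).mpr hr)
      have hγ' : (⟨γ, hγ⟩ : slPoints R hφ) ∈ pmPoints R hφ :=
        ⟨y (), he, (smul_add_smul_neg_one _).symm⟩
      refine ⟨(⟨_, hγ'⟩ : pmPoints R hφ), ?_⟩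
      funext _
      exact huniq (hγ'.choose_spec.2.symm.trans (smul_add_smul_neg_one _).symm)

end Algebraicity

/-- The exact sequence `1 → {±I} → SL^‡(2, H) → SO⁰(q_H) → 1`; the second map is induced by
the action `γ · M = γ M γ̄ᵀ` on the Hermitian matrices, which are identified with `F² ⊕ H⁺`. -/
theorem mainTheorem9 {F : Type u} [Field F] [Invertible (2 : F)]
    {H : Type v} [Ring H] [Algebra F H] [IsQuaternionAlgebra F H]
    {φ : H →ₗ[F] H} (hφ : IsOrthogonalInvolution φ) :
    (∀ R : CommAlgCat.{u} F, Set.BijOn (toHermitian R φ) Set.univ (hermitianMatrices R φ)) ∧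
    ∃ (SO₀ : GroupFunctor.{u, max u v} F) (j : SO₀ ⟶ SO (qH φ)) (p : SLddag hφ ⟶ SO₀),
      GroupFunctor.IsIdentityComponent j ∧
      (∀ (R : CommAlgCat.{u} F) (γ : slPoints R hφ) (v : R ⊗[F] (F × F × symmPart φ)),
        toHermitian R φ (((p ≫ j).app R γ : soPoints (qH φ) R).1 v) =
          γ.1.val * toHermitian R φ v * conjTransposeQ γ.1.val) ∧
      GroupFunctor.IsExactSequence (plusMinusOneInclusion hφ) p := by
  obtain ⟨κ, k, hk⟩ := hφ.exists_isTwist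
  obtain ⟨e, he⟩ := hφ.exists_isRegularOrthogonal
  -- By connectedness the identity component is `SO(q_H)` itself, with the identity as inclusion.
  refine ⟨fun R => bijOn_toHermitian hφ.involutive, SO (qH φ), 𝟙 _, hφ.actionHom,
    he.isIdentityComponent_id, fun R γ v => ?_, ?_⟩
  · exact hk.toHermitian_hermAction hφ.involutive ((hk.isTwistUnitary_iff hφ).mpr γ.2) v
  · exact
      { algebraic_left := isAlgebraicGroup_PlusMinusOne hφ
        algebraic_middle := isAlgebraicGroup_SLddag hφ
        algebraic_right := isAlgebraicGroup_SO (qH φ)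
        injective := fun R => Subtype.val_injective
        exact := hφ.actionHom_eq_one_iff
        surjective := hφ.exists_actionHom_eq }

end
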